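/- **Setting.** Let $\mathbb T=\mathbb R/2\pi\mathbb Z$, $\langle x\rangle=\sqrt{1+x^2}$, and write $\widehat u(t,k)=\frac1{2\pi}\int_{\mathbb T}e^{-ikx}u(t,x)\,dx$ and $\widehat u(k,\xi)$ for the spatial and the spacetime Fourier transform, normalized so that $\widehat u(t,k)=\int_{\mathbb R}e^{i\xi t}\,\widehat u(k,\xi)\,d\xi$. Put $\|u\|_{X^{s,b}_{p,q}}=\|\langle k\rangle^s\langle\xi+k^2\rangle^b\,\widehat u(k,\xi)\|_{\ell^p_kL^q_\xi}$. For $2\le p_0<\infty$ and $\delta>0$ let $$Y_0=X^{\frac12,\frac12}_{p_0,r_0},\quad \tfrac1{r_0}=\tfrac12+\delta,\qquad Z_0=X^{\frac12,\,1-2\delta}_{p_0,q_0},\quad q_0=\tfrac1{4\delta}.$$ Elements of these spaces are identified with their representatives that are continuous in time. For $I=[-T,T]$ and $\mathcal Y\in\{Y_0,Z_0\}$ let $\|u\|_{\mathcal Y(I)}$ be the infimum of $\|v\|_{\mathcal Y}$ over all $v$ with $v=u$ on $I$. For $k\in\mathbb Z$ let $\mathbb V_3=\{(k_1,k_2,k_3)\in\mathbb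 Z^3: k_2+k_3-k_1=k,\ |k_2|\ge|k_3|,\ k\notin\{k_2,k_3\}\}\cup\{(k,k,k)\}$ and $$\mathbb X_L=\{(k_1,k_2,k_3)\in\mathbb V_3:|k_2|<2^{-20}|k|\},\qquad \mathbb X_N=\mathbb V_3\setminus(\mathbb X_H\cup\mathbb X_L\cup\mathbb X_S),$$ where $\mathbb X_H=\{(k_1,k_2,k_3)\in\mathbb V_3:|k_3|\ge2^{-20}|k|\}$ and $\mathbb X_S=\{(k_1,k_2,k_3)\in\mathbb V_3:2^{-10}|k_1|\le|k_3|<2^{-20}|k|\}$. Let $\Delta=k^2+k_1^2-k_2^2-k_3^2$. Given a Schwartz function $\eta:\mathbb R\to\mathbb C$ and a bounded function $M_3:\mathbb Z^4\to\mathbb C$, define for $*\in\{N,L\}$ the operator $E^Y_*$ by giving the $k$-th spatial Fourier coefficient of $E^Y_*(v_1,v_2,v_3)$ at time $t$ as $$\sum_{(k_1,k_2,k_3)\in\mathbb X_*}k_1M_3(k,k_1,k_2,k_3)\int_0^te^{-i(t-s)k^2}\,\eta(\Delta(t-s))\,\overline{\widehat v_1(s,k_1)}\,\widehat v_2(s,k_2)\,\widehat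 v_3(s,k_3)\,ds .$$ **Proposition 4.4.** Let $2\le p_0<\infty$, and let $\delta>0$ be sufficiently small depending on $p_0$. Let $A_2>0$, let $A_3$ be sufficiently large depending on $p_0,\delta,A_2$, let $\eta$ be a Schwartz function and let $B\in\mathbb R$. Then there are $L\ge0$ and $T_0>0$, depending only on $p_0,\delta,A_2,A_3,\eta,B$, such that for every $0<T\le T_0$, with $I=[-T,T]$, and every $M_3$ with $|M_3|\le B$, the following hold. 1. If $\|w\|_{Z_0(I)}\le A_2$ and $\|v\|_{Y_0(I)}\le A_3$, then for every $t\in I$ and $k\in\mathbb Z$ the integrals that define the $k$-th Fourier coefficients of $E^Y_N(w,w,v)$ and $E^Y_L(w,v,v)$ at time $t$ exist, and the sums over frequencies converge absolutely. 2. For every $w$ with $\|w\|_{Z_0(I)}\le A_2$ there is a unique $v$ on $I$ with $\|v\|_{Y_0(I)}\le A_3$ such that, on $I$, $$v=w+E^Y_N(w,w,v)+E^Y_L(w,v,v).$$ 3. The resulting map $w\mapsto v[w]$ satisfies $\|v[w]-v[w']\|_{Y_0(I)}\le L\,\|w-w'\|_{Z_0(I)}$ for all $w,w'$ in the $A_2$-ball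 of $Z_0(I)$. 4. The solution submanifold $$\mathcal W=\{v:\|v\|_{Y_0(I)}\le A_3\text{ and there is }w\text{ with }\|w\|_{Z_0(I)}\le A_2\text{ and }v=w+E^Y_N(w,w,v)+E^Y_L(w,v,v)\}$$ is the image of the $A_2$-ball of $Z_0(I)$ under this map. -/

import Mathlib

open MeasureTheory
open scoped ENNReal NNReal

noncomputable section

namespace DNLS

instance fact_two_pi_pos : Fact ((0 : ℝ) < 2 * Real.pi) := ⟨Real.two_pi_pos⟩

/-- The space `L²(𝕋)`, `𝕋 = ℝ / 2πℤ`, with normalized Haar measure. Spacetime functions are maps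
from times to `L²(𝕋)`. Since `H_p^{1/2}(𝕋) ⊆ L²(𝕋)` for `p < ∞`, this contains
all values of elements of the spaces `Y₀` and `Z₀` below. -/
abbrev L2T : Type := Lp ℂ 2 (AddCircle.haarAddCircle (T := 2 * Real.pi))

/-- Spatial Fourier coefficient `û(k) = (2π)⁻¹ ∫_𝕋 e^{-ikx} u(x) dx`. -/
def xhat (u : L2T) (k : ℤ) : ℂ := fourierCoeff (T := 2 * Real.pi) (u : AddCircle (2 * Real.pi) → ℂ) k

/-- Japanese bracket `⟨x⟩ = √(1 + x²)`. -/
def jb (x : ℝ) : ℝ := Real.sqrt (1 + x ^ 2)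

/-! ### Fourier restriction norms -/

/-- `U` is the spacetime Fourier transform of `u`, where the time Fourier transform is
normalized as `(2π)⁻¹ ∫ e^{-iξt} u(t) dt`, so that inversion reads `û(k, t) = ∫ e^{iξt} U(k, ξ) dξ`.

The formula is required at every time: `u` is then the representative which is continuous in time.
In the spaces `X_{p,q}^{s,b}` with `b + 1/q > 1` (this includes `Y₀` and `Z₀`) the spacetime
Fourier transform of every element is integrable in `ξ`, so nothing is lost. -/
def HasSpacetimeFourier (u : ℝ → L2T) (U : ℤ → ℝ → ℂ) : Prop :=
  ∀ k : ℤ, Integrable (U k) ∧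
    ∀ t : ℝ, xhat (u t) k = ∫ ξ : ℝ, Complex.exp (Complex.I * (ξ : ℂ) * (t : ℂ)) * U k ξ

/-- `‖ ⟨k⟩^s ⟨ξ + k²⟩^b U(k, ξ) ‖_{ℓ^p_k L^q_ξ}`. -/
def fourierSideNorm (s b p q : ℝ) (U : ℤ → ℝ → ℂ) : ℝ≥0∞ :=
  (∑' k : ℤ,
    (eLpNorm (fun ξ : ℝ => ((jb (k : ℝ) ^ s * jb (ξ + (k : ℝ) ^ 2) ^ b : ℝ) : ℂ) * U k ξ)
      (ENNReal.ofReal q) volume) ^ p) ^ (1 / p)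

/-- The norm of `X_{p,q}^{s,b}`; it is `∞` when `u` is not in the space. The spacetime Fourier
transform is unique up to null sets, so the infimum is over equal values. -/
def XNorm (s b p q : ℝ) (u : ℝ → L2T) : ℝ≥0∞ :=
  ⨅ (U : ℤ → ℝ → ℂ) (_ : HasSpacetimeFourier u U), fourierSideNorm s b p q U

/-- The norm of `Y₀ = X_{p₀,r₀}^{1/2,1/2}`, with `1/r₀ = 1/2 + δ`. -/
def Y0Norm (p₀ δ : ℝ) (u : ℝ → L2T) : ℝ≥0∞ :=
  XNorm (1 / 2) (1 / 2) p₀ (1 / (1 / 2 + δ)) u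

/-- The norm of `Z₀ = X_{p₀,q₀}^{1/2,b₀}`, with `b₀ = 1 - 2δ` and `q₀ = 1/(4δ)`. -/
def Z0Norm (p₀ δ : ℝ) (u : ℝ → L2T) : ℝ≥0∞ :=
  XNorm (1 / 2) (1 - 2 * δ) p₀ (1 / (4 * δ)) u

/-- Spacetime functions on the time interval `I = [-T, T]`. -/
abbrev OnI (T : ℝ) : Type := Set.Icc (-T) T → L2T

/-- The restriction of a spacetime norm to `I = [-T, T]`: the infimum of the norms of all
extensions (`∞` if there is none of finite norm). -/
def restrictedNorm (N : (ℝ → L2T) → ℝ≥0∞) {T : ℝ} (u : OnI T) : ℝ≥0∞ :=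
  ⨅ (V : ℝ → L2T) (_ : ∀ t : Set.Icc (-T) T, V t = u t), N V

/-- The norm of `Y₀(I)`. -/
def Y0NormI (p₀ δ : ℝ) {T : ℝ} (u : OnI T) : ℝ≥0∞ := restrictedNorm (Y0Norm p₀ δ) u

/-- The norm of `Z₀(I)`. -/
def Z0NormI (p₀ δ : ℝ) {T : ℝ} (u : OnI T) : ℝ≥0∞ := restrictedNorm (Z0Norm p₀ δ) u

/-- The closed ball of radius `A` about `0` in `Y₀(I)`. -/
def ballY (p₀ δ T A : ℝ) : Set (OnI T) := {v | Y0NormI p₀ δ v ≤ ENNReal.ofReal A}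

/-- The closed ball of radius `A` about `0` in `Z₀(I)`. -/
def ballZ (p₀ δ T A : ℝ) : Set (OnI T) := {w | Z0NormI p₀ δ w ≤ ENNReal.ofReal A}

/-! ### Splitting of the frequency set of the cubic nonlinearity -/

/-- The set `𝕍₃` for output frequency `k`; a triple is `(k₁, k₂, k₃)`. -/
def V3 (k : ℤ) : Set (ℤ × ℤ × ℤ) :=
  {κ | κ.2.1 + κ.2.2 - κ.1 = k ∧ |κ.2.2| ≤ |κ.2.1| ∧ k ≠ κ.2.1 ∧ k ≠ κ.2.2} ∪ {(k, k, k)}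

/-- The high-high part `|k₃| ≥ 2⁻²⁰ |k|`. -/
def XH (k : ℤ) : Set (ℤ × ℤ × ℤ) :=
  {κ | κ ∈ V3 k ∧ |(k : ℝ)| / 2 ^ 20 ≤ |(κ.2.2 : ℝ)|}

/-- The low-low part `|k₂| < 2⁻²⁰ |k|`. -/
def XL (k : ℤ) : Set (ℤ × ℤ × ℤ) :=
  {κ | κ ∈ V3 k ∧ |(κ.2.1 : ℝ)| < |(k : ℝ)| / 2 ^ 20}

/-- The semilinear part `2⁻¹⁰ |k₁| ≤ |k₃| < 2⁻²⁰ |k|`. -/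
def XS (k : ℤ) : Set (ℤ × ℤ × ℤ) :=
  {κ | κ ∈ V3 k ∧ |(κ.1 : ℝ)| / 2 ^ 10 ≤ |(κ.2.2 : ℝ)| ∧ |(κ.2.2 : ℝ)| < |(k : ℝ)| / 2 ^ 20}

/-- The non-resonant part, the rest of `𝕍₃`. -/
def XN (k : ℤ) : Set (ℤ × ℤ × ℤ) := V3 k \ (XH k ∪ XL k ∪ XS k)

/-- `Δ = k² + k₁² - k₂² - k₃²`. -/
def Delta (k : ℤ) (κ : ℤ × ℤ × ℤ) : ℤ := k ^ 2 + κ.1 ^ 2 - κ.2.1 ^ 2 - κ.2.2 ^ 2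

/-- The coefficient `M₃(k, k₁, k₂, k₃)` of the cubic nonlinearity of the gauged equation: on the
Fourier side, `-v² ∂ₓv̄ - (i/π) (Im ∫_𝕋 v̄ ∂ₓv dx) v` has coefficients
`∑_{𝕍₃} k₁ M₃ conj(v̂(k₁)) v̂(k₂) v̂(k₃)`. The symmetry between `k₂` and `k₃` is used to
restrict to `|k₂| ≥ |k₃|`. -/
def gaugeM3 (k k₁ k₂ k₃ : ℤ) : ℂ :=
  if k₁ = k ∧ k₂ = k ∧ k₃ = k then -Complex.I
  else if |k₂| = |k₃| then Complex.I else 2 * Complex.I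

/-- The coefficient of the gauged equation is bounded, so the theorem, which treats all bounded
coefficients, applies to it. -/
theorem norm_gaugeM3_le (k k₁ k₂ k₃ : ℤ) : ‖gaugeM3 k k₁ k₂ k₃‖ ≤ 2 := by
  unfold gaugeM3
  split_ifs <;> simp

/-! ### The modified Duhamel operators `E_*^Y` -/

/-- The integrand, as a function of `s`, in the contribution of the frequencies `κ = (k₁, k₂, k₃)` to
the `k`-th Fourier coefficient of `E_*^Y(v₁, v₂, v₃)` at time `t`. -/
def EYIntegrand (η : SchwartzMap ℝ ℂ) (v₁ v₂ v₃ : ℝ → L2T) (k : ℤ) (t : ℝ) (κ : ℤ × ℤ × ℤ)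
    (s : ℝ) : ℂ :=
  Complex.exp (-Complex.I * ((t - s : ℝ) : ℂ) * (k : ℂ) ^ 2) *
    η ((Delta k κ : ℝ) * (t - s)) *
    (starRingEnd ℂ (xhat (v₁ s) κ.1) * xhat (v₂ s) κ.2.1 * xhat (v₃ s) κ.2.2)

/-- The contribution of the frequencies `κ = (k₁, k₂, k₃)` to the `k`-th Fourier coefficient of
`E_*^Y(v₁, v₂, v₃)` at time `t`. -/
def EYTerm (M : ℤ → ℤ → ℤ → ℤ → ℂ) (η : SchwartzMap ℝ ℂ) (v₁ v₂ v₃ : ℝ → L2T)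
    (k : ℤ) (t : ℝ) (κ : ℤ × ℤ × ℤ) : ℂ :=
  (κ.1 : ℂ) * M k κ.1 κ.2.1 κ.2.2 * ∫ s in (0 : ℝ)..t, EYIntegrand η v₁ v₂ v₃ k t κ s

/-- The `k`-th Fourier coefficient at time `t` of the modified Duhamel operator whose frequency
interactions are those in the sets `X k`: for `X = XN` this is `E_N^Y`, for `X = XL` it
is `E_L^Y`. -/
def EY (X : ℤ → Set (ℤ × ℤ × ℤ)) (M : ℤ → ℤ → ℤ → ℤ → ℂ) (η : SchwartzMap ℝ ℂ)
    (v₁ v₂ v₃ : ℝ → L2T) (k : ℤ) (t : ℝ) : ℂ :=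
  ∑' κ : X k, EYTerm M η v₁ v₂ v₃ k t κ

open Classical in
/-- Extension by zero from `[-T, T]` to `ℝ`. For `|t| ≤ T` the operators `E_*^Y` at time `t` only
involve times between `0` and `t`, so the values outside `[-T, T]` never matter. -/
def zeroExt {T : ℝ} (v : OnI T) : ℝ → L2T :=
  fun t => if h : t ∈ Set.Icc (-T) T then v ⟨t, h⟩ else 0

/-- The time integrals that define `E_N^Y(w, w, v)` and `E_L^Y(w, v, v)` on `[-T, T]` exist, and the
frequency sums converge absolutely. -/
def EYConverges (M : ℤ → ℤ → ℤ → ℤ → ℂ) (η : SchwartzMap ℝ ℂ) {T : ℝ} (w v : OnI T) : Prop :=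
  ∀ t : Set.Icc (-T) T, ∀ k : ℤ,
    (∀ κ : XN k, IntervalIntegrable
      (EYIntegrand η (zeroExt w) (zeroExt w) (zeroExt v) k t κ) volume 0 t) ∧
    (∀ κ : XL k, IntervalIntegrable
      (EYIntegrand η (zeroExt w) (zeroExt v) (zeroExt v) k t κ) volume 0 t) ∧
    Summable (fun κ : XN k => EYTerm M η (zeroExt w) (zeroExt w) (zeroExt v) k t κ) ∧
    Summable (fun κ : XL k => EYTerm M η (zeroExt w) (zeroExt v) (zeroExt v) k t κ)

/-- `v = w + E_N^Y(w, w, v) + E_L^Y(w, v, v)` on `[-T, T]`. -/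
def SolvesEq (M : ℤ → ℤ → ℤ → ℤ → ℂ) (η : SchwartzMap ℝ ℂ) {T : ℝ} (w v : OnI T) : Prop :=
  ∀ t : Set.Icc (-T) T, ∀ k : ℤ,
    xhat (v t) k = xhat (w t) k
      + EY XN M η (zeroExt w) (zeroExt w) (zeroExt v) k t
      + EY XL M η (zeroExt w) (zeroExt v) (zeroExt v) k t

/-- The solution submanifold `𝒲` of `Y₀(I)`. -/
def solutionManifold (p₀ δ : ℝ) (M : ℤ → ℤ → ℤ → ℤ → ℂ) (η : SchwartzMap ℝ ℂ) (T A₂ A₃ : ℝ) :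
    Set (OnI T) :=
  {v | v ∈ ballY p₀ δ T A₃ ∧ ∃ w ∈ ballZ p₀ δ T A₂, SolvesEq M η w v}

end DNLS

end

noncomputable section

namespace DNLS

/-! ### The Japanese bracket -/

/-! On the complete normed group $Y_0(I)$ the equation is a fixed point problem. Each of $E^Y_N$ and
$E^Y_L$ is a trilinear map of $Y_0(I)$ with norm $O(BT^\theta)$, $\theta=1/(100p_0)$
(`Exponents.exists_isTrilinear`). For $T$ small in terms of $A_3$ this norm times $A_3^2$ is at most
$1/8$, so the contraction principle applies (`exists_solution`, `norm_sub_le_of_solves`). The data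
enter through the embedding $Z_0(I)\subseteq Y_0(I)$, and $A_3$ is taken so large that the
$A_2$-ball of $Z_0(I)$ lies in the ball of radius $A_3/2$ of $Y_0(I)$.

The trilinear bound rests on $\Delta=2(k-k_2)(k-k_3)$. On $\mathbb X_N$ and $\mathbb X_L$ one has
$|k||k_1|\le4|\Delta|$, so the derivative $k_1$, together with the weights at $k$ and $k_1$, costs
$|\Delta|^{1/2}$ (`Nonresonant.weight_le`). The factor $\eta(\Delta(t-s))$ shortens the memory of
the Duhamel integral to $|\Delta|^{-1}$: localized to times of size $T$ and applied to $e^{i\nu s}$,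
its Fourier transform is
$O(T^\theta|\Delta|^{-1/2}\langle\xi+k^2\rangle^{-1/2}\langle\xi-\nu\rangle^{-1+\theta})$
(`exists_kernel_le`). The first power of $\Delta$ pays for the derivative and the second bracket
supplies the modulation weight of the output.

It remains to sum $\langle k_2\rangle^{-1/2}\langle
k_3\rangle^{-1/2}\langle\xi-\nu\rangle^{-1+\theta}$ against the three inputs
(`Exponents.exists_trilinear_le`). Here $\xi-\nu$ is a signed sum of modulations minus $\Delta$. The
weight is split into two factors and Hölder is used with $r_0$ and $r_0'$. The factor in
$\ell^{r_0'}$ is summable because few interactions share a value of $\Delta$: they are counted by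
divisors, and there are at most two when $4k_2^2<|k|$ (`exists_tsum_modulation_le`). The other
factor is integrable in $\xi$ and leaves a frequency sum in $\ell^{p_0/r_0}$, whose exponents close
because $\delta p_0<1/100$.

For the functional analysis, $Y_0$ is modelled on $\ell^{p_0}(L^{r_0})$ through weighted Fourier
transforms, and $Y_0(I)$ carries the resulting quotient norm. The absolute bounds behind the
trilinear estimate also give the existence of all integrals and sums. -/

theorem one_le_jb (x : ℝ) : 1 ≤ jb x := by
  rw [jb, Real.one_le_sqrt]; nlinarith [sq_nonneg x]

theorem jb_pos (x : ℝ) : 0 < jb x := lt_of_lt_of_le one_pos (one_le_jb x)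

theorem sq_jb (x : ℝ) : jb x ^ 2 = 1 + x ^ 2 := Real.sq_sqrt (by positivity)

theorem abs_le_jb (x : ℝ) : |x| ≤ jb x :=
  abs_le_of_sq_le_sq (by rw [sq_jb]; linarith) (jb_pos x).le

theorem jb_le_one_add_abs (x : ℝ) : jb x ≤ 1 + |x| := by
  rw [jb, Real.sqrt_le_left (by positivity)]
  nlinarith [sq_abs x, abs_nonneg x]

theorem jb_neg (x : ℝ) : jb (-x) = jb x := by simp [jb]

theorem jb_le_jb {x y : ℝ} (h : |x| ≤ |y|) : jb x ≤ jb y := by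
  unfold jb
  exact Real.sqrt_le_sqrt (by have := sq_le_sq.mpr h; linarith)

theorem jb_add_le (x y : ℝ) : jb (x + y) ≤ 2 * jb x * jb y := by
  apply le_of_sq_le_sq _ (by have := jb_pos x; have := jb_pos y; positivity)
  have h : (2 * jb x * jb y) ^ 2 = 4 * (jb x ^ 2 * jb y ^ 2) := by ring
  rw [h, sq_jb, sq_jb, sq_jb]
  nlinarith [sq_nonneg (x - y), sq_nonneg (x * y), sq_nonneg x, sq_nonneg y]

theorem continuous_jb : Continuous jb := by
  unfold jb; fun_prop

theorem continuous_jb_rpow (a : ℝ) : Continuous fun x => jb x ^ a :=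
  continuous_jb.rpow_const fun x => Or.inl (jb_pos x).ne'

theorem measurable_jb_rpow (a : ℝ) : Measurable fun x => jb x ^ a :=
  (continuous_jb_rpow a).measurable

theorem jb_rpow_eq (x a : ℝ) : jb x ^ a = (1 + ‖x‖ ^ 2) ^ (a / 2) := by
  rw [jb, Real.sqrt_eq_rpow, ← Real.rpow_mul (by positivity), Real.norm_eq_abs, sq_abs]
  ring_nf

theorem integrable_jb_rpow {a : ℝ} (ha : 1 < a) : Integrable fun x : ℝ => jb x ^ (-a) := by
  have := integrable_rpow_neg_one_add_norm_sq (E := ℝ) (μ := volume) (r := a) (by simpa using ha)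
  simpa only [jb_rpow_eq] using this

/-- The power `⟨x⟩^a` with values in `[0, ∞]`. -/
def jbe (x a : ℝ) : ℝ≥0∞ := ENNReal.ofReal (jb x ^ a)

theorem measurable_jbe (a : ℝ) : Measurable fun x => jbe x a :=
  (measurable_jb_rpow a).ennreal_ofReal

theorem jbe_ne_top (x a : ℝ) : jbe x a ≠ ∞ := ENNReal.ofReal_ne_top

theorem jbe_zero (x : ℝ) : jbe x 0 = 1 := by simp [jbe]

theorem jbe_add (x a b : ℝ) : jbe x (a + b) = jbe x a * jbe x b := by
  rw [jbe, Real.rpow_add (jb_pos x), ENNReal.ofReal_mul (Real.rpow_nonneg (jb_pos x).le _)]; rfl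

theorem jbe_mul_neg (x a : ℝ) : jbe x a * jbe x (-a) = 1 := by
  rw [← jbe_add]; simp [jbe_zero]

theorem jbe_rpow (x a b : ℝ) : jbe x a ^ b = jbe x (a * b) := by
  rw [jbe, jbe, Real.rpow_mul (jb_pos x).le,
    ENNReal.ofReal_rpow_of_pos (Real.rpow_pos_of_pos (jb_pos x) _)]

theorem jbe_mono (x : ℝ) {a b : ℝ} (h : a ≤ b) : jbe x a ≤ jbe x b :=
  ENNReal.ofReal_le_ofReal (Real.rpow_le_rpow_of_exponent_le (one_le_jb x) h)

theorem jbe_le_one (x : ℝ) {a : ℝ} (h : a ≤ 0) : jbe x a ≤ 1 :=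
  (jbe_mono x h).trans (jbe_zero x).le

theorem lintegral_jbe_lt_top {a : ℝ} (ha : 1 < a) : ∫⁻ x, jbe x (-a) < ∞ :=
  (integrable_jb_rpow ha).lintegral_lt_top

theorem summable_jb_rpow {a : ℝ} (ha : 1 < a) : Summable fun k : ℤ => jb k ^ (-a) := by
  have h : Summable fun k : ℤ => |(k : ℝ)| ^ (-a) := Real.summable_abs_int_rpow ha
  refine Summable.of_norm_bounded_eventually h ?_
  have : ∀ k : ℤ, k ≠ 0 → ‖jb k ^ (-a)‖ ≤ |(k : ℝ)| ^ (-a) := by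
    intro k hk
    rw [Real.norm_of_nonneg (Real.rpow_nonneg (jb_pos _).le _)]
    exact Real.rpow_le_rpow_of_nonpos (by positivity) (abs_le_jb _) (by linarith)
  rw [Filter.eventually_cofinite]
  refine (Set.finite_singleton (0 : ℤ)).subset fun k hk => ?_
  by_contra h0
  exact hk (this k h0)

theorem tsum_jbe_lt_top {a : ℝ} (ha : 1 < a) : ∑' k : ℤ, jbe k (-a) < ∞ :=
  lt_top_iff_ne_top.mpr (summable_jb_rpow ha).tsum_ofReal_ne_top

theorem jbe_le_of_le_mul {x y c a : ℝ} (hc : 0 < c) (h : jb y ≤ c * jb x) (ha : 0 ≤ a) :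
    jbe x (-a) ≤ ENNReal.ofReal (c ^ a) * jbe y (-a) := by
  rw [jbe, jbe, ← ENNReal.ofReal_mul (by positivity)]
  apply ENNReal.ofReal_le_ofReal
  rw [Real.rpow_neg (jb_pos x).le, Real.rpow_neg (jb_pos y).le, ← div_eq_mul_inv, ← one_div,
    div_le_div_iff₀ (Real.rpow_pos_of_pos (jb_pos x) a) (Real.rpow_pos_of_pos (jb_pos y) a), one_mul,
    ← Real.mul_rpow hc.le (jb_pos x).le]
  exact Real.rpow_le_rpow (jb_pos y).le h ha

/-- A sum of brackets over a shifted lattice is bounded uniformly in the shift. -/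
theorem exists_tsum_jbe_sub_le {a : ℝ} (ha : 1 < a) :
    ∃ C : ℝ≥0∞, C ≠ ∞ ∧ ∀ x : ℝ, ∑' m : ℤ, jbe (x - m) (-a) ≤ C := by
  refine ⟨ENNReal.ofReal (4 ^ a) * ∑' m : ℤ, jbe m (-a),
    ENNReal.mul_ne_top ENNReal.ofReal_ne_top (tsum_jbe_lt_top ha).ne, fun x => ?_⟩
  have key : ∀ m : ℤ, jbe (x - m) (-a) ≤
      ENNReal.ofReal (4 ^ a) * jbe ((m - ⌊x⌋ : ℤ) : ℝ) (-a) := by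
    intro m
    refine jbe_le_of_le_mul (by norm_num) ?_ (by linarith)
    have h1 : ((m - ⌊x⌋ : ℤ) : ℝ) = -(x - m) + Int.fract x := by
      push_cast [Int.fract]; ring
    have h2 : jb (Int.fract x) ≤ 2 := by
      have := jb_le_one_add_abs (Int.fract x)
      rw [abs_of_nonneg (Int.fract_nonneg x)] at this
      linarith [Int.fract_lt_one x]
    rw [h1]
    refine (jb_add_le _ _).trans ?_
    rw [jb_neg]
    nlinarith [jb_pos (x - m)]
  refine (ENNReal.tsum_le_tsum key).trans ?_
  rw [ENNReal.tsum_mul_left]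
  refine mul_le_mul_right (le_of_eq ?_) _
  exact (Equiv.subRight ⌊x⌋).tsum_eq fun m : ℤ => jbe m (-a)

/-! ### The divisor bound -/

/-- One prime's share of the divisor bound. If $p^\varepsilon\ge2$ then $p^{a\varepsilon}\ge2^a\ge
a+1$ with no loss. The finitely many smaller primes lose a constant, obtained from $1+x\le e^x$. -/
theorem add_one_le_mul_rpow {ε : ℝ} (hε : 0 < ε) {p : ℕ} (hp : p.Prime) (a : ℕ) :
    (a + 1 : ℝ) ≤ (if p < ⌈(2 : ℝ) ^ (1 / ε)⌉₊ then 1 + 1 / (ε * Real.log 2) else 1) *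
      ((p : ℝ) ^ a) ^ ε := by
  have hl : 0 < Real.log 2 := Real.log_pos (by norm_num)
  have hp2 : (2 : ℝ) ≤ p := by exact_mod_cast hp.two_le
  have hpow : ((p : ℝ) ^ a) ^ ε = ((p : ℝ) ^ ε) ^ a := by
    rw [← Real.rpow_natCast, ← Real.rpow_mul (by positivity), ← Real.rpow_natCast,
      ← Real.rpow_mul (by positivity), mul_comm]
  split_ifs with h
  · have h1 : 1 + a * (ε * Real.log 2) ≤ ((p : ℝ) ^ a) ^ ε := by
      have h2 : ((2 : ℝ) ^ a) ^ ε ≤ ((p : ℝ) ^ a) ^ ε := by gcongr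
      refine le_trans ?_ h2
      rw [← Real.rpow_natCast, ← Real.rpow_mul (by positivity), Real.rpow_def_of_pos (by positivity)]
      have := Real.add_one_le_exp (Real.log 2 * (a * ε))
      linarith
    have h3 : (0 : ℝ) < ε * Real.log 2 := by positivity
    calc (a + 1 : ℝ) ≤ (1 + 1 / (ε * Real.log 2)) * (1 + a * (ε * Real.log 2)) := by
          have : (1 + 1 / (ε * Real.log 2)) * (1 + a * (ε * Real.log 2))
            = a + 1 + (a * (ε * Real.log 2) + 1 / (ε * Real.log 2)) := by field_simp; ring
          rw [this]
          have : 0 ≤ a * (ε * Real.log 2) + 1 / (ε * Real.log 2) := by positivity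
          linarith
      _ ≤ _ := by gcongr
  · rw [one_mul, hpow]
    have h1 : (2 : ℝ) ≤ (p : ℝ) ^ ε := by
      have h2 : (2 : ℝ) ^ (1 / ε) ≤ p := Nat.ceil_le.mp (not_lt.mp h)
      calc (2 : ℝ) = ((2 : ℝ) ^ (1 / ε)) ^ ε := by
            rw [← Real.rpow_mul (by norm_num), one_div_mul_cancel hε.ne', Real.rpow_one]
        _ ≤ _ := by gcongr
    calc (a + 1 : ℝ) ≤ 2 ^ a := by exact_mod_cast Nat.lt_two_pow_self
      _ ≤ _ := by gcongr

/-- The divisor bound `d(n) ≤ C n^ε`. -/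
theorem exists_card_divisors_le {ε : ℝ} (hε : 0 < ε) :
    ∃ C : ℝ, 1 ≤ C ∧ ∀ n : ℕ, n ≠ 0 → (n.divisors.card : ℝ) ≤ C * (n : ℝ) ^ ε := by
  have hl : 0 < Real.log 2 := Real.log_pos (by norm_num)
  set c : ℝ := 1 + 1 / (ε * Real.log 2) with hc
  have hc1 : 1 ≤ c := by rw [hc]; have : 0 ≤ 1 / (ε * Real.log 2) := by positivity
                         linarith
  set N : ℕ := ⌈(2 : ℝ) ^ (1 / ε)⌉₊ with hN
  refine ⟨c ^ N, one_le_pow₀ hc1, fun n hn => ?_⟩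
  rw [Nat.card_divisors hn]
  push_cast
  have h1 : ∏ p ∈ n.primeFactors, ((n.factorization p : ℝ) + 1) ≤
      ∏ p ∈ n.primeFactors, ((if p < N then c else 1) * ((p : ℝ) ^ n.factorization p) ^ ε) := by
    refine Finset.prod_le_prod (fun p _ => by positivity) fun p hp => ?_
    exact add_one_le_mul_rpow hε (Nat.prime_of_mem_primeFactors hp) _
  refine h1.trans ?_
  rw [Finset.prod_mul_distrib]
  have h2 : ∏ p ∈ n.primeFactors, ((p : ℝ) ^ n.factorization p) ^ ε = (n : ℝ) ^ ε := by
    rw [Real.finsetProd_rpow _ _ (fun p _ => by positivity)]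
    congr 1
    have := Nat.prod_factorization_pow_eq_self hn
    conv_rhs => rw [← this]
    rw [Finsupp.prod, Nat.support_factorization]
    push_cast
    rfl
  rw [h2]
  gcongr
  rw [Finset.prod_ite, Finset.prod_const, Finset.prod_const_one, mul_one]
  refine pow_le_pow_right₀ hc1 ?_
  calc (n.primeFactors.filter (· < N)).card ≤ (Finset.range N).card :=
        Finset.card_le_card fun p hp => by simpa using (Finset.mem_filter.mp hp).2
    _ = N := Finset.card_range N

/-! ### The frequency interactions -/

/-- This factorization makes interactions of a given modulation correspond to divisors. -/
theorem Delta_eq {k : ℤ} {κ : ℤ × ℤ × ℤ} (h : κ.2.1 + κ.2.2 - κ.1 = k) :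
    Delta k κ = 2 * ((k - κ.2.1) * (k - κ.2.2)) := by
  have : κ.1 = κ.2.1 + κ.2.2 - k := by linarith
  rw [Delta, this]; ring

/-- What the frequency sets `𝕏_N` and `𝕏_L` have in common: this is all the estimates use. -/
structure Nonresonant (k : ℤ) (κ : ℤ × ℤ × ℤ) : Prop where
  sum_eq : κ.2.1 + κ.2.2 - κ.1 = k
  abs_le : |κ.2.2| ≤ |κ.2.1|
  ne_left : k ≠ κ.2.1
  ne_right : k ≠ κ.2.2
  mul_le : |(k : ℝ)| * |(κ.1 : ℝ)| ≤ 4 * |(Delta k κ : ℝ)|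
  delta_le : |(Delta k κ : ℝ)| ≤ 2 ^ 43 * jb κ.2.1 ^ 4 ∨ 4 * κ.2.1 ^ 2 < |k|

theorem Nonresonant.of_mem_V3 {k : ℤ} {κ : ℤ × ℤ × ℤ} (h : κ ∈ V3 k) (h3 : |κ.2.2| ≤ |κ.2.1|)
    (h4 : k ≠ κ.2.1) (h5 : k ≠ κ.2.2)
    (hb : |(k : ℝ)| * |(κ.1 : ℝ)| ≤ 8 * (|(k : ℝ) - κ.2.1| * |(k : ℝ) - κ.2.2|))
    (hd : |(k : ℝ) - κ.2.1| * |(k : ℝ) - κ.2.2| ≤ 2 ^ 42 * jb κ.2.1 ^ 4 ∨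
      4 * κ.2.1 ^ 2 < |k|) : Nonresonant k κ := by
  have h2 : κ.2.1 + κ.2.2 - κ.1 = k := by
    rcases h with h | h
    · exact h.1
    · rw [Set.mem_singleton_iff] at h
      rw [h]; ring
  have hD : |(Delta k κ : ℝ)| = 2 * (|(k : ℝ) - κ.2.1| * |(k : ℝ) - κ.2.2|) := by
    rw [Delta_eq h2]; push_cast; rw [abs_mul, abs_mul]; simp
  refine ⟨h2, h3, h4, h5, by rw [hD]; linarith, hd.imp (fun h => ?_) id⟩
  rw [hD]; linarith

/-- Both $k_2$ and $k_3$ are negligible against $k$, so $|k-k_2|$ and $|k-k_3|$ lie between $|k|/2$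
and $2|k|$, while $|k_1|\le2|k|$. The modulation is thus of size $k^2$, which is bounded by $\langle
k_2\rangle^4$ unless $k_2^2$ is small against $|k|$. -/
theorem nonresonant_of_mem_XL {k : ℤ} {κ : ℤ × ℤ × ℤ} (h : κ ∈ XL k) : Nonresonant k κ := by
  obtain ⟨hV, hL⟩ := h
  have hV' := hV
  rcases hV' with ⟨h1, h2, h3, h4⟩ | hV'
  · have h2' : |(κ.2.2 : ℝ)| ≤ |(κ.2.1 : ℝ)| := by exact_mod_cast h2
    have e1 : (κ.1 : ℝ) = κ.2.1 + κ.2.2 - k := by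
      have : κ.1 = κ.2.1 + κ.2.2 - k := by linarith
      rw [this]; push_cast; ring
    have k0 := abs_nonneg (k : ℝ)
    have a1 : |(k : ℝ)| / 2 ≤ |(k : ℝ) - κ.2.1| := by
      have := abs_sub_abs_le_abs_sub (k : ℝ) κ.2.1; linarith
    have a2 : |(k : ℝ)| / 2 ≤ |(k : ℝ) - κ.2.2| := by
      have := abs_sub_abs_le_abs_sub (k : ℝ) κ.2.2; linarith
    have a3 : |(κ.1 : ℝ)| ≤ 2 * |(k : ℝ)| := by
      rw [e1]
      have := abs_sub ((κ.2.1 : ℝ) + κ.2.2) k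
      have := abs_add_le (κ.2.1 : ℝ) κ.2.2
      linarith
    have b1 : |(k : ℝ) - κ.2.1| ≤ 2 * |(k : ℝ)| := by
      have := abs_sub (k : ℝ) κ.2.1; linarith
    have b2 : |(k : ℝ) - κ.2.2| ≤ 2 * |(k : ℝ)| := by
      have := abs_sub (k : ℝ) κ.2.2; linarith
    refine Nonresonant.of_mem_V3 hV h2 h3 h4 ?_ ?_
    · have := mul_le_mul a1 a2 (by positivity) (abs_nonneg _)
      nlinarith
    · by_cases h : 4 * κ.2.1 ^ 2 < |k|
      · exact Or.inr h
      · left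
        have h' : |(k : ℝ)| ≤ 4 * (κ.2.1 : ℝ) ^ 2 := by exact_mod_cast not_lt.mp h
        have h6 : |(k : ℝ)| ≤ 4 * jb κ.2.1 ^ 2 := by rw [sq_jb]; linarith
        have := mul_le_mul b1 b2 (abs_nonneg _) (by positivity)
        have h7 := mul_le_mul h6 h6 k0 (by positivity)
        have : (0 : ℝ) ≤ jb κ.2.1 ^ 4 := by positivity
        nlinarith
  · rw [Set.mem_singleton_iff] at hV'
    rw [hV'] at hL
    have := abs_nonneg (k : ℝ)
    simp only at hL
    linarith

/-- Here $k_3$ is negligible against both $k$ and $k_1$. Hence $|k-k_3|\ge|k|/2$, and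
$k-k_2=k_3-k_1$ has size at least $|k_1|/2$. Since $|k|\le2^{20}|k_2|$, the modulation is bounded by
a power of $\langle k_2\rangle$, and the second alternative never occurs. -/
theorem nonresonant_of_mem_XN {k : ℤ} {κ : ℤ × ℤ × ℤ} (h : κ ∈ XN k) : Nonresonant k κ := by
  obtain ⟨hV, hN⟩ := h
  simp only [Set.mem_union, not_or, XH, XL, XS, Set.mem_ofPred_eq, not_and, not_le, not_lt] at hN
  obtain ⟨⟨hH, hL⟩, hS⟩ := hN
  replace hH := hH hV
  replace hL := hL hV
  have hS : |(κ.2.2 : ℝ)| < |(κ.1 : ℝ)| / 2 ^ 10 := by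
    by_contra hc
    exact absurd (hS hV (not_lt.mp hc)) (not_le.mpr hH)
  have hV' := hV
  rcases hV' with ⟨h1, h2, h3, h4⟩ | hV'
  · have h2' : |(κ.2.2 : ℝ)| ≤ |(κ.2.1 : ℝ)| := by exact_mod_cast h2
    have e1 : (k : ℝ) - κ.2.1 = -(κ.1 - κ.2.2) := by
      have : (κ.1 : ℤ) = κ.2.1 + κ.2.2 - k := by linarith
      rw [this]; push_cast; ring
    have k0 := abs_nonneg (k : ℝ)
    have a1 : |(κ.1 : ℝ)| / 2 ≤ |(k : ℝ) - κ.2.1| := by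
      rw [e1, abs_neg]
      have := abs_sub_abs_le_abs_sub (κ.1 : ℝ) κ.2.2
      have := abs_nonneg (κ.1 : ℝ)
      linarith
    have a2 : |(k : ℝ)| / 2 ≤ |(k : ℝ) - κ.2.2| := by
      have := abs_sub_abs_le_abs_sub (k : ℝ) κ.2.2; linarith
    have b1 : |(k : ℝ) - κ.2.1| ≤ 2 ^ 21 * |(κ.2.1 : ℝ)| := by
      have := abs_sub (k : ℝ) κ.2.1
      have := abs_nonneg (κ.2.1 : ℝ); linarith
    have b2 : |(k : ℝ) - κ.2.2| ≤ 2 ^ 21 * |(κ.2.1 : ℝ)| := by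
      have := abs_sub (k : ℝ) κ.2.2
      have := abs_nonneg (κ.2.1 : ℝ); linarith
    refine Nonresonant.of_mem_V3 hV h2 h3 h4 ?_ (Or.inl ?_)
    · have := mul_le_mul a1 a2 (by positivity) (abs_nonneg _)
      have := mul_nonneg k0 (abs_nonneg (κ.1 : ℝ))
      linarith
    · refine (mul_le_mul b1 b2 (abs_nonneg _) (by positivity)).trans ?_
      have h5 : |(κ.2.1 : ℝ)| * |(κ.2.1 : ℝ)| ≤ jb κ.2.1 ^ 2 := by
        rw [abs_mul_abs_self, sq_jb]; linarith [sq_nonneg (κ.2.1 : ℝ)]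
      have h6 : jb κ.2.1 ^ 2 ≤ jb κ.2.1 ^ 4 :=
        pow_le_pow_right₀ (one_le_jb _) (by norm_num)
      nlinarith
  · rw [Set.mem_singleton_iff] at hV'
    rw [hV'] at hH
    have := abs_nonneg (k : ℝ)
    simp only at hH
    linarith

theorem Nonresonant.Delta_ne_zero {k : ℤ} {κ : ℤ × ℤ × ℤ} (h : Nonresonant k κ) :
    Delta k κ ≠ 0 := by
  rw [Delta_eq h.sum_eq]
  exact mul_ne_zero two_ne_zero
    (mul_ne_zero (sub_ne_zero.mpr h.ne_left) (sub_ne_zero.mpr h.ne_right))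

theorem Nonresonant.one_le_abs_Delta {k : ℤ} {κ : ℤ × ℤ × ℤ} (h : Nonresonant k κ) :
    1 ≤ |(Delta k κ : ℝ)| := by
  exact_mod_cast Int.one_le_abs h.Delta_ne_zero

theorem Nonresonant.fst_eq {k : ℤ} {κ : ℤ × ℤ × ℤ} (h : Nonresonant k κ) :
    κ.1 = κ.2.1 + κ.2.2 - k := by linarith [h.sum_eq]

/-- The derivative loss is recovered from the modulation. -/
theorem Nonresonant.weight_le {k : ℤ} {κ : ℤ × ℤ × ℤ} (h : Nonresonant k κ) :
    jb k ^ (1 / 2 : ℝ) * |(κ.1 : ℝ)| * jb κ.1 ^ (-(1 / 2) : ℝ) ≤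
      4 * |(Delta k κ : ℝ)| ^ (1 / 2 : ℝ) := by
  have hD := h.one_le_abs_Delta
  have h1 : jb k ≤ 1 + |(k : ℝ)| := jb_le_one_add_abs _
  by_cases h0 : κ.1 = 0
  · rw [h0]; simp; positivity
  have h01 : (1 : ℝ) ≤ |(κ.1 : ℝ)| := by exact_mod_cast Int.one_le_abs h0
  have h2 : jb κ.1 ^ (-(1 / 2) : ℝ) ≤ |(κ.1 : ℝ)| ^ (-(1 / 2) : ℝ) :=
    Real.rpow_le_rpow_of_nonpos (by linarith) (abs_le_jb _) (by norm_num)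
  have h3 : |(κ.1 : ℝ)| * |(κ.1 : ℝ)| ^ (-(1 / 2) : ℝ) = |(κ.1 : ℝ)| ^ (1 / 2 : ℝ) := by
    conv_lhs => rw [← Real.rpow_one_add' (by linarith) (by norm_num)]
    norm_num
  -- As $\langle k\rangle\le1+|k|$, the field `mul_le` has to be supplemented by
  -- $|k_1|\lesssim|\Delta|$. For $k=0$ that field says nothing, but then $\Delta=2k_2k_3$ with both
  -- factors nonzero.
  have h4 : jb k * |(κ.1 : ℝ)| ≤ 16 * |(Delta k κ : ℝ)| := by
    have h5 : |(κ.1 : ℝ)| ≤ 8 * |(Delta k κ : ℝ)| := by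
      by_cases hk : k = 0
      · have h6 : |(κ.2.1 : ℝ)| * |(κ.2.2 : ℝ)| * 2 = |(Delta k κ : ℝ)| := by
          rw [Delta_eq h.sum_eq, hk]; push_cast; rw [abs_mul, abs_mul]; simp; ring
        have h7 : (1 : ℝ) ≤ |(κ.2.1 : ℝ)| := by
          exact_mod_cast Int.one_le_abs (fun h0 => h.ne_left (by rw [hk, h0]))
        have h8 : (1 : ℝ) ≤ |(κ.2.2 : ℝ)| := by
          exact_mod_cast Int.one_le_abs (fun h0 => h.ne_right (by rw [hk, h0]))
        have h9 : |(κ.1 : ℝ)| ≤ |(κ.2.1 : ℝ)| + |(κ.2.2 : ℝ)| := by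
          rw [h.fst_eq, hk]; push_cast; simpa using abs_add_le (κ.2.1 : ℝ) κ.2.2
        nlinarith
      · have : (1 : ℝ) ≤ |(k : ℝ)| := by exact_mod_cast Int.one_le_abs hk
        nlinarith [h.mul_le]
    nlinarith [h.mul_le]
  calc jb k ^ (1 / 2 : ℝ) * |(κ.1 : ℝ)| * jb κ.1 ^ (-(1 / 2) : ℝ)
      ≤ jb k ^ (1 / 2 : ℝ) * |(κ.1 : ℝ)| * |(κ.1 : ℝ)| ^ (-(1 / 2) : ℝ) := by
        have := jb_pos k; gcongr
    _ = (jb k * |(κ.1 : ℝ)|) ^ (1 / 2 : ℝ) := by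
        rw [mul_assoc, h3, Real.mul_rpow (jb_pos _).le (abs_nonneg _)]
    _ ≤ (16 * |(Delta k κ : ℝ)|) ^ (1 / 2 : ℝ) := by
        have := jb_pos k; gcongr
    _ = 4 * |(Delta k κ : ℝ)| ^ (1 / 2 : ℝ) := by
        rw [Real.mul_rpow (by norm_num) (abs_nonneg _)]
        congr 1
        rw [show (16 : ℝ) = 4 ^ (2 : ℝ) by norm_num, ← Real.rpow_mul (by norm_num)]
        norm_num

/-- Counting device: a map that is injective on the nonzero terms and has values in a finite set
bounds their number. -/
theorem tsum_ite_le_card {α β : Type*} (P : α → Prop) [DecidablePred P] (f : α → ℝ≥0∞) (c : ℝ≥0∞)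
    (s : Finset β) (g : α → β) (hg : ∀ x, P x → g x ∈ s) (hi : Set.InjOn g {x | P x})
    (hf : ∀ x, P x → f x ≤ c) : ∑' x, (if P x then f x else 0) ≤ s.card * c := by
  have hfin : {x | P x}.Finite :=
    Set.Finite.of_finite_image (s.finite_toSet.subset (by rintro _ ⟨x, hx, rfl⟩; exact hg x hx)) hi
  rw [tsum_eq_sum (s := hfin.toFinset) (fun x hx => by
    rw [if_neg]; simpa using hx)]
  calc ∑ x ∈ hfin.toFinset, (if P x then f x else 0) ≤ ∑ x ∈ hfin.toFinset, c :=
        Finset.sum_le_sum fun x hx => by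
          have hx : P x := by simpa using hx
          rw [if_pos hx]; exact hf x hx
    _ = hfin.toFinset.card * c := by rw [Finset.sum_const, nsmul_eq_mul]
    _ ≤ s.card * c := by
        gcongr
        refine Finset.card_le_card_of_injOn g (fun x hx => hg x (by simpa using hx)) ?_
        simpa using hi

/-- Two small non-resonant interactions with the same modulation agree up to a swap. -/
theorem Nonresonant.eq_or_swap {k : ℤ} {κ κ' : ℤ × ℤ × ℤ} (h : Nonresonant k κ)
    (h' : Nonresonant k κ') (hs : 4 * κ.2.1 ^ 2 < |k|) (hs' : 4 * κ'.2.1 ^ 2 < |k|)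
    (hD : Delta k κ = Delta k κ') : κ = κ' ∨ κ = (κ'.1, κ'.2.2, κ'.2.1) := by
  rw [Delta_eq h.sum_eq, Delta_eq h'.sum_eq] at hD
  have e1 := h.fst_eq
  have e1' := h'.fst_eq
  have hab := h.abs_le
  have hab' := h'.abs_le
  obtain ⟨c, a, b⟩ := κ
  obtain ⟨c', a', b'⟩ := κ'
  simp only at *
  -- Expanding $(k-a)(k-b)$ leaves this identity. Its right side is below $|k|/2$ because $|ab|\le
  -- a^2<|k|/4$, so the integer that multiplies $k$ vanishes. Then the two pairs have the same sum
  -- and product.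
  have key : k * (a + b - a' - b') = a * b - a' * b' := by linarith
  have m1 : |a * b| ≤ a ^ 2 := by
    rw [abs_mul, ← sq_abs a, sq]; exact mul_le_mul_of_nonneg_left hab (abs_nonneg _)
  have m2 : |a' * b'| ≤ a' ^ 2 := by
    rw [abs_mul, ← sq_abs a', sq]; exact mul_le_mul_of_nonneg_left hab' (abs_nonneg _)
  have s0 : a + b - a' - b' = 0 := by
    by_contra h0
    have h1 : 1 ≤ |a + b - a' - b'| := Int.one_le_abs h0
    have h2 : |k| * |a + b - a' - b'| = |a * b - a' * b'| := by rw [← abs_mul, key]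
    have h3 := abs_sub (a * b) (a' * b')
    have h4 : |k| ≤ |k| * |a + b - a' - b'| := le_mul_of_one_le_right (abs_nonneg _) h1
    linarith [sq_nonneg a, sq_nonneg a']
  rw [s0, mul_zero] at key
  have hb : b = a' + b' - a := by linarith
  have : (a - a') * (a - b') = 0 := by rw [hb] at key; linarith
  rcases mul_eq_zero.mp this with h0 | h0
  · left
    have ha : a = a' := by linarith
    have hb' : b = b' := by linarith
    rw [e1, e1', ha, hb']
  · right
    have ha : a = b' := by linarith
    have hb' : b = a' := by linarith
    rw [e1, e1', ha, hb', add_comm]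

/-- The interactions of a given modulation are few, uniformly in the output frequency. -/
theorem exists_tsum_modulation_le {ε : ℝ} (hε : 0 < ε) : ∃ C : ℝ≥0∞, C ≠ ∞ ∧
    ∀ (X : ℤ → Set (ℤ × ℤ × ℤ)), (∀ k, ∀ κ ∈ X k, Nonresonant k κ) → ∀ k m : ℤ,
      ∑' κ : X k, (if Delta k κ = m then jbe κ.1.2.1 (-ε) else 0) ≤ C := by
  -- The exponent $\varepsilon/4$ matches the fourth power in `delta_le`: the divisor count
  -- $|m|^{\varepsilon/4}$ is absorbed by $\langle k_2\rangle^{-\varepsilon}$.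
  obtain ⟨C, hC1, hC⟩ := exists_card_divisors_le (ε := ε / 4) (by linarith)
  refine ⟨2 * ENNReal.ofReal (C * (2 ^ 43 : ℝ) ^ (ε / 4)) + 2, by finiteness, fun X hX k m => ?_⟩
  classical
  by_cases hm : m = 0
  · refine le_trans (le_of_eq ?_) zero_le
    rw [ENNReal.tsum_eq_zero]
    intro κ
    rw [if_neg]
    rw [hm]; exact (hX k κ κ.2).Delta_ne_zero
  set S : X k → Prop := fun κ => 4 * κ.1.2.1 ^ 2 < |k|
  have hsplit : ∀ κ : X k, (if Delta k κ = m then jbe κ.1.2.1 (-ε) else 0) ≤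
      (if Delta k κ = m ∧ ¬ S κ then jbe κ.1.2.1 (-ε) else 0) +
      (if Delta k κ = m ∧ S κ then jbe κ.1.2.1 (-ε) else 0) := by
    intro κ
    by_cases h1 : Delta k κ = m <;> by_cases h2 : S κ <;> simp [h1, h2]
  refine (ENNReal.tsum_le_tsum hsplit).trans ?_
  rw [ENNReal.tsum_add]
  refine add_le_add ?_ ?_
  -- Interactions with large $k_2$: the signed divisor $k-k_2$ of $m$ determines $k_3$ through
  -- `Delta_eq`, and then $k_1$.
  · set D : Finset ℤ := m.natAbs.divisors.image (fun d : ℕ => (d : ℤ)) ∪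
      m.natAbs.divisors.image (fun d : ℕ => -(d : ℤ)) with hDdef
    have hDc : (D.card : ℝ) ≤ 2 * (C * |(m : ℝ)| ^ (ε / 4)) := by
      have h1 : D.card ≤ 2 * m.natAbs.divisors.card := by
        refine (Finset.card_union_le _ _).trans ?_
        have := Finset.card_image_le (s := m.natAbs.divisors) (f := fun d : ℕ => (d : ℤ))
        have := Finset.card_image_le (s := m.natAbs.divisors) (f := fun d : ℕ => -(d : ℤ))
        omega
      have h2 := hC m.natAbs (by simpa using hm)
      rw [Nat.cast_natAbs, Int.cast_abs] at h2
      have h1' : (D.card : ℝ) ≤ 2 * m.natAbs.divisors.card := by exact_mod_cast h1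
      linarith
    have hm1 : (1 : ℝ) ≤ |(m : ℝ)| := by exact_mod_cast Int.one_le_abs hm
    refine (tsum_ite_le_card (fun κ : X k => Delta k κ = m ∧ ¬ S κ) _
      (ENNReal.ofReal ((2 ^ 43 : ℝ) ^ (ε / 4) * |(m : ℝ)| ^ (-(ε / 4)))) D
      (fun κ => k - κ.1.2.1) ?_ ?_ ?_).trans ?_
    · rintro ⟨κ, hκ⟩ ⟨h1, -⟩
      have hN := hX k κ hκ
      have hdvd : k - κ.2.1 ∣ m := by
        rw [← h1, Delta_eq hN.sum_eq]
        exact Dvd.intro_left (2 * (k - κ.2.2)) (by ring)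
      have hmem : (k - κ.2.1).natAbs ∈ m.natAbs.divisors :=
        Nat.mem_divisors.mpr ⟨Int.natAbs_dvd_natAbs.mpr hdvd, by simpa using hm⟩
      simp only [hDdef, Finset.mem_union, Finset.mem_image]
      rcases Int.natAbs_eq (k - κ.2.1) with h | h
      · exact Or.inl ⟨_, hmem, h.symm⟩
      · exact Or.inr ⟨_, hmem, h.symm⟩
    · rintro ⟨κ, hκ⟩ ⟨h1, -⟩ ⟨κ', hκ'⟩ ⟨h1', -⟩ heq
      have hN := hX k κ hκ
      have hN' := hX k κ' hκ'
      simp only at heq h1 h1'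
      rw [Delta_eq hN.sum_eq] at h1
      rw [Delta_eq hN'.sum_eq, ← h1, ← heq] at h1'
      have h2 : k - κ.2.1 ≠ 0 := sub_ne_zero.mpr hN.ne_left
      have h3 : κ.2.2 = κ'.2.2 := by
        have := mul_left_cancel₀ h2 (mul_left_cancel₀ two_ne_zero h1')
        linarith
      have h4 : κ.2.1 = κ'.2.1 := by linarith
      have h5 : κ.1 = κ'.1 := by rw [hN.fst_eq, hN'.fst_eq, h3, h4]
      exact Subtype.ext (Prod.ext h5 (Prod.ext h4 h3))
    · rintro ⟨κ, hκ⟩ ⟨h1, h2⟩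
      have hN := hX k κ hκ
      have h3 := hN.delta_le.resolve_right h2
      simp only at h1
      rw [h1] at h3
      rw [jbe]
      apply ENNReal.ofReal_le_ofReal
      have hj := jb_pos κ.2.1
      have h4 : |(m : ℝ)| ^ (ε / 4) ≤ (2 ^ 43 : ℝ) ^ (ε / 4) * jb κ.2.1 ^ ε := by
        refine (Real.rpow_le_rpow (abs_nonneg _) h3 (by linarith)).trans ?_
        rw [Real.mul_rpow (by positivity) (by positivity), ← Real.rpow_natCast (jb _),
          ← Real.rpow_mul hj.le]
        apply le_of_eq
        congr 2
        push_cast; ring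
      rw [Real.rpow_neg hj.le, Real.rpow_neg (abs_nonneg _), ← div_eq_mul_inv, ← one_div,
        div_le_div_iff₀ (by positivity) (by positivity)]
      linarith
    · rw [← ENNReal.ofReal_natCast, ← ENNReal.ofReal_mul (by positivity),
        show (2 : ℝ≥0∞) = ENNReal.ofReal 2 by simp, ← ENNReal.ofReal_mul (by norm_num)]
      apply ENNReal.ofReal_le_ofReal
      have h1 : |(m : ℝ)| ^ (ε / 4) * |(m : ℝ)| ^ (-(ε / 4)) = 1 := by
        rw [← Real.rpow_add (by linarith)]; simp
      calc (D.card : ℝ) * ((2 ^ 43 : ℝ) ^ (ε / 4) * |(m : ℝ)| ^ (-(ε / 4)))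
          ≤ 2 * (C * |(m : ℝ)| ^ (ε / 4)) * ((2 ^ 43 : ℝ) ^ (ε / 4) * |(m : ℝ)| ^ (-(ε / 4))) := by
            gcongr
        _ = 2 * (C * (2 ^ 43 : ℝ) ^ (ε / 4)) *
            (|(m : ℝ)| ^ (ε / 4) * |(m : ℝ)| ^ (-(ε / 4))) := by ring
        _ = _ := by rw [h1, mul_one]
  -- Interactions with small $k_2$: once one exists, only it and its swap can have this modulation.
  · by_cases hex : ∃ κ₀ : X k, Delta k κ₀ = m ∧ S κ₀
    · obtain ⟨κ₀, h0, hS0⟩ := hex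
      refine (tsum_ite_le_card (fun κ : X k => Delta k κ = m ∧ S κ) _ 1
        ({κ₀.1, (κ₀.1.1, κ₀.1.2.2, κ₀.1.2.1)} : Finset (ℤ × ℤ × ℤ)) (fun κ => κ.1) ?_ ?_ ?_).trans ?_
      · rintro κ ⟨h1, h2⟩
        simp only [Finset.mem_insert, Finset.mem_singleton]
        exact (hX k κ κ.2).eq_or_swap (hX k κ₀ κ₀.2) h2 hS0 (h1.trans h0.symm)
      · exact Subtype.val_injective.injOn
      · intro κ _
        exact jbe_le_one _ (by linarith)
      · rw [mul_one]
        exact_mod_cast Finset.card_le_two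
    · refine le_trans (le_of_eq ?_) zero_le
      rw [ENNReal.tsum_eq_zero]
      intro κ
      rw [if_neg]
      exact fun h => hex ⟨κ, h⟩

section

/-! ### Inequalities for sums in `[0, ∞]` -/

theorem tsum_mul_le_Lp_mul_Lq {ι : Type*} {q q' : ℝ} (hq : q.HolderConjugate q')
    (f g : ι → ℝ≥0∞) :
    ∑' i, f i * g i ≤ (∑' i, f i ^ q) ^ (1 / q) * (∑' i, g i ^ q') ^ (1 / q') := by
  let : MeasurableSpace ι := ⊤
  have := ENNReal.lintegral_mul_le_Lp_mul_Lq (Measure.count : Measure ι) hq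
    (f := f) (g := g) measurable_from_top.aemeasurable measurable_from_top.aemeasurable
  simpa only [lintegral_count, Pi.mul_apply] using this

/-- Jensen's inequality for a sum with weights. -/
theorem tsum_mul_rpow_le {ι : Type*} {q : ℝ} (hq : 1 < q) (W g : ι → ℝ≥0∞) :
    (∑' i, W i * g i) ^ q ≤ (∑' i, W i) ^ (q - 1) * ∑' i, W i * g i ^ q := by
  have hc : q.HolderConjugate (q / (q - 1)) := Real.HolderConjugate.conjExponent hq
  have hq0 : 0 < q := by linarith
  have hq1 : 0 < q - 1 := by linarith
  have h1 : ∀ i, W i * g i = (W i ^ (1 / q) * g i) * W i ^ (1 / (q / (q - 1))) := by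
    intro i
    have : W i = W i ^ (1 / q) * W i ^ (1 / (q / (q - 1))) := by
      rw [← ENNReal.rpow_add_of_nonneg _ _ (by positivity) (by positivity)]
      rw [show 1 / q + 1 / (q / (q - 1)) = 1 by field_simp; ring, ENNReal.rpow_one]
    conv_lhs => rw [this]
    ring
  have h2 := tsum_mul_le_Lp_mul_Lq hc (fun i => W i ^ (1 / q) * g i)
    (fun i => W i ^ (1 / (q / (q - 1))))
  simp only [← h1] at h2
  have h3 : ∀ i, (W i ^ (1 / q) * g i) ^ q = W i * g i ^ q := by
    intro i
    rw [ENNReal.mul_rpow_of_nonneg _ _ hq0.le, ← ENNReal.rpow_mul, one_div_mul_cancel hq0.ne',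
      ENNReal.rpow_one]
  have h4 : ∀ i, (W i ^ (1 / (q / (q - 1)))) ^ (q / (q - 1)) = W i := by
    intro i
    rw [← ENNReal.rpow_mul, one_div_mul_cancel (by positivity), ENNReal.rpow_one]
  simp only [h3, h4] at h2
  refine (ENNReal.rpow_le_rpow h2 hq0.le).trans (le_of_eq ?_)
  rw [ENNReal.mul_rpow_of_nonneg _ _ hq0.le, ← ENNReal.rpow_mul, ← ENNReal.rpow_mul,
    one_div_mul_cancel hq0.ne', ENNReal.rpow_one, mul_comm]
  congr 2
  field_simp

/-! ### The exponents -/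

/-- The range of `δ` in terms of `p₀`. -/
structure Exponents (p δ : ℝ) : Prop where
  two_le : 2 ≤ p
  pos : 0 < δ
  lt : δ * (100 * p) < 1

/-- The exponent `r₀`. -/
def rY (δ : ℝ) : ℝ := 1 / (1 / 2 + δ)

/-- The exponent dual to `r₀`. -/
def rY' (δ : ℝ) : ℝ := 1 / (1 / 2 - δ)

/-- The exponent of the time `T` that is gained. -/
def gain (p : ℝ) : ℝ := 1 / (100 * p)

theorem gain_mul {p : ℝ} (hp : 2 ≤ p) : gain p * p = 1 / 100 := by
  rw [gain]; field_simp

section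

variable {p δ : ℝ} (h : Exponents p δ)
include h

theorem Exponents.gain_pos : 0 < gain p := by
  have := h.two_le; rw [gain]; positivity

theorem Exponents.gain_le : gain p ≤ 1 / 200 := by
  have := h.two_le
  rw [gain]
  exact one_div_le_one_div_of_le (by norm_num) (by linarith)

theorem Exponents.lt_one : δ < 1 / 200 := by nlinarith [h.two_le, h.lt, h.pos]

theorem Exponents.rY_pos : 0 < rY δ := by have := h.pos; rw [rY]; positivity

theorem Exponents.rY'_pos : 0 < rY' δ := by
  have := h.lt_one; rw [rY']; apply one_div_pos.mpr; linarith

omit h in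
theorem one_div_rY (δ : ℝ) : 1 / rY δ = 1 / 2 + δ := by rw [rY, one_div_one_div]

omit h in
theorem one_div_rY' (δ : ℝ) : 1 / rY' δ = 1 / 2 - δ := by rw [rY', one_div_one_div]

theorem Exponents.one_lt_rY : 1 < rY δ := by
  have := h.pos; have := h.lt_one
  rw [rY, lt_div_iff₀ (by linarith)]; linarith

theorem Exponents.rY_lt_two : rY δ < 2 := by
  have := h.pos; rw [rY, div_lt_iff₀ (by linarith)]; linarith

theorem Exponents.two_lt_rY' : 2 < rY' δ := by
  have := h.pos; have := h.lt_one; rw [rY', lt_div_iff₀ (by linarith)]; linarith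

theorem Exponents.conj : (rY δ).HolderConjugate (rY' δ) := by
  rw [Real.holderConjugate_iff]
  refine ⟨h.one_lt_rY, ?_⟩
  have h1 := one_div_rY δ
  have h2 := one_div_rY' δ
  rw [one_div] at h1 h2
  rw [h1, h2]; ring

theorem Exponents.one_lt_div : 1 < p / rY δ := by
  have := h.two_le; rw [lt_div_iff₀ h.rY_pos]; linarith [h.rY_lt_two]

/-! ### The trilinear estimate for weighted densities -/

/-- Split of the modulation weight, with a factor that is summable over the interactions and one
that is integrable in the modulation. -/
theorem Exponents.weight_split {k₂ k₃ : ℤ} (hk : |k₃| ≤ |k₂|) (x : ℝ) :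
    jbe k₂ (-(1 / 2)) * jbe k₃ (-(1 / 2)) * jbe x (-1 + gain p) ≤
      (jbe k₂ (-(10 * gain p)) * jbe x (-((1 + gain p) / rY' δ)) + jbe k₂ (-1) * jbe k₃ (-1)) *
      (jbe k₂ (-(1 / 2 - 26 * gain p)) * jbe k₃ (-(1 / 2)) * jbe x (-((1 + gain p) / rY δ))) := by
  set θ := gain p with hθ
  have hθ0 : 0 < θ := h.gain_pos
  have hθ1 : θ ≤ 1 / 200 := h.gain_le
  have e1 : (1 + θ) / rY' δ = (1 + θ) * (1 / 2 - δ) := by rw [← one_div_rY' δ]; ring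
  have e2 : (1 + θ) / rY δ = (1 + θ) * (1 / 2 + δ) := by rw [← one_div_rY δ]; ring
  have hδ := h.lt_one
  have hδ0 := h.pos
  -- In the first case the excess $\langle x\rangle^{2\theta}$ is at most $\langle
  -- k_2\rangle^{16\theta}$, and $26=10+16$. In the second case $\langle x\rangle^{-1/4}\le\langle
  -- k_2\rangle^{-2}$, which is shared with $k_3$ because $|k_3|\le|k_2|$.
  by_cases hx : jb x ≤ jb k₂ ^ (8 : ℝ)
  · rw [add_mul]
    refine le_trans ?_ le_self_add
    have h1 : jbe k₂ (-(10 * θ)) * jbe x (-((1 + θ) / rY' δ)) *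
        (jbe k₂ (-(1 / 2 - 26 * θ)) * jbe k₃ (-(1 / 2)) * jbe x (-((1 + θ) / rY δ))) =
        (jbe k₂ (-(10 * θ)) * jbe k₂ (-(1 / 2 - 26 * θ))) * jbe k₃ (-(1 / 2)) *
        (jbe x (-((1 + θ) / rY' δ)) * jbe x (-((1 + θ) / rY δ))) := by ring
    rw [h1, ← jbe_add, ← jbe_add, e1, e2]
    have h2 : -(10 * θ) + -(1 / 2 - 26 * θ) = -(1 / 2) + 8 * (2 * θ) := by ring
    have h3 : -1 + θ = -((1 + θ) * (1 / 2 - δ)) + -((1 + θ) * (1 / 2 + δ)) + 2 * θ := by ring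
    rw [h2, h3, jbe_add x _ (2 * θ), jbe_add k₂ _ (8 * (2 * θ))]
    have h4 : jbe x (2 * θ) ≤ jbe k₂ (8 * (2 * θ)) := by
      rw [jbe, jbe, Real.rpow_mul (jb_pos (k₂ : ℝ)).le 8]
      exact ENNReal.ofReal_le_ofReal (Real.rpow_le_rpow (jb_pos _).le hx (by linarith))
    calc _ = jbe k₂ (-(1 / 2)) * jbe k₃ (-(1 / 2)) *
          jbe x (-((1 + θ) * (1 / 2 - δ)) + -((1 + θ) * (1 / 2 + δ))) * jbe x (2 * θ) := by ring
      _ ≤ jbe k₂ (-(1 / 2)) * jbe k₃ (-(1 / 2)) *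
          jbe x (-((1 + θ) * (1 / 2 - δ)) + -((1 + θ) * (1 / 2 + δ))) *
          jbe k₂ (8 * (2 * θ)) := by gcongr
      _ = _ := by ring
  · rw [add_mul]
    refine le_trans ?_ le_add_self
    have h4 : jbe x (-(1 / 4)) ≤ jbe k₂ (-1) * jbe k₃ (-1) := by
      have h5 : jbe x (-(1 / 4)) ≤ jbe k₂ (-2) := by
        rw [jbe, jbe]
        apply ENNReal.ofReal_le_ofReal
        have : jb k₂ ^ (-2 : ℝ) = (jb k₂ ^ (8 : ℝ)) ^ (-(1 / 4) : ℝ) := by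
          rw [← Real.rpow_mul (jb_pos _).le]; norm_num
        rw [this]
        exact Real.rpow_le_rpow_of_nonpos (Real.rpow_pos_of_pos (jb_pos _) _)
          (not_le.mp hx).le (by norm_num)
      refine h5.trans ?_
      rw [show (-2 : ℝ) = -1 + -1 by norm_num, jbe_add]
      gcongr
      rw [jbe, jbe]
      apply ENNReal.ofReal_le_ofReal
      refine Real.rpow_le_rpow_of_nonpos (jb_pos _) (jb_le_jb ?_) (by norm_num)
      exact_mod_cast hk
    have h6 : jbe x (-1 + θ) ≤ jbe x (-(1 / 4)) * jbe x (-((1 + θ) / rY δ)) := by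
      rw [← jbe_add, e2]
      apply jbe_mono
      nlinarith
    have h7 : jbe k₂ (-(1 / 2)) ≤ jbe k₂ (-(1 / 2 - 26 * θ)) := jbe_mono _ (by linarith)
    calc _ ≤ jbe k₂ (-(1 / 2 - 26 * θ)) * jbe k₃ (-(1 / 2)) *
          ((jbe k₂ (-1) * jbe k₃ (-1)) * jbe x (-((1 + θ) / rY δ))) := by
          gcongr
          exact h6.trans (by gcongr)
      _ = _ := by ring

/-- The summable factor of the modulation weight. -/
def weightX (p δ : ℝ) (κ : ℤ × ℤ × ℤ) (x : ℝ) : ℝ≥0∞ :=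
  jbe κ.2.1 (-(10 * gain p)) * jbe x (-((1 + gain p) / rY' δ)) + jbe κ.2.1 (-1) * jbe κ.2.2 (-1)

/-- The integrable factor of the modulation weight. -/
def weightY (p δ : ℝ) (κ : ℤ × ℤ × ℤ) (x : ℝ) : ℝ≥0∞ :=
  jbe κ.2.1 (-(1 / 2 - 26 * gain p)) * jbe κ.2.2 (-(1 / 2)) * jbe x (-((1 + gain p) / rY δ))

omit h in
theorem measurable_weightX (κ : ℤ × ℤ × ℤ) : Measurable (weightX p δ κ) :=
  ((measurable_jbe _).const_mul _).add_const _

omit h in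
theorem measurable_weightY (κ : ℤ × ℤ × ℤ) : Measurable (weightY p δ κ) :=
  (measurable_jbe _).const_mul _

omit h in
-- An interaction is determined by $(k_2,k_3)$, so forgetting all constraints leaves a free double
-- sum.
theorem tsum_interactions_le {X : Set (ℤ × ℤ × ℤ)} {k : ℤ} (hX : ∀ κ ∈ X, Nonresonant k κ)
    (f : ℤ × ℤ × ℤ → ℝ≥0∞) : ∑' κ : X, f κ ≤ ∑' a : ℤ, ∑' b : ℤ, f (a + b - k, a, b) := by
  rw [← ENNReal.tsum_prod (f := fun a b => f (a + b - k, a, b))]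
  have hinj : Function.Injective fun κ : X => κ.1.2 := by
    rintro ⟨κ, hκ⟩ ⟨κ', hκ'⟩ heq
    simp only at heq
    refine Subtype.ext (Prod.ext ?_ heq)
    rw [(hX κ hκ).fst_eq, (hX κ' hκ').fst_eq, heq]
  have := ENNReal.tsum_comp_le_tsum_of_injective hinj
    (fun q : ℤ × ℤ => f (q.1 + q.2 - k, q.1, q.2))
  refine le_trans (le_of_eq ?_) this
  refine tsum_congr fun κ => ?_
  congr 1
  exact Prod.ext (hX κ κ.2).fst_eq rfl

/-- The power $r_0'$ turns the modulation factor of the first summand into $\langle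
x-\Delta\rangle^{-(1+\theta)}$. Grouping by $\Delta=m$, `exists_tsum_modulation_le` bounds each
group and the sum over $m$ is a shifted lattice sum. The second summand does not see $\Delta$ and is
summable over $(k_2,k_3)$. -/
theorem Exponents.exists_tsum_weightX_le : ∃ C : ℝ≥0∞, C ≠ ∞ ∧
    ∀ (X : ℤ → Set (ℤ × ℤ × ℤ)), (∀ k, ∀ κ ∈ X k, Nonresonant k κ) → ∀ (k : ℤ) (x : ℝ),
      ∑' κ : X k, weightX p δ κ (x - Delta k κ) ^ rY' δ ≤ C := by
  have hr' := h.rY'_pos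
  have hθ := h.gain_pos
  obtain ⟨C₁, hC₁, hm⟩ := exists_tsum_modulation_le (ε := 10 * gain p) (by linarith)
  obtain ⟨C₂, hC₂, hs⟩ := exists_tsum_jbe_sub_le (a := 1 + gain p) (by linarith)
  set S := ∑' k : ℤ, jbe k (-2) with hS
  have hSt : S ≠ ∞ := (tsum_jbe_lt_top (by norm_num)).ne
  have h2 : (2 : ℝ≥0∞) ^ rY' δ ≠ ∞ := by finiteness
  refine ⟨2 ^ rY' δ * (C₂ * C₁ + S * S), by finiteness, fun X hX k x => ?_⟩
  have hpt : ∀ κ : X k, weightX p δ κ (x - Delta k κ) ^ rY' δ ≤ 2 ^ rY' δ *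
      (∑' m : ℤ, jbe (x - m) (-(1 + gain p)) *
        (if Delta k κ = m then jbe κ.1.2.1 (-(10 * gain p)) else 0) +
        jbe κ.1.2.1 (-2) * jbe κ.1.2.2 (-2)) := by
    intro κ
    rw [tsum_eq_single (Delta k κ) (fun m hm => by rw [if_neg hm.symm, mul_zero]), if_pos rfl]
    set u := jbe κ.1.2.1 (-(10 * gain p)) * jbe (x - Delta k κ) (-((1 + gain p) / rY' δ))
    set v := jbe κ.1.2.1 (-1) * jbe κ.1.2.2 (-1)
    have h3 : (u + v) ^ rY' δ ≤ 2 ^ rY' δ * (u ^ rY' δ + v ^ rY' δ) := by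
      rcases le_total u v with huv | huv
      · calc (u + v) ^ rY' δ ≤ (2 * v) ^ rY' δ := by gcongr; rw [two_mul]; gcongr
          _ = 2 ^ rY' δ * v ^ rY' δ := ENNReal.mul_rpow_of_nonneg _ _ hr'.le
          _ ≤ _ := by gcongr; exact le_add_self
      · calc (u + v) ^ rY' δ ≤ (2 * u) ^ rY' δ := by gcongr; rw [two_mul]; gcongr
          _ = 2 ^ rY' δ * u ^ rY' δ := ENNReal.mul_rpow_of_nonneg _ _ hr'.le
          _ ≤ _ := by gcongr; exact le_self_add
    refine h3.trans ?_
    have hr2 := h.two_lt_rY'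
    gcongr 2 ^ rY' δ * (?_ + ?_)
    · rw [ENNReal.mul_rpow_of_nonneg _ _ hr'.le, jbe_rpow, jbe_rpow, mul_comm]
      gcongr
      · apply jbe_mono; field_simp; rfl
      · apply jbe_mono; nlinarith
    · rw [ENNReal.mul_rpow_of_nonneg _ _ hr'.le, jbe_rpow, jbe_rpow]
      gcongr <;> exact jbe_mono _ (by linarith)
  refine (ENNReal.tsum_le_tsum hpt).trans ?_
  rw [ENNReal.tsum_mul_left, ENNReal.tsum_add]
  gcongr 2 ^ rY' δ * (?_ + ?_)
  · rw [ENNReal.tsum_comm]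
    simp_rw [ENNReal.tsum_mul_left]
    calc _ ≤ ∑' m : ℤ, jbe (x - m) (-(1 + gain p)) * C₁ := by
          gcongr with m; exact hm X hX k m
      _ ≤ _ := by rw [ENNReal.tsum_mul_right]; gcongr; exact hs x
  · refine (tsum_interactions_le (hX k) (fun κ => jbe κ.2.1 (-2) * jbe κ.2.2 (-2))).trans ?_
    simp_rw [ENNReal.tsum_mul_left, ENNReal.tsum_mul_right]
    rfl

end

/-- The product of the modulation weights of `Y₀`. -/
def tripleWeight (κ : ℤ × ℤ × ℤ) (ω : ℝ × ℝ × ℝ) : ℝ≥0∞ :=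
  jbe (ω.1 + (κ.1 : ℝ) ^ 2) (-(1 / 2)) *
    (jbe (ω.2.1 + (κ.2.1 : ℝ) ^ 2) (-(1 / 2)) * jbe (ω.2.2 + (κ.2.2 : ℝ) ^ 2) (-(1 / 2)))

/-- The product of three densities. -/
def tripleDensity (f : Fin 3 → ℤ → ℝ → ℝ≥0∞) (κ : ℤ × ℤ × ℤ) (ω : ℝ × ℝ × ℝ) : ℝ≥0∞ :=
  f 0 κ.1 ω.1 * (f 1 κ.2.1 ω.2.1 * f 2 κ.2.2 ω.2.2)

theorem measurable_tripleWeight (κ : ℤ × ℤ × ℤ) : Measurable (tripleWeight κ) := by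
  have h (c : ℝ) : Measurable fun x : ℝ => jbe (x + c) (-(1 / 2)) :=
    (measurable_jbe _).comp (measurable_id.add_const c)
  exact ((h _).comp measurable_fst).mul
    (((h _).comp measurable_snd.fst).mul ((h _).comp measurable_snd.snd))

theorem measurable_tripleDensity {f : Fin 3 → ℤ → ℝ → ℝ≥0∞} (hf : ∀ j k, Measurable (f j k))
    (κ : ℤ × ℤ × ℤ) : Measurable (tripleDensity f κ) :=
  ((hf _ _).comp measurable_fst).mul
    (((hf _ _).comp measurable_snd.fst).mul ((hf _ _).comp measurable_snd.snd))

/-- The modulation of the output relative to those of the inputs. -/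
def outMod (ξ : ℝ) (ω : ℝ × ℝ × ℝ) : ℝ := ξ + ω.1 - ω.2.1 - ω.2.2

theorem measurable_outMod : Measurable fun z : ℝ × ℝ × ℝ × ℝ => outMod z.1 z.2 := by
  unfold outMod; fun_prop

theorem lintegral_triple (u v w : ℝ → ℝ≥0∞) (hu : Measurable u) (hv : Measurable v)
    (hw : Measurable w) :
    ∫⁻ ω : ℝ × ℝ × ℝ, u ω.1 * (v ω.2.1 * w ω.2.2) = (∫⁻ x, u x) * ((∫⁻ x, v x) * ∫⁻ x, w x) := by
  rw [Measure.volume_eq_prod, lintegral_prod_mul (f := u) (g := fun z : ℝ × ℝ => v z.1 * w z.2)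
    hu.aemeasurable ((hv.comp measurable_fst).mul (hw.comp measurable_snd)).aemeasurable,
    Measure.volume_eq_prod, lintegral_prod_mul hv.aemeasurable hw.aemeasurable]

/-- Since $r_0'>2$, the input weights $\langle\cdot\rangle^{-1/2}$ are in $L^{r_0'}$. In the
modulation variables they no longer depend on the interaction, so the sum over interactions can be
done pointwise first. -/
theorem Exponents.exists_tsum_lintegral_weightX_le {p δ : ℝ} (h : Exponents p δ) :
    ∃ C : ℝ≥0∞, C ≠ ∞ ∧
    ∀ (X : ℤ → Set (ℤ × ℤ × ℤ)), (∀ k, ∀ κ ∈ X k, Nonresonant k κ) → ∀ (k : ℤ) (ξ : ℝ),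
      ∑' κ : X k, ∫⁻ ω, (tripleWeight κ ω * weightX p δ κ (outMod ξ ω)) ^ rY' δ ≤ C := by
  obtain ⟨C, hC, hX⟩ := h.exists_tsum_weightX_le
  have hr' := h.rY'_pos
  have hr2 := h.two_lt_rY'
  set S := ∫⁻ x, jbe x (-(rY' δ / 2)) with hS
  have hSt : S ≠ ∞ := (lintegral_jbe_lt_top (by linarith)).ne
  refine ⟨S * (S * S) * C, by finiteness, fun X hN k ξ => ?_⟩
  set b : ℝ × ℝ × ℝ → ℝ≥0∞ := fun ω =>
    jbe ω.1 (-(rY' δ / 2)) * (jbe ω.2.1 (-(rY' δ / 2)) * jbe ω.2.2 (-(rY' δ / 2))) with hb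
  have hbm : Measurable b := ((measurable_jbe _).comp measurable_fst).mul
    (((measurable_jbe _).comp measurable_snd.fst).mul ((measurable_jbe _).comp measurable_snd.snd))
  have hom (c : ℝ) (D : ℝ) : Measurable fun ω : ℝ × ℝ × ℝ => outMod c ω - D := by
    unfold outMod; fun_prop
  -- Translating $\omega_j$ by $k_j^2$ and $\xi$ by $k^2$ changes `outMod` by exactly $\Delta$.
  have hshift : ∀ κ : X k,
      ∫⁻ ω, (tripleWeight κ ω * weightX p δ κ (outMod ξ ω)) ^ rY' δ =
      ∫⁻ ω, b ω * weightX p δ κ (outMod (ξ + (k : ℝ) ^ 2) ω - Delta k κ) ^ rY' δ := by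
    intro κ
    have hmp : MeasurePreserving (fun ω : ℝ × ℝ × ℝ =>
        (ω.1 + (κ.1.1 : ℝ) ^ 2, ω.2.1 + (κ.1.2.1 : ℝ) ^ 2, ω.2.2 + (κ.1.2.2 : ℝ) ^ 2)) :=
      (measurePreserving_add_right volume ((κ.1.1 : ℝ) ^ 2)).prod
        ((measurePreserving_add_right volume ((κ.1.2.1 : ℝ) ^ 2)).prod
          (measurePreserving_add_right volume ((κ.1.2.2 : ℝ) ^ 2)))
    have hm : Measurable fun ω : ℝ × ℝ × ℝ =>
        b ω * weightX p δ κ (outMod (ξ + (k : ℝ) ^ 2) ω - Delta k κ) ^ rY' δ :=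
      hbm.mul (((measurable_weightX _).comp (hom _ _)).pow_const _)
    rw [← hmp.lintegral_comp hm]
    refine lintegral_congr fun ω => ?_
    rw [ENNReal.mul_rpow_of_nonneg _ _ hr'.le]
    congr 1
    · simp only [tripleWeight, hb, ENNReal.mul_rpow_of_nonneg _ _ hr'.le, jbe_rpow]
      rw [show -(1 / 2) * rY' δ = -(rY' δ / 2) by ring]
    · congr 2
      simp only [outMod, Delta]
      push_cast
      ring
  simp_rw [hshift]
  have : Countable (X k) := inferInstance
  rw [← lintegral_tsum (f := fun (κ : X k) ω =>
      b ω * weightX p δ κ (outMod (ξ + (k : ℝ) ^ 2) ω - Delta k κ) ^ rY' δ) fun κ => (hbm.mul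
    (((measurable_weightX _).comp (hom _ _)).pow_const _)).aemeasurable]
  simp_rw [ENNReal.tsum_mul_left]
  calc _ ≤ ∫⁻ ω, b ω * C := by
        gcongr with ω
        exact hX X hN k _
    _ = S * (S * S) * C := by
        rw [lintegral_mul_const _ hbm, hb,
          lintegral_triple _ _ _ (measurable_jbe _) (measurable_jbe _) (measurable_jbe _)]

/-- The integral over $\xi$ is done first: $\langle\cdot\rangle^{-(1+\theta)}$ has an integral that
does not depend on $\omega$, and what remains factors. The power of $\langle k_3\rangle$ is weakened
to that of $\langle k_2\rangle$ to make the two weights alike. -/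
theorem Exponents.exists_lintegral_weightY_le {p δ : ℝ} (h : Exponents p δ) :
    ∃ C : ℝ≥0∞, C ≠ ∞ ∧ ∀ f : Fin 3 → ℤ → ℝ → ℝ≥0∞, (∀ j k, Measurable (f j k)) →
      ∀ κ : ℤ × ℤ × ℤ,
      ∫⁻ ξ, ∫⁻ ω, (tripleDensity f κ ω * weightY p δ κ (outMod ξ ω)) ^ rY δ ≤
        C * (jbe κ.2.1 (-(rY δ * (1 / 2 - 26 * gain p))) *
          jbe κ.2.2 (-(rY δ * (1 / 2 - 26 * gain p)))) *
        ((∫⁻ x, f 0 κ.1 x ^ rY δ) *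
          ((∫⁻ x, f 1 κ.2.1 x ^ rY δ) * ∫⁻ x, f 2 κ.2.2 x ^ rY δ)) := by
  have hr := h.rY_pos
  have hθ := h.gain_pos
  refine ⟨∫⁻ x, jbe x (-(1 + gain p)), (lintegral_jbe_lt_top (by linarith)).ne, fun f hf κ => ?_⟩
  have hom : Measurable fun z : ℝ × ℝ × ℝ × ℝ => weightY p δ κ (outMod z.1 z.2) :=
    (measurable_weightY _).comp measurable_outMod
  rw [lintegral_lintegral_swap
    ((((measurable_tripleDensity hf κ).comp measurable_snd).mul hom).pow_const _).aemeasurable]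
  set c := jbe κ.2.1 (-(rY δ * (1 / 2 - 26 * gain p))) *
          jbe κ.2.2 (-(rY δ * (1 / 2 - 26 * gain p))) with hc
  have h1 : ∀ ω : ℝ × ℝ × ℝ, ∫⁻ ξ, (tripleDensity f κ ω * weightY p δ κ (outMod ξ ω)) ^ rY δ ≤
      (∫⁻ x, jbe x (-(1 + gain p))) * c * tripleDensity f κ ω ^ rY δ := by
    intro ω
    have h2 : ∀ ξ, (tripleDensity f κ ω * weightY p δ κ (outMod ξ ω)) ^ rY δ ≤
        jbe (ξ + (ω.1 - ω.2.1 - ω.2.2)) (-(1 + gain p)) * (c * tripleDensity f κ ω ^ rY δ) := by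
      intro ξ
      rw [ENNReal.mul_rpow_of_nonneg _ _ hr.le, mul_comm, ← mul_assoc]
      gcongr
      rw [weightY, ENNReal.mul_rpow_of_nonneg _ _ hr.le, ENNReal.mul_rpow_of_nonneg _ _ hr.le,
        jbe_rpow, jbe_rpow, jbe_rpow, mul_comm, hc]
      gcongr
      · rw [outMod, show ξ + ω.1 - ω.2.1 - ω.2.2 = ξ + (ω.1 - ω.2.1 - ω.2.2) by ring]
        apply jbe_mono
        field_simp; rfl
      · apply jbe_mono; apply le_of_eq; ring
      · apply jbe_mono; nlinarith
    refine (lintegral_mono h2).trans ?_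
    have hm : Measurable fun ξ => jbe (ξ + (ω.1 - ω.2.1 - ω.2.2)) (-(1 + gain p)) :=
      (measurable_jbe _).comp (measurable_id.add_const _)
    rw [lintegral_mul_const _ hm,
      lintegral_add_right_eq_self (fun x => jbe x (-(1 + gain p))), ← mul_assoc]
  refine (lintegral_mono h1).trans ?_
  rw [lintegral_const_mul _ ((measurable_tripleDensity hf κ).pow_const _)]
  gcongr
  simp only [tripleDensity, ENNReal.mul_rpow_of_nonneg _ _ hr.le]
  rw [lintegral_triple (fun x => f 0 κ.1 x ^ rY δ) (fun x => f 1 κ.2.1 x ^ rY δ)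
    (fun x => f 2 κ.2.2 x ^ rY δ) ((hf _ _).pow_const _) ((hf _ _).pow_const _)
    ((hf _ _).pow_const _)]

/-- The trilinear sum over frequencies, with weights at the two last ones. -/
theorem exists_tsum_trilinear_le {q a : ℝ} (hq : 1 < q) (ha : 1 < a * (q / (q - 1))) :
    ∃ C : ℝ≥0∞, C ≠ ∞ ∧
    ∀ (X : ℤ → Set (ℤ × ℤ × ℤ)), (∀ k, ∀ κ ∈ X k, Nonresonant k κ) → ∀ n : Fin 3 → ℤ → ℝ≥0∞,
      ∑' k, (∑' κ : X k, jbe κ.1.2.1 (-a) * jbe κ.1.2.2 (-a) *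
        (n 0 κ.1.1 * (n 1 κ.1.2.1 * n 2 κ.1.2.2))) ^ q ≤
      C * ∏ j, ∑' k, n j k ^ q := by
  have hc : q.HolderConjugate (q / (q - 1)) := Real.HolderConjugate.conjExponent hq
  have hq0 : 0 < q := by linarith
  set S := ∑' k : ℤ, jbe k (-(a * (q / (q - 1)))) with hS
  have hSt : S ≠ ∞ := (tsum_jbe_lt_top ha).ne
  have hq1 : 0 < 1 / (q / (q - 1)) := by
    have : 0 < q - 1 := by linarith
    positivity
  refine ⟨S ^ (1 / (q / (q - 1)) * q) * S ^ (1 / (q / (q - 1)) * q), by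
    have : 0 ≤ 1 / (q / (q - 1)) * q := by positivity
    finiteness, fun X hX n => ?_⟩
  have hw : ∀ j, (∑' b : ℤ, jbe b (-a) * n j b) ^ q ≤
      S ^ (1 / (q / (q - 1)) * q) * ∑' k, n j k ^ q := by
    intro j
    have h1 := tsum_mul_le_Lp_mul_Lq hc (n j) (fun b : ℤ => jbe b (-a))
    simp only [jbe_rpow] at h1
    rw [show -a * (q / (q - 1)) = -(a * (q / (q - 1))) by ring] at h1
    calc (∑' b : ℤ, jbe b (-a) * n j b) ^ q
        ≤ ((∑' i, n j i ^ q) ^ (1 / q) * S ^ (1 / (q / (q - 1)))) ^ q := by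
          refine ENNReal.rpow_le_rpow ?_ hq0.le
          simpa only [mul_comm] using h1
      _ = _ := by
          rw [ENNReal.mul_rpow_of_nonneg _ _ hq0.le, ← ENNReal.rpow_mul, ← ENNReal.rpow_mul,
            one_div_mul_cancel hq0.ne', ENNReal.rpow_one, mul_comm]
  -- Jensen's weight takes up $n_1$, $n_2$ and both brackets. The factor $n_0$ is kept for the sum
  -- over $k$, where $k\mapsto k_2+k_3-k$ is a bijection.
  set W : ℤ × ℤ → ℝ≥0∞ := fun z => (jbe z.1 (-a) * n 1 z.1) * (jbe z.2 (-a) * n 2 z.2) with hW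
  have hWs : ∑' z, W z = (∑' b : ℤ, jbe b (-a) * n 1 b) * ∑' b : ℤ, jbe b (-a) * n 2 b := by
    rw [ENNReal.tsum_prod']
    simp_rw [hW, ENNReal.tsum_mul_left, ENNReal.tsum_mul_right]
  have hk : ∀ k, (∑' κ : X k, jbe κ.1.2.1 (-a) * jbe κ.1.2.2 (-a) *
        (n 0 κ.1.1 * (n 1 κ.1.2.1 * n 2 κ.1.2.2))) ^ q ≤
        (∑' z, W z) ^ (q - 1) * ∑' z : ℤ × ℤ, W z * n 0 (z.1 + z.2 - k) ^ q := by
    intro k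
    refine le_trans (ENNReal.rpow_le_rpow ?_ hq0.le) (tsum_mul_rpow_le hq _ _)
    refine (tsum_interactions_le (hX k) (fun κ => jbe κ.2.1 (-a) * jbe κ.2.2 (-a) *
        (n 0 κ.1 * (n 1 κ.2.1 * n 2 κ.2.2)))).trans (le_of_eq ?_)
    rw [← ENNReal.tsum_prod (f := fun a' b : ℤ => jbe a' (-a) * jbe b (-a) *
        (n 0 (a' + b - k) * (n 1 a' * n 2 b)))]
    refine tsum_congr fun z => ?_
    simp only [hW]; ring
  refine (ENNReal.tsum_le_tsum hk).trans ?_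
  rw [ENNReal.tsum_mul_left, ENNReal.tsum_comm]
  simp_rw [ENNReal.tsum_mul_left]
  have hs : ∀ z : ℤ × ℤ, ∑' k : ℤ, n 0 (z.1 + z.2 - k) ^ q = ∑' k, n 0 k ^ q := fun z =>
    (Equiv.subLeft (z.1 + z.2)).tsum_eq fun k => n 0 k ^ q
  simp_rw [hs, ENNReal.tsum_mul_right]
  rw [← mul_assoc]
  have hpow : (∑' z, W z) ^ (q - 1) * ∑' z, W z = (∑' z, W z) ^ q := by
    conv_lhs => rw [← ENNReal.rpow_one (∑' z, W z), ← ENNReal.rpow_mul, one_mul]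
    rw [← ENNReal.rpow_add_of_nonneg _ _ (by linarith) zero_le_one]
    congr 1; ring
  rw [hpow, hWs, ENNReal.mul_rpow_of_nonneg _ _ hq0.le, Fin.prod_univ_three]
  calc _ ≤ (S ^ (1 / (q / (q - 1)) * q) * ∑' k, n 1 k ^ q) *
        (S ^ (1 / (q / (q - 1)) * q) * ∑' k, n 2 k ^ q) * ∑' k, n 0 k ^ q := by
        gcongr <;> apply hw
    _ = _ := by ring

/-- The trilinear estimate for densities in `Y₀`. -/
theorem Exponents.exists_trilinear_le {p δ : ℝ} (h : Exponents p δ) : ∃ C : ℝ≥0∞, C ≠ ∞ ∧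
    ∀ (X : ℤ → Set (ℤ × ℤ × ℤ)), (∀ k, ∀ κ ∈ X k, Nonresonant k κ) →
    ∀ f : Fin 3 → ℤ → ℝ → ℝ≥0∞, (∀ j k, Measurable (f j k)) →
      ∑' k, (∫⁻ ξ, (∑' κ : X k, jbe κ.1.2.1 (-(1 / 2)) * jbe κ.1.2.2 (-(1 / 2)) *
        ∫⁻ ω, tripleWeight κ ω * tripleDensity f κ ω * jbe (outMod ξ ω) (-1 + gain p)) ^ rY δ) ^
          (p / rY δ) ≤
      C * ∏ j, ∑' k, (∫⁻ x, f j k x ^ rY δ) ^ (p / rY δ) := by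
  obtain ⟨C₁, hC₁, h1⟩ := h.exists_tsum_lintegral_weightX_le
  obtain ⟨C₂, hC₂, h2⟩ := h.exists_lintegral_weightY_le
  have hr := h.rY_pos
  have hr' := h.rY'_pos
  have hq := h.one_lt_div
  have hp := h.two_le
  have hq0 : 0 < p / rY δ := by linarith
  -- The condition on $a$ reduces to $26\theta p+\delta p<1$, where $\theta p=1/100$ and $\delta
  -- p<1/100$.
  obtain ⟨C₃, hC₃, h3⟩ := exists_tsum_trilinear_le (q := p / rY δ)
    (a := rY δ * (1 / 2 - 26 * gain p)) hq (by
      have e1 : p / rY δ = p * (1 / 2 + δ) := by rw [← one_div_rY δ]; ring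
      have e2 : rY δ * (p / rY δ) = p := by field_simp
      have e3 : rY δ * (1 / 2 - 26 * gain p) * (p / rY δ / (p / rY δ - 1)) =
          (rY δ * (p / rY δ)) * (1 / 2 - 26 * gain p) / (p / rY δ - 1) := by ring
      rw [e3, e2, lt_div_iff₀ (by linarith), e1, one_mul]
      have := gain_mul hp
      nlinarith [h.lt])
  set c := C₁ ^ (1 / rY' δ * rY δ) * C₂ with hc
  have hct : c ≠ ∞ := by
    have : 0 ≤ 1 / rY' δ * rY δ := by positivity
    finiteness
  refine ⟨c ^ (p / rY δ) * C₃, by finiteness, fun X hX f hf => ?_⟩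
  set N : Fin 3 → ℤ → ℝ≥0∞ := fun j k => ∫⁻ x, f j k x ^ rY δ with hN
  have hom (ξ : ℝ) : Measurable fun ω : ℝ × ℝ × ℝ => outMod ξ ω := by unfold outMod; fun_prop
  have key : ∀ k, ∫⁻ ξ, (∑' κ : X k, jbe κ.1.2.1 (-(1 / 2)) * jbe κ.1.2.2 (-(1 / 2)) *
        ∫⁻ ω, tripleWeight κ ω * tripleDensity f κ ω * jbe (outMod ξ ω) (-1 + gain p)) ^ rY δ ≤
      c * ∑' κ : X k, jbe κ.1.2.1 (-(rY δ * (1 / 2 - 26 * gain p))) *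
        jbe κ.1.2.2 (-(rY δ * (1 / 2 - 26 * gain p))) *
        (N 0 κ.1.1 * (N 1 κ.1.2.1 * N 2 κ.1.2.2)) := by
    intro k
    have hpt : ∀ ξ, (∑' κ : X k, jbe κ.1.2.1 (-(1 / 2)) * jbe κ.1.2.2 (-(1 / 2)) *
        ∫⁻ ω, tripleWeight κ ω * tripleDensity f κ ω * jbe (outMod ξ ω) (-1 + gain p)) ^ rY δ ≤
        C₁ ^ (1 / rY' δ * rY δ) *
          ∑' κ : X k, ∫⁻ ω, (tripleDensity f κ ω * weightY p δ κ (outMod ξ ω)) ^ rY δ := by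
      intro ξ
      -- Hölder in $\omega$ here and over the interactions below. The dual factor, the input weights
      -- times `weightX`, is bounded uniformly in $k$ and $\xi$. The factor with the densities is
      -- raised to the power $r_0$, so that its sum and integral can be interchanged.
      have hκ : ∀ κ : X k, jbe κ.1.2.1 (-(1 / 2)) * jbe κ.1.2.2 (-(1 / 2)) *
          ∫⁻ ω, tripleWeight κ ω * tripleDensity f κ ω * jbe (outMod ξ ω) (-1 + gain p) ≤
          (∫⁻ ω, (tripleDensity f κ ω * weightY p δ κ (outMod ξ ω)) ^ rY δ) ^ (1 / rY δ) *
          (∫⁻ ω, (tripleWeight κ ω * weightX p δ κ (outMod ξ ω)) ^ rY' δ) ^ (1 / rY' δ) := by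
        intro κ
        refine le_trans ?_ (ENNReal.lintegral_mul_le_Lp_mul_Lq volume h.conj
          ((measurable_tripleDensity hf κ).mul ((measurable_weightY _).comp (hom ξ))).aemeasurable
          ((measurable_tripleWeight κ).mul ((measurable_weightX _).comp (hom ξ))).aemeasurable)
        have hm : Measurable fun ω =>
            tripleWeight κ ω * tripleDensity f κ ω * jbe (outMod ξ ω) (-1 + gain p) :=
          ((measurable_tripleWeight κ).mul (measurable_tripleDensity hf κ)).mul
            ((measurable_jbe _).comp (hom ξ))
        rw [← lintegral_const_mul _ hm]
        refine lintegral_mono fun ω => ?_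
        calc _ = tripleWeight κ ω * tripleDensity f κ ω * (jbe κ.1.2.1 (-(1 / 2)) *
              jbe κ.1.2.2 (-(1 / 2)) * jbe (outMod ξ ω) (-1 + gain p)) := by ring
          _ ≤ tripleWeight κ ω * tripleDensity f κ ω *
              (weightX p δ κ (outMod ξ ω) * weightY p δ κ (outMod ξ ω)) := by
              exact mul_le_mul_right (h.weight_split (hX k κ κ.2).abs_le _) _
          _ = _ := by simp only [Pi.mul_apply]; ring
      calc _ ≤ ((∑' κ : X k,
              ∫⁻ ω, (tripleDensity f κ ω * weightY p δ κ (outMod ξ ω)) ^ rY δ) ^ (1 / rY δ) *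
            C₁ ^ (1 / rY' δ)) ^ rY δ := by
            refine ENNReal.rpow_le_rpow ?_ hr.le
            refine (ENNReal.tsum_le_tsum hκ).trans ((tsum_mul_le_Lp_mul_Lq h.conj _ _).trans ?_)
            simp_rw [← ENNReal.rpow_mul, one_div_mul_cancel hr.ne', one_div_mul_cancel hr'.ne',
              ENNReal.rpow_one]
            gcongr
            exact h1 X hX k ξ
        _ = _ := by
            rw [ENNReal.mul_rpow_of_nonneg _ _ hr.le, ← ENNReal.rpow_mul, ← ENNReal.rpow_mul,
              one_div_mul_cancel hr.ne', ENNReal.rpow_one, mul_comm]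
    refine (lintegral_mono hpt).trans ?_
    have hmeas : ∀ κ : X k, Measurable fun ξ =>
        ∫⁻ ω, (tripleDensity f κ ω * weightY p δ κ (outMod ξ ω)) ^ rY δ := by
      intro κ
      refine Measurable.lintegral_prod_right' (f := fun z : ℝ × ℝ × ℝ × ℝ =>
        (tripleDensity f κ z.2 * weightY p δ κ (outMod z.1 z.2)) ^ rY δ) ?_
      exact (((measurable_tripleDensity hf κ).comp measurable_snd).mul
        ((measurable_weightY _).comp measurable_outMod)).pow_const _
    rw [lintegral_const_mul _ (Measurable.tsum hmeas),
      lintegral_tsum fun κ => (hmeas κ).aemeasurable, hc, mul_assoc]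
    refine mul_le_mul_right ?_ _
    rw [← ENNReal.tsum_mul_left]
    refine ENNReal.tsum_le_tsum fun κ => ?_
    rw [← mul_assoc]
    exact h2 f hf κ
  calc _ ≤ ∑' k, (c * ∑' κ : X k, jbe κ.1.2.1 (-(rY δ * (1 / 2 - 26 * gain p))) *
        jbe κ.1.2.2 (-(rY δ * (1 / 2 - 26 * gain p))) *
        (N 0 κ.1.1 * (N 1 κ.1.2.1 * N 2 κ.1.2.2))) ^ (p / rY δ) := by
        gcongr with k; exact key k
    _ ≤ _ := by
        simp_rw [ENNReal.mul_rpow_of_nonneg _ _ hq0.le]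
        rw [ENNReal.tsum_mul_left, mul_assoc]
        gcongr
        exact h3 X hX N

end

section

/-! ### Characters -/

/-- The character `e^{ix}`. -/
def cis (x : ℝ) : ℂ := Complex.exp (x * Complex.I)

theorem norm_cis (x : ℝ) : ‖cis x‖ = 1 := Complex.norm_exp_ofReal_mul_I x

theorem cis_add (x y : ℝ) : cis (x + y) = cis x * cis y := by
  rw [cis, cis, cis, ← Complex.exp_add]; push_cast; ring_nf

theorem cis_zero : cis 0 = 1 := by simp [cis]

theorem continuous_cis : Continuous cis := by unfold cis; fun_prop

theorem star_cis (x : ℝ) : starRingEnd ℂ (cis x) = cis (-x) := by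
  rw [cis, cis, ← Complex.exp_conj]; simp

theorem hasDerivAt_cis_mul (b t : ℝ) :
    HasDerivAt (fun t : ℝ => cis (b * t)) (Complex.I * b * cis (b * t)) t := by
  have h1 : HasDerivAt (fun t : ℝ => ((b * t : ℝ) : ℂ) * Complex.I) (b * Complex.I) t := by
    have := (((hasDerivAt_id t).const_mul b).ofReal_comp).mul_const Complex.I
    simpa using this
  have h2 : Complex.I * b * cis (b * t) = cis (b * t) * (b * Complex.I) := by ring
  rw [h2]
  exact h1.cexp

theorem norm_cis_mul (x : ℝ) (z : ℂ) : ‖cis x * z‖ = ‖z‖ := by rw [norm_mul, norm_cis, one_mul]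

/-! ### Fourier transforms of compactly supported functions -/

theorem integral_deriv_mul_cis {φ φ' : ℝ → ℂ} (hφ : ∀ t, HasDerivAt φ (φ' t) t)
    (hi : Integrable φ) (hi' : Integrable φ') (x : ℝ) :
    ∫ t, φ' t * cis (-x * t) = Complex.I * x * ∫ t, φ t * cis (-x * t) := by
  have hb : ∀ f : ℝ → ℂ, Integrable f → Integrable fun t => f t * cis (-x * t) := by
    intro f hf
    refine hf.mul_bdd (c := 1) ?_ (Filter.Eventually.of_forall fun t => (norm_cis _).le)
    exact (continuous_cis.comp (continuous_const.mul continuous_id)).aestronglyMeasurable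
  have h1 : ∀ t, HasDerivAt (fun t => φ t * cis (-x * t))
      (φ' t * cis (-x * t) + φ t * (Complex.I * ((-x : ℝ) : ℂ) * cis (-x * t))) t :=
    fun t => (hφ t).mul (hasDerivAt_cis_mul _ t)
  have h2 : ∀ t, φ t * (Complex.I * ((-x : ℝ) : ℂ) * cis (-x * t)) =
      -(Complex.I * x) * (φ t * cis (-x * t)) := fun t => by push_cast; ring
  simp_rw [h2] at h1
  have h3 := integral_eq_zero_of_hasDerivAt_of_integrable h1
    ((hb _ hi').add ((hb _ hi).const_mul _)) (hb _ hi)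
  rw [integral_add (hb _ hi') ((hb _ hi).const_mul _), integral_const_mul] at h3
  linear_combination h3

theorem norm_integral_mul_cis_le (φ : ℝ → ℂ) (x : ℝ) :
    ‖∫ t, φ t * cis (-x * t)‖ ≤ ∫ t, ‖φ t‖ := by
  refine (norm_integral_le_integral_norm _).trans (le_of_eq ?_)
  simp_rw [norm_mul, norm_cis, mul_one]

/-- Inversion for the characters $e^{2\pi ixt}$, rescaled by $\xi=2\pi x$. -/
theorem fourier_inversion {f : ℝ → ℂ} (hc : Continuous f) (hi : Integrable f)
    (hF : Integrable fun ξ : ℝ => (2 * Real.pi : ℂ)⁻¹ * ∫ t, f t * cis (-ξ * t)) (t : ℝ) :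
    ∫ ξ : ℝ, cis (ξ * t) * ((2 * Real.pi : ℂ)⁻¹ * ∫ t, f t * cis (-ξ * t)) = f t := by
  have hpi := Real.pi_pos
  have h1 : ∀ x : ℝ, FourierTransform.fourier f x = ∫ t, f t * cis (-(2 * Real.pi * x) * t) := by
    intro x
    rw [Real.fourier_eq']
    refine integral_congr_ae (Filter.Eventually.of_forall fun v => ?_)
    simp only [cis, smul_eq_mul, RCLike.inner_apply, conj_trivial]
    rw [mul_comm]
    congr 2
    push_cast; ring
  have hpi' : (2 * Real.pi : ℂ) ≠ 0 := by
    exact_mod_cast (by positivity : (2 * Real.pi : ℝ) ≠ 0)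
  have h2 : Integrable (FourierTransform.fourier f) := by
    have := (hF.comp_mul_left' (R := 2 * Real.pi) (by positivity)).const_mul (2 * Real.pi : ℂ)
    refine this.congr (Filter.Eventually.of_forall fun x => ?_)
    simp only [h1]
    rw [mul_inv_cancel_left₀ hpi']
  have h3 := congrFun (hc.fourierInv_fourier_eq hi h2) t
  rw [Real.fourierInv_eq'] at h3
  have h4 := Measure.integral_comp_mul_left
    (fun ξ : ℝ => cis (ξ * t) * ((2 * Real.pi : ℂ)⁻¹ * ∫ t, f t * cis (-ξ * t))) (2 * Real.pi)
  have h5 : ∫ ξ : ℝ, cis (ξ * t) * ((2 * Real.pi : ℂ)⁻¹ * ∫ t, f t * cis (-ξ * t)) =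
      (2 * Real.pi : ℂ) * ∫ x : ℝ, cis (2 * Real.pi * x * t) *
        ((2 * Real.pi : ℂ)⁻¹ * ∫ t, f t * cis (-(2 * Real.pi * x) * t)) := by
    rw [h4, abs_of_pos (by positivity), Complex.real_smul]
    push_cast
    rw [mul_inv_cancel_left₀ hpi']
  rw [h5, ← integral_const_mul]
  refine Eq.trans (integral_congr_ae (Filter.Eventually.of_forall fun x => ?_)) h3
  simp only [h1, smul_eq_mul, RCLike.inner_apply, conj_trivial]
  have h6 : Complex.exp (((2 * Real.pi * (t * x) : ℝ) : ℂ) * Complex.I) =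
      cis (2 * Real.pi * x * t) := by
    rw [cis]; congr 2; push_cast; ring
  rw [h6]; field_simp

/-! ### The time cutoff -/

/-- A smooth cutoff that is `1` on `[-1, 1]` and is supported in `[-2, 2]`. -/
def cutoff (t : ℝ) : ℝ := (⟨1, 2, one_pos, one_lt_two⟩ : ContDiffBump (0 : ℝ)) t

theorem contDiff_cutoff : ContDiff ℝ 2 cutoff := ContDiffBump.contDiff _

theorem cutoff_eq_one {t : ℝ} (ht : |t| ≤ 1) : cutoff t = 1 :=
  ContDiffBump.one_of_mem_closedBall _ (by simpa using ht)

theorem hasCompactSupport_cutoff : HasCompactSupport cutoff := ContDiffBump.hasCompactSupport _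

theorem cutoff_eq_zero {t : ℝ} (ht : 2 ≤ |t|) : cutoff t = 0 :=
  ContDiffBump.zero_of_le_dist _ (by simpa [Real.dist_eq] using ht)

theorem tsupport_cutoff_subset : tsupport cutoff ⊆ Set.Icc (-2) 2 := by
  refine closure_minimal (fun t ht => ?_) isClosed_Icc
  rw [Set.mem_Icc, ← abs_le]
  by_contra hc
  exact ht (cutoff_eq_zero (not_le.mp hc).le)

theorem deriv_cutoff_eq_zero {t : ℝ} (ht : 2 < |t|) : deriv cutoff t = 0 := by
  by_contra hc
  have := tsupport_cutoff_subset (support_deriv_subset hc)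
  exact absurd (abs_le.mpr this) (not_le.mpr ht)

theorem deriv2_cutoff_eq_zero {t : ℝ} (ht : 2 < |t|) : deriv (deriv cutoff) t = 0 := by
  by_contra hc
  have := tsupport_cutoff_subset (closure_minimal support_deriv_subset isClosed_closure
    (support_deriv_subset hc))
  exact absurd (abs_le.mpr this) (not_le.mpr ht)

theorem contDiff_deriv_cutoff : ContDiff ℝ 1 (deriv cutoff) := by
  have := contDiff_cutoff
  rw [show (2 : WithTop ℕ∞) = 1 + 1 by norm_num, contDiff_succ_iff_deriv] at this
  exact this.2.2

theorem hasDerivAt_cutoff (t : ℝ) : HasDerivAt cutoff (deriv cutoff t) t :=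
  (contDiff_cutoff.differentiable (by norm_num) t).hasDerivAt

theorem hasDerivAt_deriv_cutoff (t : ℝ) : HasDerivAt (deriv cutoff) (deriv (deriv cutoff) t) t :=
  (contDiff_deriv_cutoff.differentiable (by norm_num) t).hasDerivAt

theorem continuous_deriv2_cutoff : Continuous (deriv (deriv cutoff)) :=
  contDiff_deriv_cutoff.continuous_deriv le_rfl

theorem exists_cutoff_bound : ∃ C : ℝ, 0 ≤ C ∧ ∀ t, |cutoff t| ≤ C ∧ |deriv cutoff t| ≤ C ∧
    |deriv (deriv cutoff) t| ≤ C := by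
  obtain ⟨C₀, h0⟩ := hasCompactSupport_cutoff.exists_bound_of_continuous contDiff_cutoff.continuous
  obtain ⟨C₁, h1⟩ := hasCompactSupport_cutoff.deriv.exists_bound_of_continuous
    contDiff_deriv_cutoff.continuous
  obtain ⟨C₂, h2⟩ := hasCompactSupport_cutoff.deriv.deriv.exists_bound_of_continuous
    continuous_deriv2_cutoff
  refine ⟨max C₀ (max C₁ C₂), ?_, fun t => ⟨?_, ?_, ?_⟩⟩
  · exact ((abs_nonneg _).trans (h0 0)).trans (le_max_left _ _)
  · exact (h0 t).trans (le_max_left _ _)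
  · exact (h1 t).trans ((le_max_left _ _).trans (le_max_right _ _))
  · exact (h2 t).trans ((le_max_right _ _).trans (le_max_right _ _))

theorem two_lt_abs_inv_mul {T t : ℝ} (hT : 0 < T) (ht : 2 * T < |t|) : 2 < |T⁻¹ * t| := by
  rw [abs_mul, abs_inv, abs_of_pos hT, inv_mul_eq_div, lt_div_iff₀ hT]; exact ht

/-- The cutoff at scale `T`, its derivatives and their bounds. -/
theorem exists_scaled_cutoff : ∃ C : ℝ, 0 ≤ C ∧ ∀ T : ℝ, 0 < T → ∃ χ χ' χ'' : ℝ → ℂ,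
    (∀ t, χ t = (cutoff (T⁻¹ * t) : ℂ)) ∧ (∀ t, HasDerivAt χ (χ' t) t) ∧
    (∀ t, HasDerivAt χ' (χ'' t) t) ∧ Continuous χ'' ∧ (∀ t, 2 * T < |t| → χ t = 0) ∧
    (∀ t, 2 * T < |t| → χ' t = 0) ∧ (∀ t, 2 * T < |t| → χ'' t = 0) ∧ (∀ t, ‖χ t‖ ≤ C) ∧
    (∀ t, ‖χ' t‖ ≤ T⁻¹ * C) ∧ ∀ t, ‖χ'' t‖ ≤ T⁻¹ * (T⁻¹ * C) := by
  obtain ⟨C, hC0, hC⟩ := exists_cutoff_bound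
  refine ⟨C, hC0, fun T hT => ⟨fun t => (cutoff (T⁻¹ * t) : ℂ),
    fun t => ((T⁻¹ * deriv cutoff (T⁻¹ * t) : ℝ) : ℂ),
    fun t => ((T⁻¹ * (T⁻¹ * deriv (deriv cutoff) (T⁻¹ * t)) : ℝ) : ℂ), fun t => rfl, fun t => ?_,
    fun t => ?_, ?_, fun t ht => ?_, fun t ht => ?_, fun t ht => ?_, fun t => ?_, fun t => ?_,
    fun t => ?_⟩⟩
  · have := ((hasDerivAt_cutoff (T⁻¹ * t)).comp t ((hasDerivAt_id t).const_mul T⁻¹)).ofReal_comp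
    rw [mul_one, mul_comm] at this
    exact this
  · have := (((hasDerivAt_deriv_cutoff (T⁻¹ * t)).comp t
      ((hasDerivAt_id t).const_mul T⁻¹)).const_mul T⁻¹).ofReal_comp
    rw [mul_one, mul_comm (deriv (deriv cutoff) (T⁻¹ * t))] at this
    exact this
  · exact Complex.continuous_ofReal.comp (continuous_const.mul (continuous_const.mul
      (continuous_deriv2_cutoff.comp (continuous_const.mul continuous_id))))
  · beta_reduce; rw [cutoff_eq_zero (two_lt_abs_inv_mul hT ht).le]; simp
  · beta_reduce; rw [deriv_cutoff_eq_zero (two_lt_abs_inv_mul hT ht)]; simp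
  · beta_reduce; rw [deriv2_cutoff_eq_zero (two_lt_abs_inv_mul hT ht)]; simp
  · rw [Complex.norm_real]; exact (hC _).1
  · rw [Complex.norm_real, norm_mul, Real.norm_of_nonneg (inv_pos.mpr hT).le]
    gcongr; exact (hC _).2.1
  · rw [Complex.norm_real, norm_mul, norm_mul, Real.norm_of_nonneg (inv_pos.mpr hT).le]
    gcongr; exact (hC _).2.2

/-! ### The kernel of the modified Duhamel operator -/

variable (η : SchwartzMap ℝ ℂ)

/-- The derivative of a Schwartz function. -/
def sderiv : SchwartzMap ℝ ℂ := SchwartzMap.derivCLM ℂ ℂ η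

theorem hasDerivAt_schwartz (t : ℝ) : HasDerivAt η (sderiv η t) t := by
  rw [sderiv, SchwartzMap.derivCLM_apply]
  exact η.differentiableAt.hasDerivAt

theorem exists_schwartz_bound : ∃ C : ℝ, 0 ≤ C ∧ (∀ t, ‖η t‖ ≤ C) ∧ (∀ t, ‖sderiv η t‖ ≤ C) ∧
    (∫ t, ‖η t‖) ≤ C ∧ (∫ t, ‖sderiv η t‖) ≤ C := by
  have hb : ∀ f : SchwartzMap ℝ ℂ, ∃ C, ∀ t, ‖f t‖ ≤ C := fun f => by
    obtain ⟨C, hC⟩ := f.decay 0 0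
    exact ⟨C, fun t => by simpa using hC.2 t⟩
  obtain ⟨C₀, h0⟩ := hb η
  obtain ⟨C₁, h1⟩ := hb (sderiv η)
  refine ⟨max (max C₀ C₁) (max (∫ t, ‖η t‖) (∫ t, ‖sderiv η t‖)), ?_, fun t => ?_, fun t => ?_,
    ?_, ?_⟩
  · exact ((norm_nonneg _).trans (h0 0)).trans ((le_max_left _ _).trans (le_max_left _ _))
  · exact (h0 t).trans ((le_max_left _ _).trans (le_max_left _ _))
  · exact (h1 t).trans ((le_max_right _ _).trans (le_max_left _ _))
  · exact (le_max_left _ _).trans (le_max_right _ _)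
  · exact (le_max_right _ _).trans (le_max_right _ _)

/-- The primitive of `e^{-ibs} η(Ds)`. -/
def oscPrim (b D t : ℝ) : ℂ := ∫ s in (0 : ℝ)..t, cis (-b * s) * η (D * s)

theorem continuous_osc (f : SchwartzMap ℝ ℂ) (b D : ℝ) :
    Continuous fun s : ℝ => cis (-b * s) * f (D * s) :=
  (continuous_cis.comp (continuous_const.mul continuous_id)).mul
    (f.continuous.comp (continuous_const.mul continuous_id))

theorem hasDerivAt_oscPrim (b D t : ℝ) :
    HasDerivAt (oscPrim η b D) (cis (-b * t) * η (D * t)) t :=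
  intervalIntegral.integral_hasDerivAt_right ((continuous_osc η b D).intervalIntegrable _ _)
    ((continuous_osc η b D).stronglyMeasurableAtFilter _ _)
    (continuous_osc η b D).continuousAt

theorem integral_norm_comp_mul (f : SchwartzMap ℝ ℂ) {D : ℝ} :
    ∫ s, ‖f (D * s)‖ = |D|⁻¹ * ∫ s, ‖f s‖ := by
  rw [Measure.integral_comp_mul_left (fun s => ‖f s‖) D, abs_inv, smul_eq_mul]

theorem integrable_norm_comp_mul (f : SchwartzMap ℝ ℂ) {D : ℝ} (hD : D ≠ 0) :
    Integrable fun s => ‖f (D * s)‖ :=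
  (f.integrable.comp_mul_left' hD).norm

/-- The mass of $f(D\,\cdot)$ is $|D|^{-1}\|f\|_1$, whatever the oscillation. This is the source of
the gain in $\Delta$. -/
theorem norm_integral_osc_le (f : SchwartzMap ℝ ℂ) (b t : ℝ) {D : ℝ} (hD : D ≠ 0) :
    ‖∫ s in (0 : ℝ)..t, cis (-b * s) * f (D * s)‖ ≤ |D|⁻¹ * ∫ s, ‖f s‖ := by
  refine (intervalIntegral.norm_integral_le_integral_norm_uIoc).trans ?_
  simp_rw [norm_cis_mul]
  rw [← integral_norm_comp_mul]
  exact setIntegral_le_integral (integrable_norm_comp_mul f hD)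
    (Filter.Eventually.of_forall fun s => norm_nonneg _)

theorem norm_oscPrim_le_mul_abs {C : ℝ} (hC : ∀ t, ‖η t‖ ≤ C) (b D t : ℝ) :
    ‖oscPrim η b D t‖ ≤ C * |t| := by
  have := intervalIntegral.norm_integral_le_of_norm_le_const (a := 0) (b := t)
    (f := fun s => cis (-b * s) * η (D * s)) (C := C) (fun s _ => by rw [norm_cis_mul]; exact hC _)
  rw [sub_zero] at this
  exact this

/-- Integration by parts for the primitive. -/
theorem oscPrim_parts (b D t : ℝ) :
    Complex.I * b * oscPrim η b D t + cis (-b * t) * η (D * t) =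
      η 0 + D * ∫ s in (0 : ℝ)..t, cis (-b * s) * sderiv η (D * s) := by
  have h1 : ∀ s ∈ Set.uIcc 0 t, HasDerivAt (fun s => cis (-b * s) * η (D * s))
      (Complex.I * ((-b : ℝ) : ℂ) * cis (-b * s) * η (D * s) +
        cis (-b * s) * ((D : ℝ) • sderiv η (D * s))) s := by
    intro s _
    refine (hasDerivAt_cis_mul (-b) s).mul ?_
    have := (hasDerivAt_schwartz η (D * s)).scomp s ((hasDerivAt_id s).const_mul D)
    rw [mul_one] at this
    exact this
  have h2 : ∀ s, Complex.I * ((-b : ℝ) : ℂ) * cis (-b * s) * η (D * s) +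
        cis (-b * s) * ((D : ℝ) • sderiv η (D * s)) =
      -(Complex.I * b) * (cis (-b * s) * η (D * s)) +
        D * (cis (-b * s) * sderiv η (D * s)) := by
    intro s; rw [Complex.real_smul]; push_cast; ring
  simp_rw [h2] at h1
  have i1 : IntervalIntegrable (fun s => -(Complex.I * b) * (cis (-b * s) * η (D * s)))
      volume 0 t := (continuous_const.mul (continuous_osc η b D)).intervalIntegrable _ _
  have i2 : IntervalIntegrable (fun s => (D : ℂ) * (cis (-b * s) * sderiv η (D * s)))
      volume 0 t := (continuous_const.mul (continuous_osc (sderiv η) b D)).intervalIntegrable _ _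
  have h3 := intervalIntegral.integral_eq_sub_of_hasDerivAt h1 (i1.add i2)
  rw [intervalIntegral.integral_add i1 i2,
    intervalIntegral.integral_const_mul, intervalIntegral.integral_const_mul] at h3
  simp only [mul_zero, cis_zero, one_mul] at h3
  rw [oscPrim]
  linear_combination -h3

/-- The time-localized Duhamel integral of `e^{iνs}`. -/
def locDuhamel (a D T ν t : ℝ) : ℂ :=
  (cutoff (T⁻¹ * t) : ℂ) * (cis (ν * t) * oscPrim η (a + ν) D t)

/-- The Fourier transform of `locDuhamel`. -/
def kernel (a D T ν ξ : ℝ) : ℂ :=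
  (2 * Real.pi : ℂ)⁻¹ * ∫ t, locDuhamel η a D T ν t * cis (-ξ * t)

/-- The substitution $s\mapsto t-s$ collects the phases into the single frequency $a+\nu$. -/
theorem duhamel_eq (a D ν t : ℝ) :
    ∫ s in (0 : ℝ)..t, cis (-((t - s) * a)) * η (D * (t - s)) * cis (ν * s) =
      cis (ν * t) * oscPrim η (a + ν) D t := by
  have h := intervalIntegral.integral_comp_sub_left (a := 0) (b := t)
    (fun s => cis (-(s * a)) * η (D * s) * cis (ν * (t - s))) t
  rw [sub_self, sub_zero] at h
  simp only [sub_sub_cancel] at h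
  rw [h, oscPrim, ← intervalIntegral.integral_const_mul]
  refine intervalIntegral.integral_congr fun s _ => ?_
  rw [show -(a + ν) * s = -(s * a) + -(ν * s) by ring, show ν * (t - s) = ν * t + -(ν * s) by ring,
    cis_add, cis_add]
  ring

theorem continuous_oscPrim_uncurry (a D : ℝ) :
    Continuous fun z : ℝ × ℝ => oscPrim η (a + z.1) D z.2 := by
  unfold oscPrim
  refine intervalIntegral.continuous_parametric_intervalIntegral_of_continuous ?_ continuous_snd
  change Continuous fun w : (ℝ × ℝ) × ℝ => cis (-(a + w.1.1) * w.2) * η (D * w.2)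
  refine (continuous_cis.comp ?_).mul (η.continuous.comp ?_) <;> fun_prop

theorem continuous_locDuhamel_uncurry (a D T : ℝ) :
    Continuous fun z : ℝ × ℝ => locDuhamel η a D T z.1 z.2 := by
  unfold locDuhamel
  refine (Complex.continuous_ofReal.comp (contDiff_cutoff.continuous.comp ?_)).mul
    ((continuous_cis.comp ?_).mul (continuous_oscPrim_uncurry η a D)) <;> fun_prop

theorem continuous_locDuhamel (a D T ν : ℝ) : Continuous (locDuhamel η a D T ν) :=
  (continuous_locDuhamel_uncurry η a D T).comp (Continuous.prodMk_right ν)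

theorem locDuhamel_eq_zero {T t : ℝ} (hT : 0 < T) (ht : 2 * T ≤ |t|) (a D ν : ℝ) :
    locDuhamel η a D T ν t = 0 := by
  rw [locDuhamel, cutoff_eq_zero, Complex.ofReal_zero, zero_mul]
  rw [abs_mul, abs_inv, abs_of_pos hT, inv_mul_eq_div, le_div_iff₀ hT]
  exact ht

theorem integrable_of_eq_zero {f : ℝ → ℂ} (hf : Continuous f) {R : ℝ}
    (h : ∀ t, R < |t| → f t = 0) : Integrable f := by
  refine hf.integrable_of_hasCompactSupport
    (HasCompactSupport.of_support_subset_isCompact (isCompact_Icc (a := -R) (b := R)) fun t ht => ?_)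
  rw [Set.mem_Icc, ← abs_le]
  by_contra hc
  exact ht (h t (not_le.mp hc))

theorem integrable_locDuhamel {T : ℝ} (hT : 0 < T) (a D ν : ℝ) :
    Integrable (locDuhamel η a D T ν) :=
  integrable_of_eq_zero (continuous_locDuhamel η a D T ν) fun _ ht =>
    locDuhamel_eq_zero η hT ht.le a D ν

theorem stronglyMeasurable_kernel (a D T : ℝ) :
    StronglyMeasurable fun z : ℝ × ℝ => kernel η a D T z.1 z.2 := by
  unfold kernel
  refine StronglyMeasurable.const_mul ?_ _
  refine StronglyMeasurable.integral_prod_right' (ν := volume)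
    (f := fun w : (ℝ × ℝ) × ℝ => locDuhamel η a D T w.1.1 w.2 * cis (-w.1.2 * w.2)) ?_
  refine Continuous.stronglyMeasurable (Continuous.mul ?_ (continuous_cis.comp (by fun_prop)))
  exact (continuous_locDuhamel_uncurry η a D T).comp (f := fun w : (ℝ × ℝ) × ℝ => (w.1.1, w.2))
    (by fun_prop)

/-- The constant part lives on an interval of length $4T$. The part $g$, concentrated at scale
$|D|^{-1}$ in the applications, is integrated over the whole line. -/
theorem integral_norm_le_of_bound {f : ℝ → ℂ} {g : ℝ → ℝ} {T c c' : ℝ} (hT : 0 < T)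
    (hg : Integrable g) (hg0 : ∀ t, 0 ≤ g t) (hc' : 0 ≤ c')
    (h : ∀ t, |t| ≤ 2 * T → ‖f t‖ ≤ c + c' * g t) (h0 : ∀ t, 2 * T < |t| → f t = 0) :
    ∫ t, ‖f t‖ ≤ 4 * T * c + c' * ∫ t, g t := by
  have hc : ∫ t, ((Set.Icc (-(2 * T)) (2 * T)).indicator (fun _ => c) t + c' * g t) =
      4 * T * c + c' * ∫ t, g t := by
    rw [integral_add ((integrable_indicator_iff measurableSet_Icc).mpr
      (integrableOn_const (by simp))) (hg.const_mul _), integral_const_mul,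
      integral_indicator measurableSet_Icc]
    simp only [integral_const, smul_eq_mul]
    rw [measureReal_restrict_apply_univ, Real.volume_real_Icc, max_eq_left (by linarith)]
    ring
  rw [← hc]
  refine integral_mono_of_nonneg (Filter.Eventually.of_forall fun t => norm_nonneg _)
    (((integrable_indicator_iff measurableSet_Icc).mpr
      (integrableOn_const (by simp))).add (hg.const_mul _))
    (Filter.Eventually.of_forall fun t => ?_)
  simp only
  by_cases ht : |t| ≤ 2 * T
  · rw [Set.indicator_of_mem (by rw [Set.mem_Icc, ← abs_le]; exact ht)]
    exact h t ht
  · rw [h0 t (not_le.mp ht), norm_zero, Set.indicator_of_notMem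
      (by rw [Set.mem_Icc, ← abs_le]; exact ht), zero_add]
    exact mul_nonneg hc' (hg0 t)

/-- The four bounds on the kernel, as `∫ φ e^{-ixt}` is at most `‖φ‖₁` and `‖φ'‖₁ / |x|`. -/
theorem exists_kernel_bounds : ∃ C : ℝ, 0 ≤ C ∧ ∀ (a D T ν ξ : ℝ), 0 < T → 1 ≤ |D| →
    |D| * ‖kernel η a D T ν ξ‖ ≤ C * T ∧
    |ξ - ν| * (|D| * ‖kernel η a D T ν ξ‖) ≤ C ∧
    |ξ + a| * ‖kernel η a D T ν ξ‖ ≤ C * T ∧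
    |ξ - ν| * (|ξ + a| * ‖kernel η a D T ν ξ‖) ≤ C := by
  obtain ⟨Cχ, hχ0, hχ⟩ := exists_scaled_cutoff
  obtain ⟨Cη, hη0, hη, hη', hηi, hηi'⟩ := exists_schwartz_bound η
  refine ⟨21 * (Cχ * Cη), by positivity, fun a D T ν ξ hT hD => ?_⟩
  have hD0 : D ≠ 0 := by rintro rfl; simp at hD; linarith
  have hDp : 0 < |D| := by linarith
  set b := a + ν with hb
  set H := oscPrim η b D with hH
  have hTi : T⁻¹ * T = 1 := inv_mul_cancel₀ hT.ne'
  obtain ⟨χ, χ', χ'', hχdef, hχd, hχd', cχ'', hχz, hχz', hχz'', nχ, nχ', nχ''⟩ := hχ T hT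
  have cχ : Continuous χ := continuous_iff_continuousAt.mpr fun t => (hχd t).continuousAt
  have cχ' : Continuous χ' := continuous_iff_continuousAt.mpr fun t => (hχd' t).continuousAt
  have hHd : ∀ t, HasDerivAt H (cis (-b * t) * η (D * t)) t := hasDerivAt_oscPrim η b D
  have cH : Continuous H := continuous_iff_continuousAt.mpr fun t => (hHd t).continuousAt
  have nH : ∀ t, ‖H t‖ ≤ |D|⁻¹ * Cη := fun t =>
    (norm_integral_osc_le η b t hD0).trans (by gcongr)
  have nH' : ∀ t, |t| ≤ 2 * T → ‖H t‖ ≤ Cη * (2 * T) := fun t ht =>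
    (norm_oscPrim_le_mul_abs η hη b D t).trans (by gcongr)
  -- $P=e^{-ibt}\frac{d}{dt}(e^{ibt}H)$. The size of $b$ is not controlled, but `oscPrim_parts`
  -- cancels it and bounds $P$ by $2C_\eta$.
  obtain ⟨P, hP⟩ : ∃ P : ℝ → ℂ, P = fun t => Complex.I * b * H t + cis (-b * t) * η (D * t) :=
    ⟨_, rfl⟩
  have cP : Continuous P := by
    rw [hP]; exact (continuous_const.mul cH).add (continuous_osc η b D)
  have nP : ∀ t, ‖P t‖ ≤ 2 * Cη := fun t => by
    rw [hP]; simp only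
    rw [hH, oscPrim_parts]
    refine (norm_add_le _ _).trans ?_
    rw [norm_mul, Complex.norm_real, Real.norm_eq_abs]
    have h1 := norm_integral_osc_le (sderiv η) b t hD0
    have h2 : |D| * ‖∫ s in (0 : ℝ)..t, cis (-b * s) * sderiv η (D * s)‖ ≤
        |D| * (|D|⁻¹ * ∫ s, ‖sderiv η s‖) := by gcongr
    rw [mul_inv_cancel_left₀ hDp.ne'] at h2
    linarith [hη 0]
  obtain ⟨Lf, hLf⟩ : ∃ Lf : ℝ → ℂ, Lf = fun t => cis (b * t) * H t := ⟨_, rfl⟩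
  have hLd : ∀ t, HasDerivAt Lf (cis (b * t) * P t) t := fun t => by
    have := (hasDerivAt_cis_mul b t).mul (hHd t)
    have h2 : cis (b * t) * P t =
        Complex.I * b * cis (b * t) * H t + cis (b * t) * (cis (-b * t) * η (D * t)) := by
      rw [hP]; ring
    rw [h2, hLf]
    exact this
  have cL : Continuous Lf := continuous_iff_continuousAt.mpr fun t => (hLd t).continuousAt
  have cLd : Continuous fun t => cis (b * t) * P t :=
    (continuous_cis.comp (continuous_const.mul continuous_id)).mul cP
  have nL : ∀ t, ‖Lf t‖ = ‖H t‖ := fun t => by rw [hLf]; exact norm_cis_mul _ _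
  have nLd : ∀ t, ‖cis (b * t) * P t‖ ≤ 2 * Cη := fun t => by rw [norm_cis_mul]; exact nP t
  have hηd : ∀ t, HasDerivAt (fun t => η (D * t)) (D * sderiv η (D * t)) t := fun t => by
    have := (hasDerivAt_schwartz η (D * t)).scomp t ((hasDerivAt_id t).const_mul D)
    rw [mul_one] at this
    exact this
  have cη : Continuous fun t => η (D * t) :=
    η.continuous.comp (continuous_const.mul continuous_id)
  have cη' : Continuous fun t => (D : ℂ) * sderiv η (D * t) :=
    continuous_const.mul ((sderiv η).continuous.comp (continuous_const.mul continuous_id))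
  have iη : ∫ t, ‖η (D * t)‖ ≤ |D|⁻¹ * Cη := by rw [integral_norm_comp_mul]; gcongr
  have iη' : ∫ t, ‖sderiv η (D * t)‖ ≤ |D|⁻¹ * Cη := by rw [integral_norm_comp_mul]; gcongr
  -- The transform of $\varphi$ is evaluated at $\xi-\nu$ and that of $\psi=e^{ibt}\varphi$ at
  -- $\xi+a$, which agree since $b=a+\nu$. One derivative in the first frame gains $|\xi-\nu|^{-1}$.
  -- Passing to $\sigma=e^{ibt}\varphi'$ and differentiating again also gains $|\xi+a|^{-1}$.
  set φ : ℝ → ℂ := fun t => χ t * H t with hφ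
  set φ' : ℝ → ℂ := fun t => χ' t * H t + χ t * (cis (-b * t) * η (D * t)) with hφ'
  set ψ : ℝ → ℂ := fun t => χ t * Lf t with hψ
  set ψ' : ℝ → ℂ := fun t => χ' t * Lf t + χ t * (cis (b * t) * P t) with hψ'
  set σ : ℝ → ℂ := fun t => χ' t * Lf t + χ t * η (D * t) with hσ
  set σ' : ℝ → ℂ := fun t => (χ'' t * Lf t + χ' t * (cis (b * t) * P t)) +
    (χ' t * η (D * t) + χ t * (D * sderiv η (D * t))) with hσ'
  have dφ : ∀ t, HasDerivAt φ (φ' t) t := fun t => (hχd t).mul (hHd t)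
  have dψ : ∀ t, HasDerivAt ψ (ψ' t) t := fun t => (hχd t).mul (hLd t)
  have dσ : ∀ t, HasDerivAt σ (σ' t) t := fun t =>
    ((hχd' t).mul (hLd t)).add ((hχd t).mul (hηd t))
  have zφ : ∀ t, 2 * T < |t| → φ t = 0 := fun t ht => by simp only [hφ, hχz t ht, zero_mul]
  have zφ' : ∀ t, 2 * T < |t| → φ' t = 0 := fun t ht => by simp only [hφ', hχz t ht, hχz' t ht, zero_mul, add_zero]
  have zψ : ∀ t, 2 * T < |t| → ψ t = 0 := fun t ht => by simp only [hψ, hχz t ht, zero_mul]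
  have zψ' : ∀ t, 2 * T < |t| → ψ' t = 0 := fun t ht => by simp only [hψ', hχz t ht, hχz' t ht, zero_mul, add_zero]
  have zσ : ∀ t, 2 * T < |t| → σ t = 0 := fun t ht => by simp only [hσ, hχz t ht, hχz' t ht, zero_mul, add_zero]
  have zσ' : ∀ t, 2 * T < |t| → σ' t = 0 := fun t ht => by
    simp only [hσ', hχz t ht, hχz' t ht, hχz'' t ht, zero_mul, add_zero]
  have iφ := integrable_of_eq_zero (cχ.mul cH) zφ
  have iφ' := integrable_of_eq_zero ((cχ'.mul cH).add (cχ.mul (continuous_osc η b D))) zφ'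
  have iψ := integrable_of_eq_zero (cχ.mul cL) zψ
  have iψ' := integrable_of_eq_zero ((cχ'.mul cL).add (cχ.mul cLd)) zψ'
  have iσ := integrable_of_eq_zero ((cχ'.mul cL).add (cχ.mul cη)) zσ
  have iσ' := integrable_of_eq_zero
    (((cχ''.mul cL).add (cχ'.mul cLd)).add ((cχ'.mul cη).add (cχ.mul cη'))) zσ'
  have bφ : ∫ t, ‖φ t‖ ≤ 4 * T * (Cχ * (|D|⁻¹ * Cη)) := by
    have := integral_norm_le_of_bound (f := φ) (g := fun _ => 0) (c := Cχ * (|D|⁻¹ * Cη))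
      (c' := 0) hT (integrable_zero _ _ _) (fun _ => le_rfl) le_rfl (fun t _ => by
        rw [hφ]; simp only [norm_mul]
        have := mul_le_mul (nχ t) (nH t) (norm_nonneg _) hχ0
        linarith) zφ
    linarith
  have bφ' : ∫ t, ‖φ' t‖ ≤ 5 * (Cχ * (|D|⁻¹ * Cη)) := by
    have := integral_norm_le_of_bound (f := φ') (g := fun t => ‖η (D * t)‖)
      (c := T⁻¹ * Cχ * (|D|⁻¹ * Cη)) (c' := Cχ) hT (integrable_norm_comp_mul η hD0)
      (fun _ => norm_nonneg _) hχ0 (fun t _ => by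
        refine (norm_add_le _ _).trans ?_
        simp only [norm_mul, norm_cis, one_mul]
        have h1 := mul_le_mul (nχ' t) (nH t) (norm_nonneg _) (by positivity)
        have h2 := mul_le_mul_of_nonneg_right (nχ t) (norm_nonneg (η (D * t)))
        linarith) zφ'
    have h2 := mul_le_mul_of_nonneg_left iη hχ0
    have h3 : 4 * T * (T⁻¹ * Cχ * (|D|⁻¹ * Cη)) = 4 * (T⁻¹ * T) * (Cχ * (|D|⁻¹ * Cη)) := by ring
    rw [h3, hTi] at this
    linarith
  have bψ' : ∫ t, ‖ψ' t‖ ≤ 16 * (Cχ * Cη) * T := by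
    have := integral_norm_le_of_bound (f := ψ') (g := fun _ => 0)
      (c := 4 * (Cχ * Cη)) (c' := 0) hT (integrable_zero _ _ _)
      (fun _ => le_rfl) le_rfl (fun t ht => by
        refine (norm_add_le _ _).trans ?_
        rw [norm_mul, norm_mul, nL]
        have h1 := mul_le_mul (nχ' t) (nH' t ht) (norm_nonneg _) (by positivity)
        have h2 := mul_le_mul (nχ t) (nLd t) (norm_nonneg _) (by positivity)
        have h3 : T⁻¹ * Cχ * (Cη * (2 * T)) = 2 * (T⁻¹ * T) * (Cχ * Cη) := by ring
        rw [h3, hTi] at h1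
        linarith) zψ'
    linarith
  have bσ' : ∫ t, ‖σ' t‖ ≤ 21 * (Cχ * Cη) := by
    have := integral_norm_le_of_bound (f := σ') (g := fun t => ‖sderiv η (D * t)‖)
      (c := 5 * (T⁻¹ * (Cχ * Cη))) (c' := Cχ * |D|) hT (integrable_norm_comp_mul (sderiv η) hD0)
      (fun _ => norm_nonneg _) (by positivity) (fun t ht => by
        refine (norm_add_le _ _).trans ((add_le_add (norm_add_le _ _) (norm_add_le _ _)).trans ?_)
        rw [norm_mul, norm_mul (χ' t) (cis (b * t) * P t), norm_mul (χ' t) (η _), norm_mul (χ t),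
          norm_mul (D : ℂ), Complex.norm_real, Real.norm_eq_abs, nL]
        have h1 := mul_le_mul (nχ'' t) (nH' t ht) (norm_nonneg _) (by positivity)
        have h2 := mul_le_mul (nχ' t) (nLd t) (norm_nonneg _) (by positivity)
        have h3 := mul_le_mul (nχ' t) (hη (D * t)) (norm_nonneg _) (by positivity)
        have h4 := mul_le_mul_of_nonneg_right (nχ t)
          (mul_nonneg hDp.le (norm_nonneg (sderiv η (D * t))))
        have h5 : T⁻¹ * (T⁻¹ * Cχ) * (Cη * (2 * T)) = 2 * (T⁻¹ * T) * (T⁻¹ * (Cχ * Cη)) := by ring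
        rw [h5, hTi] at h1
        linarith) zσ'
    have h2 := mul_le_mul_of_nonneg_left iη' (mul_nonneg hχ0 hDp.le)
    have h3 : 4 * T * (5 * (T⁻¹ * (Cχ * Cη))) = 20 * (T⁻¹ * T) * (Cχ * Cη) := by ring
    have h4 : Cχ * |D| * (|D|⁻¹ * Cη) = (|D| * |D|⁻¹) * (Cχ * Cη) := by ring
    rw [h3, hTi] at this
    rw [h4, mul_inv_cancel₀ hDp.ne'] at h2
    linarith
  have hK1 : (2 * Real.pi : ℂ) * kernel η a D T ν ξ = ∫ t, φ t * cis (-(ξ - ν) * t) := by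
    rw [kernel, mul_inv_cancel_left₀ (by exact_mod_cast (by positivity : (2 * Real.pi : ℝ) ≠ 0))]
    refine integral_congr_ae (Filter.Eventually.of_forall fun t => ?_)
    simp only [locDuhamel, hφ, hχdef t, hH, hb]
    rw [show -(ξ - ν) * t = ν * t + -ξ * t by ring, cis_add]; ring
  have hK2 : (2 * Real.pi : ℂ) * kernel η a D T ν ξ = ∫ t, ψ t * cis (-(ξ + a) * t) := by
    rw [hK1]
    refine integral_congr_ae (Filter.Eventually.of_forall fun t => ?_)
    simp only [hφ, hψ, hLf, hb]
    rw [show -(ξ - ν) * t = (a + ν) * t + -(ξ + a) * t by ring, cis_add]; ring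
  have hK3 : ∫ t, φ' t * cis (-(ξ - ν) * t) = ∫ t, σ t * cis (-(ξ + a) * t) := by
    refine integral_congr_ae (Filter.Eventually.of_forall fun t => ?_)
    simp only [hφ', hσ, hLf]
    have h1 : cis (-b * t) * cis (b * t) = 1 := by rw [← cis_add, ← cis_zero]; congr 1; ring
    rw [show -(ξ - ν) * t = b * t + -(ξ + a) * t by rw [hb]; ring, cis_add]
    linear_combination χ t * η (D * t) * cis (-(ξ + a) * t) * h1
  have e1 := integral_deriv_mul_cis dφ iφ iφ' (ξ - ν)
  have e2 := integral_deriv_mul_cis dψ iψ iψ' (ξ + a)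
  have e3 := integral_deriv_mul_cis dσ iσ iσ' (ξ + a)
  rw [← hK1] at e1
  rw [← hK2] at e2
  rw [← hK3, e1] at e3
  have n0 := norm_integral_mul_cis_le φ (ξ - ν)
  have n1 := norm_integral_mul_cis_le φ' (ξ - ν)
  have n2 := norm_integral_mul_cis_le ψ' (ξ + a)
  have n3 := norm_integral_mul_cis_le σ' (ξ + a)
  rw [← hK1] at n0
  rw [e1] at n1
  rw [e2] at n2
  rw [e3] at n3
  have hpi : (1 : ℝ) ≤ 2 * Real.pi := by linarith [Real.pi_gt_three]
  have hpin : ‖(2 * Real.pi : ℂ)‖ = 2 * Real.pi := by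
    rw [← Complex.ofReal_ofNat, ← Complex.ofReal_mul, Complex.norm_real,
      Real.norm_of_nonneg (by linarith)]
  simp only [norm_mul, Complex.norm_I, one_mul] at n0 n1 n2 n3
  rw [← norm_mul, hpin] at n0 n1 n2 n3
  simp only [Complex.norm_real, Real.norm_eq_abs] at n0 n1 n2 n3
  set u := ‖kernel η a D T ν ξ‖ with hu
  have hu0 : 0 ≤ u := norm_nonneg _
  have hCC : 0 ≤ Cχ * Cη := by positivity
  have hle : ∀ x y : ℝ, 0 ≤ x → 2 * Real.pi * x ≤ y → x ≤ y := fun x y hx hxy => by nlinarith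
  refine ⟨?_, ?_, ?_, ?_⟩
  · have h1 := hle u _ hu0 (n0.trans bφ)
    have h2 := mul_le_mul_of_nonneg_left h1 hDp.le
    have h3 : |D| * (4 * T * (Cχ * (|D|⁻¹ * Cη))) = (|D| * |D|⁻¹) * (4 * T * (Cχ * Cη)) := by ring
    rw [h3, mul_inv_cancel₀ hDp.ne'] at h2
    nlinarith
  · have h1 := hle (|ξ - ν| * u) _ (by positivity)
      ((le_of_eq (by ring)).trans (n1.trans bφ'))
    have h2 := mul_le_mul_of_nonneg_left h1 hDp.le
    have h3 : |D| * (5 * (Cχ * (|D|⁻¹ * Cη))) = (|D| * |D|⁻¹) * (5 * (Cχ * Cη)) := by ring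
    rw [h3, mul_inv_cancel₀ hDp.ne'] at h2
    nlinarith
  · have h1 := hle (|ξ + a| * u) _ (by positivity)
      ((le_of_eq (by ring)).trans (n2.trans bψ'))
    nlinarith
  · have h1 := hle (|ξ - ν| * (|ξ + a| * u)) _ (by positivity)
      ((le_of_eq (by ring)).trans (n3.trans bσ'))
    linarith

end

/-! ### Decay of the kernel -/

/-- Interpolation $y=y^\theta y^{1-\theta}$, with the bound that is small in $T$ for the first
factor and the one that decays in $j$ for the second. -/
theorem le_mul_rpow_of_le {y c T j θ : ℝ} (hy : 0 ≤ y) (hT : 0 < T) (hj : 0 < j)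
    (hθ0 : 0 ≤ θ) (hθ1 : θ ≤ 1) (h1 : y ≤ c * T) (h2 : y * j ≤ c) :
    y ≤ c * T ^ θ * j ^ (-1 + θ) := by
  have hc : 0 ≤ c := (mul_nonneg hy hj.le).trans h2
  have h3 : y ≤ c * j⁻¹ := by rwa [← div_eq_mul_inv, le_div_iff₀ hj]
  have h4 : y = y ^ θ * y ^ (1 - θ) := by
    rw [← Real.rpow_add_of_nonneg hy hθ0 (by linarith)]; simp
  calc y = y ^ θ * y ^ (1 - θ) := h4
    _ ≤ (c * T) ^ θ * (c * j⁻¹) ^ (1 - θ) :=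
        mul_le_mul (Real.rpow_le_rpow hy h1 hθ0) (Real.rpow_le_rpow hy h3 (by linarith))
          (by positivity) (by positivity)
    _ = (c ^ θ * c ^ (1 - θ)) * T ^ θ * j ^ (-1 + θ) := by
        rw [Real.mul_rpow hc hT.le, Real.mul_rpow hc (by positivity), Real.inv_rpow hj.le,
          ← Real.rpow_neg hj.le, neg_sub, show θ - 1 = -1 + θ by ring]
        ring
    _ = _ := by rw [← Real.rpow_add_of_nonneg hc hθ0 (by linarith)]; simp

/-- The decay of the kernel, with a gain of a power of `T`. -/
theorem exists_kernel_le (η : SchwartzMap ℝ ℂ) : ∃ C : ℝ, 0 ≤ C ∧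
    ∀ (θ a D T ν ξ : ℝ), 0 ≤ θ → θ ≤ 1 → 0 < T → T ≤ 1 → 1 ≤ |D| →
    ‖kernel η a D T ν ξ‖ ≤
      C * T ^ θ * (|D| ^ (-(1 / 2) : ℝ) * jb (ξ + a) ^ (-(1 / 2) : ℝ) * jb (ξ - ν) ^ (-1 + θ)) := by
  obtain ⟨C, hC0, hC⟩ := exists_kernel_bounds η
  refine ⟨4 * C, by positivity, fun θ a D T ν ξ hθ0 hθ1 hT hT1 hD => ?_⟩
  obtain ⟨h1, h2, h3, h4⟩ := hC a D T ν ξ hT hD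
  set u := ‖kernel η a D T ν ξ‖
  have hu : 0 ≤ u := norm_nonneg _
  have hj := jb_pos (ξ - ν)
  have hm := jb_pos (ξ + a)
  have hj' := jb_le_one_add_abs (ξ - ν)
  have hm' := jb_le_one_add_abs (ξ + a)
  have hDp : 0 < |D| := by linarith
  have hCT : C * T ≤ C := by nlinarith
  have huD : u ≤ |D| * u := by nlinarith
  have k1 : (|D| * u) * jb (ξ - ν) ≤ 2 * C := by
    have := mul_le_mul_of_nonneg_left hj' (mul_nonneg hDp.le hu)
    linarith
  have k2 : jb (ξ + a) * u ≤ 2 * (C * T) := by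
    have := mul_le_mul_of_nonneg_right hm' hu
    linarith
  have k3 : (jb (ξ + a) * u) * jb (ξ - ν) ≤ 4 * C := by
    have e1 := mul_le_mul_of_nonneg_left hj' (mul_nonneg hm.le hu)
    have e2 : |ξ - ν| * (jb (ξ + a) * u) ≤ |ξ - ν| * ((1 + |ξ + a|) * u) := by gcongr
    have e3 : |ξ - ν| * u ≤ |ξ - ν| * (|D| * u) := by gcongr
    linarith
  -- The geometric mean: $y^2$ is the product of $|D|u$ and $\langle\xi+a\rangle u$. Each of these
  -- is $O(T)$ and $O(\langle\xi-\nu\rangle^{-1})$, so the same holds for $y$.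
  set y := u * (|D| ^ (1 / 2 : ℝ) * jb (ξ + a) ^ (1 / 2 : ℝ)) with hy
  have hy0 : 0 ≤ y := by positivity
  have s1 : |D| ^ (1 / 2 : ℝ) * |D| ^ (1 / 2 : ℝ) = |D| := by
    rw [← Real.rpow_add hDp]; norm_num
  have s2 : jb (ξ + a) ^ (1 / 2 : ℝ) * jb (ξ + a) ^ (1 / 2 : ℝ) = jb (ξ + a) := by
    rw [← Real.rpow_add hm]; norm_num
  have hyy : y * y = (|D| * u) * (jb (ξ + a) * u) := by
    calc y * y = (|D| ^ (1 / 2 : ℝ) * |D| ^ (1 / 2 : ℝ)) *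
          (jb (ξ + a) ^ (1 / 2 : ℝ) * jb (ξ + a) ^ (1 / 2 : ℝ)) * (u * u) := by rw [hy]; ring
      _ = _ := by rw [s1, s2]; ring
  have y1 : y ≤ 4 * C * T := by
    refine abs_le_of_sq_le_sq' ?_ (by positivity) |>.2
    rw [sq, hyy]
    have := mul_le_mul h1 k2 (by positivity) (by positivity)
    nlinarith [mul_nonneg hC0 hT.le]
  have y2 : y * jb (ξ - ν) ≤ 4 * C := by
    refine abs_le_of_sq_le_sq' ?_ (by positivity) |>.2
    have e : (y * jb (ξ - ν)) ^ 2 =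
        (|D| * u * jb (ξ - ν)) * (jb (ξ + a) * u * jb (ξ - ν)) := by
      calc (y * jb (ξ - ν)) ^ 2 = (y * y) * (jb (ξ - ν) * jb (ξ - ν)) := by ring
        _ = _ := by rw [hyy]; ring
    rw [e]
    have := mul_le_mul k1 k3 (by positivity) (by positivity)
    nlinarith
  have y3 := le_mul_rpow_of_le hy0 hT hj hθ0 hθ1 y1 y2
  have e : u = y * (|D| ^ (-(1 / 2) : ℝ) * jb (ξ + a) ^ (-(1 / 2) : ℝ)) := by
    have e1 : |D| ^ (1 / 2 : ℝ) * |D| ^ (-(1 / 2) : ℝ) = 1 := by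
      rw [← Real.rpow_add hDp]; norm_num
    have e2 : jb (ξ + a) ^ (1 / 2 : ℝ) * jb (ξ + a) ^ (-(1 / 2) : ℝ) = 1 := by
      rw [← Real.rpow_add hm]; norm_num
    calc u = u * (|D| ^ (1 / 2 : ℝ) * |D| ^ (-(1 / 2) : ℝ)) *
          (jb (ξ + a) ^ (1 / 2 : ℝ) * jb (ξ + a) ^ (-(1 / 2) : ℝ)) := by rw [e1, e2]; ring
      _ = _ := by rw [hy]; ring
  rw [e]
  refine (mul_le_mul_of_nonneg_right y3 (by positivity)).trans (le_of_eq ?_)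
  ring

theorem measurable_kernel (η : SchwartzMap ℝ ℂ) (a D T ν : ℝ) :
    AEStronglyMeasurable (kernel η a D T ν) :=
  ((stronglyMeasurable_kernel η a D T).comp_measurable
    (measurable_prodMk_left (x := ν))).aestronglyMeasurable

/-- At $\theta=0$ the decay is $\langle\xi+a\rangle^{-1/2}\langle\xi-\nu\rangle^{-1}$, and giving
both powers to the smaller bracket makes it integrable. Uniformity in $\nu$ is what Fubini needs for
superpositions. -/
theorem exists_integral_norm_kernel_le (η : SchwartzMap ℝ ℂ) : ∃ C : ℝ, 0 ≤ C ∧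
    ∀ (a D T ν : ℝ), 0 < T → T ≤ 1 → 1 ≤ |D| →
    Integrable (kernel η a D T ν) ∧ ∫ ξ, ‖kernel η a D T ν ξ‖ ≤ C := by
  obtain ⟨C, hC0, hC⟩ := exists_kernel_le η
  have hint : Integrable fun x : ℝ => jb x ^ (-(3 / 2) : ℝ) := integrable_jb_rpow (by norm_num)
  have hI0 : 0 ≤ ∫ x : ℝ, jb x ^ (-(3 / 2) : ℝ) :=
    integral_nonneg fun x => Real.rpow_nonneg (jb_pos x).le _
  refine ⟨C * ((∫ x : ℝ, jb x ^ (-(3 / 2) : ℝ)) + ∫ x : ℝ, jb x ^ (-(3 / 2) : ℝ)),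
    by positivity, fun a D T ν hT hT1 hD => ?_⟩
  have hpt : ∀ ξ, ‖kernel η a D T ν ξ‖ ≤
      C * (jb (ξ + a) ^ (-(3 / 2) : ℝ) + jb (ξ - ν) ^ (-(3 / 2) : ℝ)) := by
    intro ξ
    have hj := jb_pos (ξ - ν)
    have hm := jb_pos (ξ + a)
    have h1 := hC 0 a D T ν ξ le_rfl zero_le_one hT hT1 hD
    rw [Real.rpow_zero, mul_one, add_zero] at h1
    refine h1.trans ?_
    gcongr
    have hD1 : |D| ^ (-(1 / 2) : ℝ) ≤ 1 :=
      Real.rpow_le_one_of_one_le_of_nonpos hD (by norm_num)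
    calc |D| ^ (-(1 / 2) : ℝ) * jb (ξ + a) ^ (-(1 / 2) : ℝ) * jb (ξ - ν) ^ (-1 : ℝ)
        ≤ 1 * jb (ξ + a) ^ (-(1 / 2) : ℝ) * jb (ξ - ν) ^ (-1 : ℝ) := by gcongr
      _ = jb (ξ + a) ^ (-(1 / 2) : ℝ) * jb (ξ - ν) ^ (-1 : ℝ) := by rw [one_mul]
      _ ≤ _ := by
        rcases le_total (jb (ξ + a)) (jb (ξ - ν)) with h | h
        · have : jb (ξ - ν) ^ (-1 : ℝ) ≤ jb (ξ + a) ^ (-1 : ℝ) :=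
            Real.rpow_le_rpow_of_nonpos hm h (by norm_num)
          calc _ ≤ jb (ξ + a) ^ (-(1 / 2) : ℝ) * jb (ξ + a) ^ (-1 : ℝ) := by gcongr
            _ = jb (ξ + a) ^ (-(3 / 2) : ℝ) := by rw [← Real.rpow_add hm]; norm_num
            _ ≤ _ := le_add_of_nonneg_right (by positivity)
        · have : jb (ξ + a) ^ (-(1 / 2) : ℝ) ≤ jb (ξ - ν) ^ (-(1 / 2) : ℝ) :=
            Real.rpow_le_rpow_of_nonpos hj h (by norm_num)
          calc _ ≤ jb (ξ - ν) ^ (-(1 / 2) : ℝ) * jb (ξ - ν) ^ (-1 : ℝ) := by gcongr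
            _ = jb (ξ - ν) ^ (-(3 / 2) : ℝ) := by rw [← Real.rpow_add hj]; norm_num
            _ ≤ _ := le_add_of_nonneg_left (by positivity)
  have hb := ((hint.comp_add_right a).add (hint.comp_sub_right ν)).const_mul C
  refine ⟨hb.mono' (measurable_kernel η a D T ν) (Filter.Eventually.of_forall hpt), ?_⟩
  refine (integral_mono_of_nonneg (Filter.Eventually.of_forall fun _ => norm_nonneg _) hb
    (Filter.Eventually.of_forall hpt)).trans (le_of_eq ?_)
  rw [integral_const_mul]
  congr 1
  have := integral_add (hint.comp_add_right a) (hint.comp_sub_right ν)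
  rw [integral_add_right_eq_self (fun x => jb x ^ (-(3 / 2) : ℝ)),
    integral_sub_right_eq_self (fun x => jb x ^ (-(3 / 2) : ℝ))] at this
  exact this

/-! ### Duhamel integrals of superpositions of characters -/

/-- The Duhamel integral of a superposition of characters is a superposition of characters. -/
theorem duhamel_fourier (η : SchwartzMap ℝ ℂ) {Ω : Type*} [MeasurableSpace Ω] (m : Measure Ω)
    [SFinite m] {G : Ω → ℂ} (hG : Integrable G m) {ν : Ω → ℝ} (hν : Measurable ν) {a D T : ℝ}
    (hT : 0 < T) (hT1 : T ≤ 1) (hD : 1 ≤ |D|) :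
    Integrable (fun ξ => ∫ ω, G ω * kernel η a D T (ν ω) ξ ∂m) ∧
    ∀ t : ℝ, |t| ≤ T → ∫ ξ, cis (ξ * t) * ∫ ω, G ω * kernel η a D T (ν ω) ξ ∂m =
      ∫ s in (0 : ℝ)..t, cis (-((t - s) * a)) * η (D * (t - s)) * ∫ ω, G ω * cis (ν ω * s) ∂m := by
  obtain ⟨C, hC0, hC⟩ := exists_integral_norm_kernel_le η
  have hmeas : AEStronglyMeasurable (fun z : Ω × ℝ => G z.1 * kernel η a D T (ν z.1) z.2)
      (m.prod volume) := by
    refine hG.1.comp_fst.mul ?_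
    exact ((stronglyMeasurable_kernel η a D T).comp_measurable
      ((hν.comp measurable_fst).prodMk measurable_snd)).aestronglyMeasurable
  have hint : Integrable (fun z : Ω × ℝ => G z.1 * kernel η a D T (ν z.1) z.2)
      (m.prod volume) := by
    rw [integrable_prod_iff hmeas]
    refine ⟨Filter.Eventually.of_forall fun ω => ?_, ?_⟩
    · exact (hC a D T (ν ω) hT hT1 hD).1.const_mul (G ω)
    refine (hG.norm.mul_const C).mono' hmeas.norm.integral_prod_right'
      (Filter.Eventually.of_forall fun ω => ?_)
    rw [Real.norm_of_nonneg (integral_nonneg fun _ => norm_nonneg _)]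
    simp_rw [norm_mul]
    rw [integral_const_mul]
    gcongr
    exact (hC a D T (ν ω) hT hT1 hD).2
  refine ⟨hint.integral_prod_right, fun t ht => ?_⟩
  have hint2 : Integrable (fun z : ℝ × Ω => cis (z.1 * t) * (G z.2 * kernel η a D T (ν z.2) z.1))
      (volume.prod m) := by
    refine hint.swap.bdd_mul (c := 1) ?_ (Filter.Eventually.of_forall fun z => (norm_cis _).le)
    exact ((continuous_cis.comp (continuous_id.mul continuous_const)).stronglyMeasurable.comp_measurable
      measurable_fst).aestronglyMeasurable
  have h1 : ∫ ξ, cis (ξ * t) * ∫ ω, G ω * kernel η a D T (ν ω) ξ ∂m =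
      ∫ ω, (∫ ξ, cis (ξ * t) * (G ω * kernel η a D T (ν ω) ξ)) ∂m := by
    simp_rw [← integral_const_mul]
    exact integral_integral_swap
      (f := fun ξ ω => cis (ξ * t) * (G ω * kernel η a D T (ν ω) ξ)) hint2
  have h2 : ∀ ω, ∫ ξ, cis (ξ * t) * (G ω * kernel η a D T (ν ω) ξ) =
      G ω * ∫ s in (0 : ℝ)..t, cis (-((t - s) * a)) * η (D * (t - s)) * cis (ν ω * s) := by
    intro ω
    have h3 : ∀ ξ, cis (ξ * t) * (G ω * kernel η a D T (ν ω) ξ) =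
        G ω * (cis (ξ * t) * kernel η a D T (ν ω) ξ) := fun ξ => by ring
    simp_rw [h3]
    rw [integral_const_mul]
    congr 1
    have h4 := fourier_inversion (continuous_locDuhamel η a D T (ν ω))
      (integrable_locDuhamel η hT a D (ν ω)) (hC a D T (ν ω) hT hT1 hD).1 t
    -- On $|t|\le T$ the localization is invisible, so inversion returns the Duhamel integral
    -- itself.
    have h5 : cutoff (T⁻¹ * t) = 1 := cutoff_eq_one (by
      rw [abs_mul, abs_inv, abs_of_pos hT, inv_mul_eq_div, div_le_one hT]; exact ht)
    rw [locDuhamel, h5, Complex.ofReal_one, one_mul] at h4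
    rw [duhamel_eq, ← h4]
    rfl
  rw [h1]
  simp_rw [h2]
  obtain ⟨Cη, hη0, hη, -⟩ := exists_schwartz_bound η
  have hswap : Integrable (fun z : Ω × ℝ =>
      G z.1 * (cis (-((t - z.2) * a)) * η (D * (t - z.2)) * cis (ν z.1 * z.2)))
      (m.prod (volume.restrict (Set.uIoc 0 t))) := by
    have hc : Continuous fun s : ℝ => cis (-((t - s) * a)) * η (D * (t - s)) :=
      (continuous_cis.comp (by fun_prop)).mul (η.continuous.comp (by fun_prop))
    have hcm : Measurable fun z : Ω × ℝ => cis (ν z.1 * z.2) :=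
      continuous_cis.measurable.comp ((hν.comp measurable_fst).mul measurable_snd)
    have hfin : IsFiniteMeasure (volume.restrict (Set.uIoc 0 t)) :=
      ⟨by rw [Measure.restrict_apply_univ, Set.uIoc]; exact measure_Ioc_lt_top⟩
    refine (hG.comp_fst (volume.restrict (Set.uIoc 0 t))).mul_bdd (c := Cη) ?_
      (Filter.Eventually.of_forall fun z => ?_)
    · exact ((hc.measurable.comp measurable_snd).mul hcm).aestronglyMeasurable
    · rw [norm_mul, norm_mul, norm_cis, norm_cis, one_mul, mul_one]
      exact hη _
  simp_rw [intervalIntegral.intervalIntegral_eq_integral_uIoc]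
  have h6 : ∀ ω, G ω * ((if 0 ≤ t then (1 : ℝ) else -1) • ∫ s in Set.uIoc 0 t,
      cis (-((t - s) * a)) * η (D * (t - s)) * cis (ν ω * s)) =
      (if 0 ≤ t then (1 : ℝ) else -1) • ∫ s in Set.uIoc 0 t,
        G ω * (cis (-((t - s) * a)) * η (D * (t - s)) * cis (ν ω * s)) := by
    intro ω
    rw [mul_smul_comm, integral_const_mul]
  simp_rw [h6]
  rw [integral_smul, integral_integral_swap (f := fun ω s =>
    G ω * (cis (-((t - s) * a)) * η (D * (t - s)) * cis (ν ω * s))) hswap]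
  congr 1
  refine integral_congr_ae (Filter.Eventually.of_forall fun s => ?_)
  simp only
  rw [← integral_const_mul]
  refine integral_congr_ae (Filter.Eventually.of_forall fun ω => ?_)
  simp only
  ring

/-! ### The modified Duhamel operator in weighted Fourier variables -/

/-- The weighted modulus `⟨k⟩^{1/2} ⟨ξ + k²⟩^{1/2} |U(k, ξ)|`. -/
def ydens (U : ℤ → ℝ → ℂ) (k : ℤ) (ξ : ℝ) : ℝ≥0∞ :=
  jbe k (1 / 2) * jbe (ξ + (k : ℝ) ^ 2) (1 / 2) * ‖U k ξ‖ₑ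

/-- The `p`-th power of the norm of `X^{1/2,1/2}_{p,r}`, in terms of the Fourier transform. -/
def yPow (p δ : ℝ) (U : ℤ → ℝ → ℂ) : ℝ≥0∞ :=
  ∑' k, (∫⁻ ξ, ydens U k ξ ^ rY δ) ^ (p / rY δ)

/-- The `k`-th spatial coefficient at time `t` of the function with Fourier transform `U`. -/
def timeCoef (U : ℤ → ℝ → ℂ) (k : ℤ) (t : ℝ) : ℂ := ∫ ξ, cis (ξ * t) * U k ξ

theorem aemeasurable_ydens {U : ℤ → ℝ → ℂ} {k : ℤ} (hU : AEStronglyMeasurable (U k)) :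
    AEMeasurable (ydens U k) :=
  (((measurable_jbe _).comp (measurable_id.add_const _)).const_mul _).aemeasurable.mul hU.enorm

theorem measurable_ydens {U : ℤ → ℝ → ℂ} {k : ℤ} (hU : Measurable (U k)) :
    Measurable (ydens U k) :=
  (((measurable_jbe _).comp (measurable_id.add_const _)).const_mul _).mul hU.enorm

theorem enorm_eq_mul_ydens (U : ℤ → ℝ → ℂ) (k : ℤ) (ξ : ℝ) :
    ‖U k ξ‖ₑ = jbe k (-(1 / 2)) * (jbe (ξ + (k : ℝ) ^ 2) (-(1 / 2)) * ydens U k ξ) := by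
  have h1 := jbe_mul_neg k (1 / 2)
  have h2 := jbe_mul_neg (ξ + (k : ℝ) ^ 2) (1 / 2)
  calc ‖U k ξ‖ₑ = (jbe k (1 / 2) * jbe k (-(1 / 2))) *
      (jbe (ξ + (k : ℝ) ^ 2) (1 / 2) * jbe (ξ + (k : ℝ) ^ 2) (-(1 / 2))) * ‖U k ξ‖ₑ := by
        rw [h1, h2, one_mul, one_mul]
    _ = _ := by rw [ydens]; ring

/-- $\langle\cdot\rangle^{-1/2}$ lies in $L^{r_0'}$ because $r_0'>2$. This is why transforms of
elements of $Y_0$ are integrable and their coefficients continuous in time. -/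
theorem Exponents.exists_lintegral_le {p δ : ℝ} (h : Exponents p δ) : ∃ C : ℝ≥0∞, C ≠ ∞ ∧
    ∀ (k : ℤ) (g : ℝ → ℝ≥0∞), AEMeasurable g →
      ∫⁻ ξ, jbe (ξ + (k : ℝ) ^ 2) (-(1 / 2)) * g ξ ≤ C * (∫⁻ ξ, g ξ ^ rY δ) ^ (1 / rY δ) := by
  refine ⟨(∫⁻ ξ, jbe ξ (-(1 / 2) * rY' δ)) ^ (1 / rY' δ), ?_, fun k g hg => ?_⟩
  · refine (ENNReal.rpow_lt_top_of_nonneg (by have := h.rY'_pos; positivity) ?_).ne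
    have := lintegral_jbe_lt_top (a := 1 / 2 * rY' δ) (by linarith [h.two_lt_rY'])
    rw [← neg_mul] at this
    exact this.ne
  · have hm : Measurable fun ξ => jbe (ξ + (k : ℝ) ^ 2) (-(1 / 2)) :=
      (measurable_jbe _).comp (measurable_id.add_const _)
    refine (ENNReal.lintegral_mul_le_Lp_mul_Lq volume h.conj.symm hm.aemeasurable hg).trans
      (le_of_eq ?_)
    congr 2
    simp_rw [jbe_rpow]
    exact lintegral_add_right_eq_self (fun ξ => jbe ξ (-(1 / 2) * rY' δ)) _

theorem Exponents.lintegral_lt_top {p δ : ℝ} (h : Exponents p δ) {g : ℤ → ℝ → ℝ≥0∞}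
    (hg : ∑' k, (∫⁻ ξ, g k ξ ^ rY δ) ^ (p / rY δ) ≠ ∞) (k : ℤ) : ∫⁻ ξ, g k ξ ^ rY δ < ∞ := by
  have h1 := ENNReal.ne_top_of_tsum_ne_top hg k
  rw [lt_top_iff_ne_top]
  intro h2
  rw [h2, ENNReal.top_rpow_of_pos (by linarith [h.one_lt_div])] at h1
  exact h1 rfl

theorem Exponents.exists_lintegral_enorm_le {p δ : ℝ} (h : Exponents p δ) : ∃ C : ℝ≥0∞, C ≠ ∞ ∧
    ∀ (U : ℤ → ℝ → ℂ) (k : ℤ), AEStronglyMeasurable (U k) →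
      ∫⁻ ξ, ‖U k ξ‖ₑ ≤ C * (jbe k (-(1 / 2)) * (∫⁻ ξ, ydens U k ξ ^ rY δ) ^ (1 / rY δ)) := by
  obtain ⟨C, hC, hle⟩ := h.exists_lintegral_le
  refine ⟨C, hC, fun U k hU => ?_⟩
  simp_rw [enorm_eq_mul_ydens U k]
  rw [lintegral_const_mul' _ _ (jbe_ne_top _ _)]
  refine (mul_le_mul_right (hle k _ (aemeasurable_ydens hU)) _).trans (le_of_eq ?_)
  ring

theorem Exponents.integrable_of_yPow {p δ : ℝ} (h : Exponents p δ) {U : ℤ → ℝ → ℂ} {k : ℤ}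
    (hm : AEStronglyMeasurable (U k)) (hU : yPow p δ U ≠ ∞) : Integrable (U k) := by
  obtain ⟨C, hC, hle⟩ := h.exists_lintegral_enorm_le
  refine ⟨hm, (hle U k hm).trans_lt ?_⟩
  refine ENNReal.mul_lt_top hC.lt_top (ENNReal.mul_lt_top (jbe_ne_top _ _).lt_top ?_)
  exact ENNReal.rpow_lt_top_of_nonneg (by have := h.rY_pos; positivity) (h.lintegral_lt_top hU k).ne

theorem continuous_timeCoef {U : ℤ → ℝ → ℂ} {k : ℤ} (hU : Integrable (U k)) :
    Continuous (timeCoef U k) := by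
  refine continuous_of_dominated (bound := fun ξ => ‖U k ξ‖) (fun t => ?_) (fun t => ?_) hU.norm ?_
  · exact ((continuous_cis.comp (continuous_id.mul continuous_const)).aestronglyMeasurable).mul hU.1
  · exact Filter.Eventually.of_forall fun ξ => (norm_cis_mul _ _).le
  · exact Filter.Eventually.of_forall fun ξ =>
      (continuous_cis.comp (continuous_const.mul continuous_id)).mul continuous_const

/-- The kernel's $\langle\xi+k^2\rangle^{-1/2}$ cancels the output weight, and its $|\Delta|^{-1/2}$
cancels the loss in `Nonresonant.weight_le`. The remaining $\langle k_1\rangle^{1/2}$ belongs to the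
norm of the first input. -/
theorem exists_weighted_kernel_le (η : SchwartzMap ℝ ℂ) : ∃ C : ℝ, 0 ≤ C ∧
    ∀ (k : ℤ) (κ : ℤ × ℤ × ℤ), Nonresonant k κ → ∀ (c : ℂ) (B θ T ξ ν : ℝ), ‖c‖ ≤ B → 0 ≤ θ →
      θ ≤ 1 → 0 < T → T ≤ 1 →
      jbe k (1 / 2) * jbe (ξ + (k : ℝ) ^ 2) (1 / 2) *
        (‖(κ.1 : ℂ) * c‖ₑ * ‖kernel η ((k : ℝ) ^ 2) (Delta k κ : ℤ) T ν ξ‖ₑ) ≤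
      ENNReal.ofReal (C * B * T ^ θ) * (jbe κ.1 (1 / 2) * jbe (ξ - ν) (-1 + θ)) := by
  obtain ⟨C, hC0, hC⟩ := exists_kernel_le η
  refine ⟨4 * C, by positivity, fun k κ hκ c B θ T ξ ν hc hθ0 hθ1 hT hT1 => ?_⟩
  have hB : 0 ≤ B := (norm_nonneg c).trans hc
  have hK := hC θ ((k : ℝ) ^ 2) (Delta k κ : ℤ) T ν ξ hθ0 hθ1 hT hT1 hκ.one_le_abs_Delta
  have hW := hκ.weight_le
  set D : ℝ := |(Delta k κ : ℝ)|
  have hD : 0 < D := one_pos.trans_le hκ.one_le_abs_Delta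
  set j := jb (ξ + (k : ℝ) ^ 2) with hj
  have hj0 : 0 < j := jb_pos _
  have hk1 : 0 < jb κ.1 := jb_pos _
  have hk0 : 0 < jb k := jb_pos _
  rw [← ofReal_norm, ← ofReal_norm, norm_mul, Complex.norm_intCast]
  simp only [jbe]
  rw [← ENNReal.ofReal_mul (by positivity), ← ENNReal.ofReal_mul (by positivity),
    ← ENNReal.ofReal_mul (by positivity), ← ENNReal.ofReal_mul (by positivity),
    ← ENNReal.ofReal_mul (by positivity)]
  apply ENNReal.ofReal_le_ofReal
  have e1 : j ^ (1 / 2 : ℝ) * j ^ (-(1 / 2) : ℝ) = 1 := by rw [← Real.rpow_add hj0]; simp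
  have e2 : D ^ (1 / 2 : ℝ) * D ^ (-(1 / 2) : ℝ) = 1 := by rw [← Real.rpow_add hD]; simp
  have e3 : jb κ.1 ^ (-(1 / 2) : ℝ) * jb κ.1 ^ (1 / 2 : ℝ) = 1 := by
    rw [← Real.rpow_add hk1]; simp
  have hJ : 0 ≤ jb (ξ - ν) ^ (-1 + θ) := Real.rpow_nonneg (jb_pos _).le _
  calc jb k ^ (1 / 2 : ℝ) * j ^ (1 / 2 : ℝ) * (|(κ.1 : ℝ)| * ‖c‖ *
        ‖kernel η ((k : ℝ) ^ 2) (Delta k κ : ℤ) T ν ξ‖)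
      ≤ jb k ^ (1 / 2 : ℝ) * j ^ (1 / 2 : ℝ) * (|(κ.1 : ℝ)| * B *
        (C * T ^ θ * (D ^ (-(1 / 2) : ℝ) * j ^ (-(1 / 2) : ℝ) * jb (ξ - ν) ^ (-1 + θ)))) := by
        gcongr
    _ = (jb k ^ (1 / 2 : ℝ) * |(κ.1 : ℝ)| * jb κ.1 ^ (-(1 / 2) : ℝ)) * jb κ.1 ^ (1 / 2 : ℝ) *
        (B * (C * T ^ θ * (D ^ (-(1 / 2) : ℝ) * jb (ξ - ν) ^ (-1 + θ)))) := by
        linear_combination (jb k ^ (1 / 2 : ℝ) * (|(κ.1 : ℝ)| * B *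
          (C * T ^ θ * (D ^ (-(1 / 2) : ℝ) * jb (ξ - ν) ^ (-1 + θ))))) * (e1 - e3)
    _ ≤ (4 * D ^ (1 / 2 : ℝ)) * jb κ.1 ^ (1 / 2 : ℝ) *
        (B * (C * T ^ θ * (D ^ (-(1 / 2) : ℝ) * jb (ξ - ν) ^ (-1 + θ)))) := by gcongr
    _ = _ := by
        linear_combination (4 * jb κ.1 ^ (1 / 2 : ℝ) *
          (B * (C * T ^ θ * jb (ξ - ν) ^ (-1 + θ)))) * e2

/-- The product of the three Fourier transforms that enter the interaction `κ`. -/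
def tripleProd (U : Fin 3 → ℤ → ℝ → ℂ) (κ : ℤ × ℤ × ℤ) (ω : ℝ × ℝ × ℝ) : ℂ :=
  starRingEnd ℂ (U 0 κ.1 ω.1) * (U 1 κ.2.1 ω.2.1 * U 2 κ.2.2 ω.2.2)

/-- The time frequency of an interaction. -/
def tripleFreq (ω : ℝ × ℝ × ℝ) : ℝ := -ω.1 + ω.2.1 + ω.2.2

/-- The Fourier transform of the contribution of the interaction `κ` to the localized modified
Duhamel operator. -/
def duhamelTerm (η : SchwartzMap ℝ ℂ) (T : ℝ) (U : Fin 3 → ℤ → ℝ → ℂ) (k : ℤ) (κ : ℤ × ℤ × ℤ)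
    (ξ : ℝ) : ℂ :=
  ∫ ω, tripleProd U κ ω * kernel η ((k : ℝ) ^ 2) (Delta k κ : ℤ) T (tripleFreq ω) ξ

/-- The Fourier transform of the localized modified Duhamel operator. -/
def duhamelSum (X : ℤ → Set (ℤ × ℤ × ℤ)) (M : ℤ → ℤ → ℤ → ℤ → ℂ) (η : SchwartzMap ℝ ℂ) (T : ℝ)
    (U : Fin 3 → ℤ → ℝ → ℂ) (k : ℤ) (ξ : ℝ) : ℂ :=
  ∑' κ : X k, (κ.1.1 : ℂ) * M k κ.1.1 κ.1.2.1 κ.1.2.2 * duhamelTerm η T U k κ ξ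

theorem measurable_tripleFreq : Measurable tripleFreq := by unfold tripleFreq; fun_prop

theorem outMod_eq (ξ : ℝ) (ω : ℝ × ℝ × ℝ) : outMod ξ ω = ξ - tripleFreq ω := by
  rw [outMod, tripleFreq]; ring

theorem integrable_tripleProd {U : Fin 3 → ℤ → ℝ → ℂ} (hU : ∀ j k, Integrable (U j k))
    (κ : ℤ × ℤ × ℤ) : Integrable (tripleProd U κ) := by
  have h0 : Integrable fun x => starRingEnd ℂ (U 0 κ.1 x) :=
    (hU 0 κ.1).congr'
      (Complex.continuous_conj.comp_aestronglyMeasurable (hU 0 κ.1).1)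
      (Filter.Eventually.of_forall fun x => (RCLike.norm_conj _).symm)
  exact h0.mul_prod ((hU 1 κ.2.1).mul_prod (hU 2 κ.2.2))

theorem integral_tripleProd_mul_cis (U : Fin 3 → ℤ → ℝ → ℂ) (κ : ℤ × ℤ × ℤ) (s : ℝ) :
    ∫ ω, tripleProd U κ ω * cis (tripleFreq ω * s) =
      starRingEnd ℂ (timeCoef (U 0) κ.1 s) * timeCoef (U 1) κ.2.1 s * timeCoef (U 2) κ.2.2 s := by
  have h1 : ∀ ω : ℝ × ℝ × ℝ, tripleProd U κ ω * cis (tripleFreq ω * s) =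
      starRingEnd ℂ (cis (ω.1 * s) * U 0 κ.1 ω.1) *
        ((cis (ω.2.1 * s) * U 1 κ.2.1 ω.2.1) * (cis (ω.2.2 * s) * U 2 κ.2.2 ω.2.2)) := by
    intro ω
    have h2 : tripleFreq ω * s = -(ω.1 * s) + (ω.2.1 * s + ω.2.2 * s) := by
      rw [tripleFreq]; ring
    rw [h2, cis_add, cis_add, map_mul, star_cis, tripleProd]
    ring
  simp_rw [h1]
  rw [Measure.volume_eq_prod, integral_prod_mul (fun x => starRingEnd ℂ (cis (x * s) * U 0 κ.1 x))
    (fun y : ℝ × ℝ => (cis (y.1 * s) * U 1 κ.2.1 y.1) * (cis (y.2 * s) * U 2 κ.2.2 y.2)),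
    Measure.volume_eq_prod, integral_prod_mul (fun x => cis (x * s) * U 1 κ.2.1 x)
    (fun x => cis (x * s) * U 2 κ.2.2 x), integral_conj, mul_assoc]
  rfl

/-- Passing to densities produces the inverse weights of all inputs, and the factor $\langle
k_1\rangle^{1/2}$ left by the kernel removes the one at $k_1$. -/
theorem enorm_tripleProd (U : Fin 3 → ℤ → ℝ → ℂ) (κ : ℤ × ℤ × ℤ) (ω : ℝ × ℝ × ℝ) :
    jbe κ.1 (1 / 2) * ‖tripleProd U κ ω‖ₑ = jbe κ.2.1 (-(1 / 2)) * jbe κ.2.2 (-(1 / 2)) *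
      (tripleWeight κ ω * tripleDensity (fun j => ydens (U j)) κ ω) := by
  have h0 : ‖starRingEnd ℂ (U 0 κ.1 ω.1)‖ₑ = ‖U 0 κ.1 ω.1‖ₑ := by
    rw [← ofReal_norm, ← ofReal_norm, RCLike.norm_conj]
  rw [tripleProd, enorm_mul, enorm_mul, h0, enorm_eq_mul_ydens (U 0), enorm_eq_mul_ydens (U 1),
    enorm_eq_mul_ydens (U 2), tripleWeight, tripleDensity]
  have h1 := jbe_mul_neg κ.1 (1 / 2)
  generalize jbe κ.1 (1 / 2) = x at *
  generalize jbe κ.1 (-(1 / 2)) = y at *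
  have h2 : ∀ z w : ℝ≥0∞, x * (y * z * w) = z * w := fun z w => by
    rw [← mul_assoc, ← mul_assoc, h1, one_mul]
  rw [h2]
  ring

theorem exists_enorm_duhamelTerm_le (η : SchwartzMap ℝ ℂ) : ∃ C : ℝ, 0 ≤ C ∧
    ∀ (k : ℤ) (κ : ℤ × ℤ × ℤ), Nonresonant k κ → ∀ (c : ℂ) (B θ T ξ : ℝ)
      (U : Fin 3 → ℤ → ℝ → ℂ), ‖c‖ ≤ B → 0 ≤ θ → θ ≤ 1 → 0 < T → T ≤ 1 →
      jbe k (1 / 2) * jbe (ξ + (k : ℝ) ^ 2) (1 / 2) * ‖(κ.1 : ℂ) * c * duhamelTerm η T U k κ ξ‖ₑ ≤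
      ENNReal.ofReal (C * B * T ^ θ) * (jbe κ.2.1 (-(1 / 2)) * jbe κ.2.2 (-(1 / 2)) *
        ∫⁻ ω, tripleWeight κ ω * tripleDensity (fun j => ydens (U j)) κ ω *
          jbe (outMod ξ ω) (-1 + θ)) := by
  obtain ⟨C, hC0, hC⟩ := exists_weighted_kernel_le η
  refine ⟨C, hC0, fun k κ hκ c B θ T ξ U hc hθ0 hθ1 hT hT1 => ?_⟩
  set W := jbe k (1 / 2) * jbe (ξ + (k : ℝ) ^ 2) (1 / 2) with hW
  have hWt : W ≠ ∞ := ENNReal.mul_ne_top (jbe_ne_top _ _) (jbe_ne_top _ _)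
  calc W * ‖(κ.1 : ℂ) * c * duhamelTerm η T U k κ ξ‖ₑ
      ≤ (W * ‖(κ.1 : ℂ) * c‖ₑ) * ∫⁻ ω, ‖tripleProd U κ ω *
          kernel η ((k : ℝ) ^ 2) (Delta k κ : ℤ) T (tripleFreq ω) ξ‖ₑ := by
        rw [enorm_mul, mul_assoc W]
        gcongr
        exact enorm_integral_le_lintegral_enorm _
    _ = ∫⁻ ω, (W * ‖(κ.1 : ℂ) * c‖ₑ) * ‖tripleProd U κ ω *
          kernel η ((k : ℝ) ^ 2) (Delta k κ : ℤ) T (tripleFreq ω) ξ‖ₑ :=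
        (lintegral_const_mul' _ _ (ENNReal.mul_ne_top hWt enorm_ne_top)).symm
    _ ≤ ∫⁻ ω, (ENNReal.ofReal (C * B * T ^ θ) * (jbe κ.2.1 (-(1 / 2)) * jbe κ.2.2 (-(1 / 2)))) *
          (tripleWeight κ ω * tripleDensity (fun j => ydens (U j)) κ ω *
          jbe (outMod ξ ω) (-1 + θ)) := by
        refine lintegral_mono fun ω => ?_
        have h1 := hC k κ hκ c B θ T ξ (tripleFreq ω) hc hθ0 hθ1 hT hT1
        rw [← outMod_eq, ← hW] at h1
        rw [enorm_mul (tripleProd U κ ω)]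
        calc _ = ‖tripleProd U κ ω‖ₑ * (W * (‖(κ.1 : ℂ) * c‖ₑ *
              ‖kernel η ((k : ℝ) ^ 2) (Delta k κ : ℤ) T (tripleFreq ω) ξ‖ₑ)) := by ring
          _ ≤ ‖tripleProd U κ ω‖ₑ * (ENNReal.ofReal (C * B * T ^ θ) *
              (jbe κ.1 (1 / 2) * jbe (outMod ξ ω) (-1 + θ))) := by gcongr
          _ = ENNReal.ofReal (C * B * T ^ θ) * jbe (outMod ξ ω) (-1 + θ) *
              (jbe κ.1 (1 / 2) * ‖tripleProd U κ ω‖ₑ) := by ring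
          _ = _ := by rw [enorm_tripleProd]; ring
    _ = _ := by
        rw [lintegral_const_mul' _ _ (ENNReal.mul_ne_top ENNReal.ofReal_ne_top
          (ENNReal.mul_ne_top (jbe_ne_top _ _) (jbe_ne_top _ _)))]
        ring

/-- The modified Duhamel operator acts on `X^{1/2,1/2}_{p,r}`, with a gain of a power of the length of
the time interval. -/
theorem Exponents.exists_duhamelSum {p δ : ℝ} (h : Exponents p δ) (η : SchwartzMap ℝ ℂ) :
    ∃ C : ℝ≥0∞, C ≠ ∞ ∧ ∀ (X : ℤ → Set (ℤ × ℤ × ℤ)), (∀ k, ∀ κ ∈ X k, Nonresonant k κ) →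
    ∀ (M : ℤ → ℤ → ℤ → ℤ → ℂ) (B : ℝ), (∀ k k₁ k₂ k₃, ‖M k k₁ k₂ k₃‖ ≤ B) →
    ∀ T : ℝ, 0 < T → T ≤ 1 → ∀ U : Fin 3 → ℤ → ℝ → ℂ, (∀ j k, Measurable (U j k)) →
      (∀ j, yPow p δ (U j) ≠ ∞) →
      (∀ k, AEStronglyMeasurable (duhamelSum X M η T U k)) ∧
      yPow p δ (duhamelSum X M η T U) ≤
        C * ENNReal.ofReal (B * T ^ gain p) ^ p * ∏ j, yPow p δ (U j) ∧
      ∀ v₁ v₂ v₃ : ℝ → L2T,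
        (∀ s, |s| ≤ T → ∀ k, xhat (v₁ s) k = timeCoef (U 0) k s) →
        (∀ s, |s| ≤ T → ∀ k, xhat (v₂ s) k = timeCoef (U 1) k s) →
        (∀ s, |s| ≤ T → ∀ k, xhat (v₃ s) k = timeCoef (U 2) k s) →
        ∀ k t, |t| ≤ T →
          (∀ κ : X k, IntervalIntegrable (EYIntegrand η v₁ v₂ v₃ k t κ) volume 0 t) ∧
          Summable (fun κ : X k => EYTerm M η v₁ v₂ v₃ k t κ) ∧
          EY X M η v₁ v₂ v₃ k t = timeCoef (duhamelSum X M η T U) k t := by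
  obtain ⟨C₁, hC₁, hbd⟩ := exists_enorm_duhamelTerm_le η
  obtain ⟨C₂, hC₂, htri⟩ := h.exists_trilinear_le
  obtain ⟨C₃, hC₃, hhol⟩ := h.exists_lintegral_le
  have hp : 0 < p := by linarith [h.two_le]
  have hr := h.rY_pos
  refine ⟨C₂ * ENNReal.ofReal C₁ ^ p, ENNReal.mul_ne_top hC₂
    (ENNReal.rpow_ne_top_of_nonneg hp.le ENNReal.ofReal_ne_top), ?_⟩
  intro X hX M B hM T hT hT1 U hUm hUp
  have hB : 0 ≤ B := (norm_nonneg _).trans (hM 0 0 0 0)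
  have hUi : ∀ j k, Integrable (U j k) := fun j k =>
    h.integrable_of_yPow (hUm j k).aestronglyMeasurable (hUp j)
  set A := ENNReal.ofReal (C₁ * B * T ^ gain p) with hA
  -- $A\,Q$ majorizes the weighted sum of the absolute values of all terms, so a single estimate on
  -- $Q$ serves both convergence and the norm bound.
  set Q : ℤ → ℝ → ℝ≥0∞ := fun k ξ => ∑' κ : X k, jbe κ.1.2.1 (-(1 / 2)) * jbe κ.1.2.2 (-(1 / 2)) *
        ∫⁻ ω, tripleWeight κ ω * tripleDensity (fun j => ydens (U j)) κ ω *
          jbe (outMod ξ ω) (-1 + gain p) with hQ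
  have hQb : ∑' k, (∫⁻ ξ, Q k ξ ^ rY δ) ^ (p / rY δ) ≤ C₂ * ∏ j, yPow p δ (U j) :=
    htri X hX _ fun j k => measurable_ydens (hUm j k)
  have hQtop : ∑' k, (∫⁻ ξ, Q k ξ ^ rY δ) ^ (p / rY δ) ≠ ∞ :=
    ne_top_of_le_ne_top (ENNReal.mul_ne_top hC₂ (ENNReal.prod_ne_top fun j _ => hUp j)) hQb
  have hQm : ∀ k, Measurable (Q k) := by
    intro k
    refine Measurable.tsum fun κ => Measurable.const_mul ?_ _
    refine Measurable.lintegral_prod_right' (f := fun z : ℝ × ℝ × ℝ × ℝ => tripleWeight κ z.2 *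
      tripleDensity (fun j => ydens (U j)) κ z.2 * jbe (outMod z.1 z.2) (-1 + gain p)) ?_
    exact (((measurable_tripleWeight _).comp measurable_snd).mul
      ((measurable_tripleDensity (fun j k => measurable_ydens (hUm j k)) _).comp
        measurable_snd)).mul ((measurable_jbe _).comp measurable_outMod)
  set F : ∀ k, X k → ℝ → ℂ := fun k κ ξ =>
    (κ.1.1 : ℂ) * M k κ.1.1 κ.1.2.1 κ.1.2.2 * duhamelTerm η T U k κ ξ with hF
  have hsum : ∀ (k : ℤ) (ξ : ℝ), jbe k (1 / 2) * jbe (ξ + (k : ℝ) ^ 2) (1 / 2) * ∑' κ, ‖F k κ ξ‖ₑ ≤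
      A * Q k ξ := by
    intro k ξ
    rw [hQ, ← ENNReal.tsum_mul_left, ← ENNReal.tsum_mul_left]
    exact ENNReal.tsum_le_tsum fun κ => hbd k κ (hX k κ κ.2) _ B (gain p) T ξ U (hM _ _ _ _)
      h.gain_pos.le (h.gain_le.trans (by norm_num)) hT hT1
  have hduh : ∀ k (κ : X k), _ := fun k κ => duhamel_fourier η volume
    (integrable_tripleProd hUi κ.1) measurable_tripleFreq (a := (k : ℝ) ^ 2)
    (D := (Delta k κ : ℤ)) hT hT1 (hX k κ κ.2).one_le_abs_Delta
  have hFm : ∀ k κ, AEStronglyMeasurable (F k κ) := fun k κ =>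
    (hduh k κ).1.1.const_mul _
  -- Absolute summability in $L^1_\xi$ gives convergence for almost every $\xi$, hence measurability
  -- of the sum, and also the summability at each time and the interchange of sum and inverse
  -- transform. The weight $\langle k\rangle^{1/2}\ge1$ is simply dropped.
  have hFsum : ∀ k, ∑' κ, ∫⁻ ξ, ‖F k κ ξ‖ₑ ≠ ∞ := by
    intro k
    rw [← lintegral_tsum fun κ => (hFm k κ).enorm]
    refine ne_top_of_le_ne_top (b := A * ∫⁻ ξ, jbe (ξ + (k : ℝ) ^ 2) (-(1 / 2)) * Q k ξ) ?_ ?_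
    · refine ENNReal.mul_ne_top ENNReal.ofReal_ne_top (ne_top_of_le_ne_top ?_ (hhol k _
        (hQm k).aemeasurable))
      exact ENNReal.mul_ne_top hC₃ (ENNReal.rpow_lt_top_of_nonneg (by positivity)
        (h.lintegral_lt_top hQtop k).ne).ne
    · rw [← lintegral_const_mul' _ _ ENNReal.ofReal_ne_top]
      refine lintegral_mono fun ξ => ?_
      have h1 := hsum k ξ
      have h2 : (1 : ℝ≥0∞) ≤ jbe k (1 / 2) := by
        rw [← jbe_zero k]; exact jbe_mono _ (by norm_num)
      calc ∑' κ, ‖F k κ ξ‖ₑ = jbe (ξ + (k : ℝ) ^ 2) (-(1 / 2)) *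
            (1 * jbe (ξ + (k : ℝ) ^ 2) (1 / 2) * ∑' κ, ‖F k κ ξ‖ₑ) := by
            rw [one_mul, ← mul_assoc, mul_comm (jbe _ _) (jbe _ _), jbe_mul_neg, one_mul]
        _ ≤ jbe (ξ + (k : ℝ) ^ 2) (-(1 / 2)) *
            (jbe k (1 / 2) * jbe (ξ + (k : ℝ) ^ 2) (1 / 2) * ∑' κ, ‖F k κ ξ‖ₑ) := by gcongr
        _ ≤ jbe (ξ + (k : ℝ) ^ 2) (-(1 / 2)) * (A * Q k ξ) := by gcongr
        _ = _ := by ring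
  refine ⟨fun k => ?_, ?_, ?_⟩
  · -- measurability of the sum
    have hfin : ∀ᵐ ξ, ∑' κ, ‖F k κ ξ‖ₑ < ∞ := by
      refine ae_lt_top' (AEMeasurable.tsum fun κ => (hFm k κ).enorm) ?_
      rw [lintegral_tsum fun κ => (hFm k κ).enorm]
      exact hFsum k
    refine aestronglyMeasurable_of_tendsto_ae (Filter.atTop : Filter (Finset (X k)))
      (f := fun s ξ => ∑ κ ∈ s, F k κ ξ)
      (fun s => Finset.aestronglyMeasurable_fun_sum s fun κ _ => hFm k κ) ?_
    filter_upwards [hfin] with ξ hξ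
    exact (Summable.of_enorm hξ.ne).hasSum
  · calc yPow p δ (duhamelSum X M η T U)
        ≤ ∑' k, (∫⁻ ξ, (A * Q k ξ) ^ rY δ) ^ (p / rY δ) := by
          refine ENNReal.tsum_le_tsum fun k => ?_
          refine ENNReal.rpow_le_rpow (lintegral_mono fun ξ => ?_) (by positivity)
          refine ENNReal.rpow_le_rpow (le_trans ?_ (hsum k ξ)) hr.le
          rw [ydens]
          gcongr
          exact enorm_tsum_le_tsum_enorm
      _ = A ^ p * ∑' k, (∫⁻ ξ, Q k ξ ^ rY δ) ^ (p / rY δ) := by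
          rw [← ENNReal.tsum_mul_left]
          congr 1; ext k
          simp_rw [ENNReal.mul_rpow_of_nonneg _ _ hr.le]
          rw [lintegral_const_mul' _ _ (ENNReal.rpow_ne_top_of_nonneg hr.le ENNReal.ofReal_ne_top),
            ENNReal.mul_rpow_of_nonneg _ _ (by positivity), ← ENNReal.rpow_mul]
          congr 2
          field_simp
      _ ≤ A ^ p * (C₂ * ∏ j, yPow p δ (U j)) := by gcongr
      _ = _ := by
          rw [hA, mul_assoc C₁, ENNReal.ofReal_mul (by positivity),
            ENNReal.mul_rpow_of_nonneg _ _ hp.le]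
          ring
  · intro v₁ v₂ v₃ h₁ h₂ h₃ k t ht
    have hst : ∀ s ∈ Set.uIcc 0 t, |s| ≤ T := fun s hs => by
      rcases Set.mem_uIcc.mp hs with hs | hs <;> rw [abs_le] at ht ⊢ <;>
        constructor <;> linarith [hs.1, hs.2]
    have hEq : ∀ κ : X k, Set.EqOn (EYIntegrand η v₁ v₂ v₃ k t κ) (fun s =>
        cis (-((t - s) * (k : ℝ) ^ 2)) * η ((Delta k κ : ℤ) * (t - s)) *
          ∫ ω, tripleProd U κ ω * cis (tripleFreq ω * s)) (Set.uIcc 0 t) := by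
      intro κ s hs
      have hs' := hst s hs
      simp only [EYIntegrand]
      rw [integral_tripleProd_mul_cis, h₁ s hs', h₂ s hs', h₃ s hs', cis]
      congr 3
      push_cast
      ring
    have hterm : ∀ κ : X k, EYTerm M η v₁ v₂ v₃ k t κ = ∫ ξ, cis (ξ * t) * F k κ ξ := by
      intro κ
      rw [EYTerm, intervalIntegral.integral_congr (hEq κ), ← (hduh k κ).2 t ht,
        ← integral_const_mul]
      refine integral_congr_ae (Filter.Eventually.of_forall fun ξ => ?_)
      simp only [hF, duhamelTerm]
      ring
    have hFi : ∀ κ, Integrable (F k κ) := fun κ => ((hduh k κ).1).const_mul _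
    have hcm : ∀ κ, AEStronglyMeasurable fun ξ => cis (ξ * t) * F k κ ξ := fun κ =>
      ((continuous_cis.comp (continuous_id.mul continuous_const)).aestronglyMeasurable).mul (hFm k κ)
    refine ⟨fun κ => ?_, ?_, ?_⟩
    · have hc : Continuous fun s => cis (-((t - s) * (k : ℝ) ^ 2)) * η ((Delta k κ : ℤ) * (t - s)) *
          ∫ ω, tripleProd U κ ω * cis (tripleFreq ω * s) := by
        simp_rw [integral_tripleProd_mul_cis]
        refine ((continuous_cis.comp (by fun_prop)).mul (η.continuous.comp (by fun_prop))).mul ?_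
        exact ((Complex.continuous_conj.comp (continuous_timeCoef (hUi _ _))).mul
          (continuous_timeCoef (hUi _ _))).mul (continuous_timeCoef (hUi _ _))
      exact (hc.intervalIntegrable 0 t).congr fun s hs => (hEq κ (Set.uIoc_subset_uIcc hs)).symm
    · simp_rw [hterm]
      refine Summable.of_enorm (ne_top_of_le_ne_top (hFsum k) (ENNReal.tsum_le_tsum fun κ => ?_))
      refine (enorm_integral_le_lintegral_enorm _).trans (lintegral_mono fun ξ => ?_)
      rw [enorm_mul, ← ofReal_norm, norm_cis, ENNReal.ofReal_one, one_mul]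
    · rw [EY, timeCoef]
      simp_rw [hterm]
      rw [← integral_tsum hcm]
      · refine integral_congr_ae (Filter.Eventually.of_forall fun ξ => ?_)
        simp only [duhamelSum]
        rw [tsum_mul_left]
      · refine ne_top_of_le_ne_top (hFsum k) (ENNReal.tsum_le_tsum fun κ => lintegral_mono fun ξ => ?_)
        rw [enorm_mul, ← ofReal_norm, norm_cis, ENNReal.ofReal_one, one_mul]

/-! ### The sequence model of the space -/

section

/-- Weighted spacetime Fourier transforms of the elements of `X^{1/2,1/2}_{p,r}`. -/
abbrev YSeq (p δ : ℝ) [Fact (1 ≤ ENNReal.ofReal (rY δ))] : Type :=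
  lp (fun _ : ℤ => Lp ℂ (ENNReal.ofReal (rY δ)) (volume : Measure ℝ)) (ENNReal.ofReal p)

theorem Exponents.fact_rY {p δ : ℝ} (h : Exponents p δ) : Fact (1 ≤ ENNReal.ofReal (rY δ)) :=
  ⟨by rw [ENNReal.one_le_ofReal]; exact h.one_lt_rY.le⟩

theorem Exponents.fact_p {p δ : ℝ} (h : Exponents p δ) : Fact (1 ≤ ENNReal.ofReal p) :=
  ⟨by rw [ENNReal.one_le_ofReal]; linarith [h.two_le]⟩

/-- The weight of `X^{1/2,1/2}`. -/
def ywt (k : ℤ) (ξ : ℝ) : ℝ := jb k ^ (1 / 2 : ℝ) * jb (ξ + (k : ℝ) ^ 2) ^ (1 / 2 : ℝ)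

theorem ywt_pos (k : ℤ) (ξ : ℝ) : 0 < ywt k ξ :=
  mul_pos (Real.rpow_pos_of_pos (jb_pos _) _) (Real.rpow_pos_of_pos (jb_pos _) _)

theorem measurable_ywt (k : ℤ) : Measurable (ywt k) :=
  ((measurable_jb_rpow _).comp (measurable_id.add_const _)).const_mul _

theorem enorm_ywt_mul (U : ℤ → ℝ → ℂ) (k : ℤ) (ξ : ℝ) :
    ‖(ywt k ξ : ℂ) * U k ξ‖ₑ = ydens U k ξ := by
  rw [enorm_mul, ← ofReal_norm, Complex.norm_real, Real.norm_of_nonneg (ywt_pos _ _).le, ywt,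
    ENNReal.ofReal_mul (Real.rpow_nonneg (jb_pos _).le _)]
  rfl

theorem Exponents.eLpNorm_ywt_mul {p δ : ℝ} (h : Exponents p δ) (U : ℤ → ℝ → ℂ) (k : ℤ) :
    eLpNorm (fun ξ => (ywt k ξ : ℂ) * U k ξ) (ENNReal.ofReal (rY δ)) volume =
      (∫⁻ ξ, ydens U k ξ ^ rY δ) ^ (1 / rY δ) := by
  rw [eLpNorm_eq_lintegral_rpow_enorm_toReal (by simpa using h.rY_pos) ENNReal.ofReal_ne_top,
    ENNReal.toReal_ofReal h.rY_pos.le]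
  simp_rw [enorm_ywt_mul]

theorem Exponents.fourierSideNorm_eq {p δ : ℝ} (h : Exponents p δ) (U : ℤ → ℝ → ℂ) :
    fourierSideNorm (1 / 2) (1 / 2) p (1 / (1 / 2 + δ)) U = yPow p δ U ^ (1 / p) := by
  rw [fourierSideNorm, yPow]
  congr 2
  ext k
  have h1 := h.eLpNorm_ywt_mul U k
  rw [rY] at h1
  rw [rY, div_eq_mul_one_div p, mul_comm p, ENNReal.rpow_mul, ← h1]
  rfl

theorem yPow_congr {p δ : ℝ} {U V : ℤ → ℝ → ℂ} (hUV : ∀ k, U k =ᵐ[volume] V k) :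
    yPow p δ U = yPow p δ V := by
  rw [yPow, yPow]
  congr 1
  ext k
  congr 1
  refine lintegral_congr_ae ?_
  filter_upwards [hUV k] with ξ hξ
  rw [ydens, ydens, hξ]

theorem timeCoef_congr {U V : ℤ → ℝ → ℂ} {k : ℤ} (hUV : U k =ᵐ[volume] V k) (t : ℝ) :
    timeCoef U k t = timeCoef V k t := by
  refine integral_congr_ae ?_
  filter_upwards [hUV] with ξ hξ
  rw [hξ]

section

variable {p δ : ℝ} [Fact (1 ≤ ENNReal.ofReal (rY δ))]

/-- The spacetime Fourier transform which belongs to a weighted one. -/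
def ofSeq (e : YSeq p δ) (k : ℤ) (ξ : ℝ) : ℂ := ((ywt k ξ)⁻¹ : ℝ) * e k ξ

theorem measurable_ofSeq (e : YSeq p δ) (k : ℤ) : Measurable (ofSeq e k) :=
  (Complex.measurable_ofReal.comp (measurable_ywt k).inv).mul (Lp.stronglyMeasurable (e k)).measurable

theorem ywt_mul_ofSeq (e : YSeq p δ) (k : ℤ) (ξ : ℝ) : (ywt k ξ : ℂ) * ofSeq e k ξ = e k ξ := by
  rw [ofSeq, ← mul_assoc, ← Complex.ofReal_mul, mul_inv_cancel₀ (ywt_pos k ξ).ne', Complex.ofReal_one,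
    one_mul]

theorem Exponents.enorm_apply (h : Exponents p δ) (e : YSeq p δ) (k : ℤ) :
    ‖e k‖ₑ = (∫⁻ ξ, ydens (ofSeq e) k ξ ^ rY δ) ^ (1 / rY δ) := by
  rw [← h.eLpNorm_ywt_mul, Lp.enorm_def]
  simp_rw [ywt_mul_ofSeq]

theorem Exponents.yPow_ofSeq [Fact (1 ≤ ENNReal.ofReal p)] (h : Exponents p δ) (e : YSeq p δ) :
    yPow p δ (ofSeq e) = ‖e‖ₑ ^ p := by
  have hp : 0 < p := by linarith [h.two_le]
  have hp' : (ENNReal.ofReal p).toReal = p := ENNReal.toReal_ofReal hp.le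
  have h1 := lp.norm_rpow_eq_tsum (by rwa [hp']) e
  have h2 := (lp.memℓp e).summable (by rwa [hp'])
  rw [hp'] at h1 h2
  rw [← ofReal_norm, ENNReal.ofReal_rpow_of_nonneg (norm_nonneg _) hp.le, h1,
    ENNReal.ofReal_tsum_of_nonneg (fun k => by positivity) h2, yPow]
  congr 1
  ext k
  rw [← ENNReal.ofReal_rpow_of_nonneg (norm_nonneg _) hp.le, ofReal_norm, h.enorm_apply,
    ← ENNReal.rpow_mul]
  congr 1
  ring

theorem Exponents.exists_seq (h : Exponents p δ) {U : ℤ → ℝ → ℂ}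
    (hm : ∀ k, AEStronglyMeasurable (U k)) (hU : yPow p δ U ≠ ∞) :
    ∃ e : YSeq p δ, ∀ k, ofSeq e k =ᵐ[volume] U k := by
  have hp : 0 < p := by linarith [h.two_le]
  have hp' : (ENNReal.ofReal p).toReal = p := ENNReal.toReal_ofReal hp.le
  have hL : ∀ k, MemLp (fun ξ => (ywt k ξ : ℂ) * U k ξ) (ENNReal.ofReal (rY δ)) volume := fun k =>
    ⟨(Complex.measurable_ofReal.comp (measurable_ywt k)).aestronglyMeasurable.mul (hm k), by
      rw [h.eLpNorm_ywt_mul]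
      exact ENNReal.rpow_lt_top_of_nonneg (by have := h.rY_pos; positivity)
        (h.lintegral_lt_top hU k).ne⟩
  have hmem : Memℓp (fun k => (hL k).toLp) (ENNReal.ofReal p) := by
    refine memℓp_gen ?_
    rw [hp']
    have h1 : ∑' k, ENNReal.ofReal (‖(hL k).toLp‖ ^ p) ≠ ∞ := by
      convert hU using 1
      rw [yPow]
      congr 1
      ext k
      rw [← ENNReal.ofReal_rpow_of_nonneg (norm_nonneg _) hp.le, ofReal_norm, Lp.enorm_toLp,
        h.eLpNorm_ywt_mul, ← ENNReal.rpow_mul]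
      congr 1
      ring
    have h2 := ENNReal.summable_toReal h1
    refine h2.congr fun k => ?_
    rw [ENNReal.toReal_ofReal (by positivity)]
  refine ⟨⟨_, hmem⟩, fun k => ?_⟩
  filter_upwards [(hL k).coeFn_toLp] with ξ hξ
  rw [ofSeq]
  simp only
  rw [hξ, ← mul_assoc, ← Complex.ofReal_mul, inv_mul_cancel₀ (ywt_pos k ξ).ne', Complex.ofReal_one,
    one_mul]

theorem Exponents.integrable_ofSeq [Fact (1 ≤ ENNReal.ofReal p)] (h : Exponents p δ) (e : YSeq p δ) (k : ℤ) :
    Integrable (ofSeq e k) :=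
  h.integrable_of_yPow (measurable_ofSeq e k).aestronglyMeasurable (by
    rw [h.yPow_ofSeq]
    exact ENNReal.rpow_ne_top_of_nonneg (by linarith [h.two_le]) enorm_ne_top)

/-- The `k`-th spatial coefficient at time `t`. -/
def seqCoef (e : YSeq p δ) (k : ℤ) (t : ℝ) : ℂ := timeCoef (ofSeq e) k t

/-- The $L^1_\xi$ norm of the transform bounds the coefficient at every time. The decay in $k$ is
kept because it makes the values square summable. -/
theorem Exponents.exists_enorm_seqCoef_le (h : Exponents p δ) : ∃ C : ℝ, 0 ≤ C ∧
    ∀ (e : YSeq p δ) (k : ℤ) (t : ℝ), ‖seqCoef e k t‖ ≤ C * (jb k ^ (-(1 / 2) : ℝ) * ‖e k‖) := by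
  obtain ⟨C, hC, hle⟩ := h.exists_lintegral_enorm_le
  refine ⟨C.toReal, ENNReal.toReal_nonneg, fun e k t => ?_⟩
  have h1 : ‖seqCoef e k t‖ₑ ≤ C * (jbe k (-(1 / 2)) * ‖e k‖ₑ) := by
    rw [h.enorm_apply]
    refine le_trans ?_ (hle (ofSeq e) k (measurable_ofSeq e k).aestronglyMeasurable)
    refine (enorm_integral_le_lintegral_enorm _).trans (lintegral_mono fun ξ => ?_)
    rw [enorm_mul, ← ofReal_norm, norm_cis, ENNReal.ofReal_one, one_mul]
  have h2 := ENNReal.toReal_mono (ENNReal.mul_ne_top hC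
    (ENNReal.mul_ne_top (jbe_ne_top _ _) enorm_ne_top)) h1
  rwa [toReal_enorm, ENNReal.toReal_mul, ENNReal.toReal_mul, toReal_enorm, jbe,
    ENNReal.toReal_ofReal (Real.rpow_nonneg (jb_pos _).le _)] at h2

theorem Exponents.exists_norm_seqCoef_le [Fact (1 ≤ ENNReal.ofReal p)] (h : Exponents p δ) :
    ∃ C : ℝ, 0 ≤ C ∧ ∀ (e : YSeq p δ) (k : ℤ) (t : ℝ), ‖seqCoef e k t‖ ≤ C * ‖e‖ := by
  obtain ⟨C, hC, hle⟩ := h.exists_enorm_seqCoef_le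
  refine ⟨C, hC, fun e k t => (hle e k t).trans ?_⟩
  gcongr
  have h1 : jb k ^ (-(1 / 2) : ℝ) ≤ 1 :=
    Real.rpow_le_one_of_one_le_of_nonpos (one_le_jb _) (by norm_num)
  have h2 : ‖e k‖ ≤ ‖e‖ := lp.norm_apply_le_norm (by
    have := h.two_le
    simp; linarith) e k
  calc _ ≤ 1 * ‖e k‖ := by gcongr
    _ ≤ ‖e‖ := by rwa [one_mul]

theorem Exponents.seqCoef_add [Fact (1 ≤ ENNReal.ofReal p)] (h : Exponents p δ) (e e' : YSeq p δ) (k : ℤ) (t : ℝ) :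
    seqCoef (e + e') k t = seqCoef e k t + seqCoef e' k t := by
  have hi : ∀ e : YSeq p δ, Integrable fun ξ => cis (ξ * t) * ofSeq e k ξ := fun e =>
    (h.integrable_ofSeq e k).bdd_mul (c := 1)
      (continuous_cis.comp (continuous_id.mul continuous_const)).aestronglyMeasurable
      (Filter.Eventually.of_forall fun ξ => (norm_cis _).le)
  rw [seqCoef, seqCoef, seqCoef, timeCoef, timeCoef, timeCoef, ← integral_add (hi e) (hi e')]
  refine integral_congr_ae ?_
  filter_upwards [Lp.coeFn_add (e k) (e' k)] with ξ hξ
  rw [ofSeq, lp.coeFn_add, Pi.add_apply, hξ, Pi.add_apply, ofSeq, ofSeq]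
  ring

/-- Spatial coefficients as additive maps. -/
def Exponents.seqCoefHom [Fact (1 ≤ ENNReal.ofReal p)] (h : Exponents p δ) (k : ℤ) (t : ℝ) : YSeq p δ →+ ℂ :=
  AddMonoidHom.mk' (fun e => seqCoef e k t) fun e e' => h.seqCoef_add e e' k t

/-- A Young inequality that remains valid at $p=2$. The threshold $x=\langle y\rangle^{-1/p}$ is
where $\langle y\rangle^{-1}=x^p$: below it $x^2\le\langle y\rangle^{-2/p}$, above it $\langle
y\rangle^{-1}\le x^{p-2}$. -/
theorem jb_inv_mul_sq_le {p : ℝ} (hp : 2 ≤ p) (y : ℝ) {x : ℝ} (hx : 0 ≤ x) :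
    jb y ^ (-1 : ℝ) * x ^ 2 ≤ jb y ^ (-(1 + 2 / p)) + x ^ p := by
  have hj := jb_pos y
  have hp0 : 0 < p := by linarith
  rcases le_or_gt x (jb y ^ (-(1 / p))) with h1 | h1
  · have h2 : jb y ^ (-1 : ℝ) * x ^ 2 ≤ jb y ^ (-1 : ℝ) * (jb y ^ (-(1 / p))) ^ 2 := by gcongr
    refine h2.trans ?_
    rw [← Real.rpow_mul_natCast hj.le, ← Real.rpow_add hj]
    have : -1 + -(1 / p) * ((2 : ℕ) : ℝ) = -(1 + 2 / p) := by push_cast; ring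
    rw [this]
    have := Real.rpow_nonneg hx p
    linarith
  · have hx0 : 0 < x := (Real.rpow_pos_of_pos hj _).trans h1
    have h2 : jb y ^ (-1 : ℝ) ≤ x ^ (p - 2) := by
      calc jb y ^ (-1 : ℝ) ≤ jb y ^ (-(1 / p) * (p - 2)) := by
            refine Real.rpow_le_rpow_of_exponent_le (one_le_jb y) ?_
            have : -(1 / p) * (p - 2) = -1 + 2 / p := by field_simp; ring
            rw [this]
            have : 0 ≤ 2 / p := by positivity
            linarith
        _ = (jb y ^ (-(1 / p))) ^ (p - 2) := Real.rpow_mul hj.le _ _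
        _ ≤ x ^ (p - 2) := Real.rpow_le_rpow (by positivity) h1.le (by linarith)
    calc jb y ^ (-1 : ℝ) * x ^ 2 ≤ x ^ (p - 2) * x ^ 2 := by gcongr
      _ = x ^ p := by rw [← Real.rpow_add_natCast hx0.ne']; congr 1; push_cast; ring
      _ ≤ _ := le_add_of_nonneg_left (by positivity)

/-- The coefficients are $O(\langle k\rangle^{-1/2}\|e_k\|)$, and their squares are summable by
`jb_inv_mul_sq_le` since $1+2/p>1$. They therefore define an element of $L^2(\mathbb T)$ at every
time. -/
theorem Exponents.exists_fun (h : Exponents p δ) (e : YSeq p δ) :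
    ∃ u : ℝ → L2T, ∀ t k, xhat (u t) k = seqCoef e k t := by
  obtain ⟨C, hC, hle⟩ := h.exists_enorm_seqCoef_le
  have hp : 0 < p := by linarith [h.two_le]
  have hp' : (ENNReal.ofReal p).toReal = p := ENNReal.toReal_ofReal hp.le
  have h2 := (lp.memℓp e).summable (by rwa [hp'])
  rw [hp'] at h2
  have hmem : ∀ t, Memℓp (fun k => seqCoef e k t) 2 := by
    intro t
    refine memℓp_gen ?_
    have hs : Summable fun k : ℤ => C ^ 2 * (jb k ^ (-(1 + 2 / p)) + ‖e k‖ ^ p) :=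
      ((summable_jb_rpow (by have : 0 < 2 / p := by positivity
                             linarith)).add h2).mul_left _
    refine hs.of_nonneg_of_le (fun k => by positivity) fun k => ?_
    simp only [ENNReal.toReal_ofNat, Real.rpow_ofNat]
    calc ‖seqCoef e k t‖ ^ 2 ≤ (C * (jb k ^ (-(1 / 2) : ℝ) * ‖e k‖)) ^ 2 := by
          gcongr; exact hle e k t
      _ = C ^ 2 * (jb k ^ (-1 : ℝ) * ‖e k‖ ^ 2) := by
          rw [mul_pow, mul_pow, ← Real.rpow_mul_natCast (jb_pos _).le]
          norm_num
      _ ≤ _ := by gcongr; exact jb_inv_mul_sq_le h.two_le _ (norm_nonneg _)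
  refine ⟨fun t => fourierBasis.repr.symm ⟨_, hmem t⟩, fun t k => ?_⟩
  rw [xhat, ← fourierBasis_repr, LinearIsometryEquiv.apply_symm_apply]

end

theorem xhat_injective {u v : L2T} (huv : ∀ k, xhat u k = xhat v k) : u = v := by
  apply fourierBasis.repr.injective
  ext k
  rw [fourierBasis_repr, fourierBasis_repr]
  exact huv k

theorem xhat_add (u v : L2T) (k : ℤ) : xhat (u + v) k = xhat u k + xhat v k := by
  rw [xhat, xhat, xhat, ← fourierBasis_repr, ← fourierBasis_repr, ← fourierBasis_repr, map_add]
  rfl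

theorem xhat_sub (u v : L2T) (k : ℤ) : xhat (u - v) k = xhat u k - xhat v k := by
  rw [xhat, xhat, xhat, ← fourierBasis_repr, ← fourierBasis_repr, ← fourierBasis_repr, map_sub]
  rfl

end

/-! ### The complete normed group $Y_0(I)$ -/

section

theorem exp_eq_cis (ξ t : ℝ) : Complex.exp (Complex.I * (ξ : ℂ) * (t : ℂ)) = cis (ξ * t) := by
  rw [cis]
  congr 1
  push_cast
  ring

theorem hasSpacetimeFourier_iff {u : ℝ → L2T} {U : ℤ → ℝ → ℂ} :
    HasSpacetimeFourier u U ↔ ∀ k, Integrable (U k) ∧ ∀ t, xhat (u t) k = timeCoef U k t := by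
  simp_rw [HasSpacetimeFourier, timeCoef, exp_eq_cis]

section

variable {p δ : ℝ} [Fact (1 ≤ ENNReal.ofReal (rY δ))] [Fact (1 ≤ ENNReal.ofReal p)]

/-- The function `u` on `[-T, T]` is given by the weighted Fourier transform `e`. -/
def Represents {T : ℝ} (e : YSeq p δ) (u : OnI T) : Prop :=
  ∀ (t : Set.Icc (-T) T) (k : ℤ), xhat (u t) k = seqCoef e k t

theorem Exponents.Y0NormI_le (h : Exponents p δ) {T : ℝ} {e : YSeq p δ} {u : OnI T}
    (hu : Represents e u) : Y0NormI p δ u ≤ ‖e‖ₑ := by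
  have hp : 0 < p := by linarith [h.two_le]
  obtain ⟨V, hV⟩ := h.exists_fun e
  refine (iInf₂_le V fun t => xhat_injective fun k => by rw [hV, hu]).trans ?_
  refine (iInf₂_le (ofSeq e) (hasSpacetimeFourier_iff.mpr fun k =>
    ⟨h.integrable_ofSeq e k, fun t => hV t k⟩)).trans (le_of_eq ?_)
  rw [h.fourierSideNorm_eq, h.yPow_ofSeq, ← ENNReal.rpow_mul, mul_one_div_cancel hp.ne',
    ENNReal.rpow_one]

/-- Converse of `Exponents.Y0NormI_le`: together they say that the norm of $Y_0(I)$ is the quotient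
norm of the sequence space. The inequality is strict because the infimum need not be attained. -/
theorem Exponents.exists_represents (h : Exponents p δ) {T : ℝ} {u : OnI T} {c : ℝ≥0∞}
    (hu : Y0NormI p δ u < c) : ∃ e : YSeq p δ, Represents e u ∧ ‖e‖ₑ < c := by
  have hp : 0 < p := by linarith [h.two_le]
  simp only [Y0NormI, restrictedNorm, Y0Norm, XNorm, iInf_lt_iff] at hu
  obtain ⟨V, hV, U, hU, hc⟩ := hu
  rw [h.fourierSideNorm_eq] at hc
  rw [hasSpacetimeFourier_iff] at hU
  have htop : yPow p δ U ≠ ∞ := fun h1 => by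
    rw [h1, ENNReal.top_rpow_of_pos (by positivity)] at hc
    exact not_top_lt hc
  obtain ⟨e, he⟩ := h.exists_seq (fun k => (hU k).1.1) htop
  refine ⟨e, fun t k => ?_, ?_⟩
  · rw [← hV, (hU k).2, seqCoef, timeCoef_congr (he k)]
  · have h1 := h.yPow_ofSeq e
    rw [yPow_congr he] at h1
    rwa [h1, ← ENNReal.rpow_mul, mul_one_div_cancel hp.ne', ENNReal.rpow_one] at hc

theorem Exponents.represents_add (h : Exponents p δ) {T : ℝ} {e e' : YSeq p δ} {u u' : OnI T}
    (hu : Represents e u) (hu' : Represents e' u') : Represents (e + e') (u + u') := fun t k => by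
  rw [h.seqCoef_add, Pi.add_apply, xhat_add, hu, hu']

theorem Exponents.represents_zero (h : Exponents p δ) (T : ℝ) :
    Represents (0 : YSeq p δ) (0 : OnI T) := fun t k => by
  have h1 : xhat 0 k = 0 := by simpa using xhat_sub 0 0 k
  have h2 : seqCoef (0 : YSeq p δ) k t = 0 := (h.seqCoefHom k t).map_zero
  rw [h2, Pi.zero_apply, h1]

theorem Exponents.represents_neg (h : Exponents p δ) {T : ℝ} {e : YSeq p δ} {u : OnI T}
    (hu : Represents e u) : Represents (-e) (-u) := fun t k => by
  have h1 : xhat (-u t) k = -xhat (u t) k := by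
    have h0 : xhat 0 k = 0 := by simpa using xhat_sub 0 0 k
    simpa [h0] using xhat_sub 0 (u t) k
  have h2 : seqCoef (-e) k t = -seqCoef e k t := (h.seqCoefHom k t).map_neg e
  rw [h2, Pi.neg_apply, h1, hu]

end

variable {p δ : ℝ}

theorem Exponents.Y0NormI_add_le (h : Exponents p δ) {T : ℝ} (u v : OnI T) :
    Y0NormI p δ (u + v) ≤ Y0NormI p δ u + Y0NormI p δ v := by
  have := h.fact_rY
  have := h.fact_p
  refine ENNReal.le_of_forall_pos_le_add fun ε hε hlt => ?_
  obtain ⟨hu, hv⟩ := ENNReal.add_lt_top.mp hlt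
  have hε' : ((ε / 2 : ℝ≥0) : ℝ≥0∞) ≠ 0 := by simpa using hε.ne'
  obtain ⟨e, he, hle⟩ := h.exists_represents (ENNReal.lt_add_right hu.ne hε')
  obtain ⟨e', he', hle'⟩ := h.exists_represents (ENNReal.lt_add_right hv.ne hε')
  calc Y0NormI p δ (u + v) ≤ ‖e + e'‖ₑ := h.Y0NormI_le (h.represents_add he he')
    _ ≤ ‖e‖ₑ + ‖e'‖ₑ := enorm_add_le _ _
    _ ≤ (Y0NormI p δ u + (ε / 2 : ℝ≥0)) + (Y0NormI p δ v + (ε / 2 : ℝ≥0)) :=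
        add_le_add hle.le hle'.le
    _ = Y0NormI p δ u + Y0NormI p δ v + (ε / 2 + ε / 2 : ℝ≥0) := by push_cast; ring
    _ = _ := by rw [add_halves]

theorem Exponents.Y0NormI_neg_le (h : Exponents p δ) {T : ℝ} (u : OnI T) :
    Y0NormI p δ (-u) ≤ Y0NormI p δ u := by
  have := h.fact_rY
  have := h.fact_p
  refine le_of_forall_gt_imp_ge_of_dense fun c hc => ?_
  obtain ⟨e, he, hle⟩ := h.exists_represents hc
  refine (h.Y0NormI_le (h.represents_neg he)).trans ?_
  rw [enorm_neg]
  exact hle.le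

theorem Exponents.Y0NormI_zero (h : Exponents p δ) (T : ℝ) : Y0NormI p δ (0 : OnI T) = 0 := by
  have := h.fact_rY
  have := h.fact_p
  refine le_antisymm ((h.Y0NormI_le (h.represents_zero T)).trans ?_) zero_le
  rw [enorm_zero]

/-- Every coefficient at a given time is bounded by the norm of any representing sequence, and here
these norms can be made arbitrarily small. -/
theorem Exponents.eq_zero_of_Y0NormI (h : Exponents p δ) {T : ℝ} {u : OnI T}
    (hu : Y0NormI p δ u = 0) : u = 0 := by
  have := h.fact_rY
  have := h.fact_p
  obtain ⟨C, hC, hle⟩ := h.exists_norm_seqCoef_le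
  funext t
  refine xhat_injective fun k => ?_
  have h0 : xhat 0 k = 0 := by simpa using xhat_sub 0 0 k
  rw [Pi.zero_apply, h0, ← norm_le_zero_iff]
  refine le_of_forall_pos_le_add fun ε hε => ?_
  have hε' : 0 < ε / (C + 1) := by positivity
  obtain ⟨e, he, hlt⟩ := h.exists_represents (u := u) (c := ENNReal.ofReal (ε / (C + 1)))
    (by rw [hu]; exact ENNReal.ofReal_pos.mpr hε')
  rw [← ofReal_norm, ENNReal.ofReal_lt_ofReal_iff hε'] at hlt
  rw [he, zero_add]
  calc ‖seqCoef e k t‖ ≤ C * ‖e‖ := hle e k t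
    _ ≤ (C + 1) * (ε / (C + 1)) := by gcongr; linarith
    _ = ε := by field_simp

/-- The spacetime functions on `I` of finite `Y₀(I)` norm. -/
def Exponents.finiteY (h : Exponents p δ) (T : ℝ) : AddSubgroup (OnI T) where
  carrier := {u | Y0NormI p δ u < ∞}
  add_mem' hu hv := (h.Y0NormI_add_le _ _).trans_lt (ENNReal.add_lt_top.mpr ⟨hu, hv⟩)
  zero_mem' := by simp [h.Y0NormI_zero]
  neg_mem' hu := (h.Y0NormI_neg_le _).trans_lt hu

/-- The normed group `Y₀(I)`, as a type of its own since the norm is not the one inherited from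
pointwise values. -/
def Exponents.SpaceY (h : Exponents p δ) (T : ℝ) : Type := h.finiteY T

instance (h : Exponents p δ) (T : ℝ) : AddCommGroup (h.SpaceY T) :=
  inferInstanceAs (AddCommGroup (h.finiteY T))

/-- The inclusion of `Y₀(I)` in the spacetime functions on `I`. -/
def Exponents.incl (h : Exponents p δ) {T : ℝ} : h.SpaceY T →+ OnI T := (h.finiteY T).subtype

theorem Exponents.incl_injective (h : Exponents p δ) {T : ℝ} :
    Function.Injective (h.incl (T := T)) := Subtype.val_injective

theorem Exponents.incl_lt_top (h : Exponents p δ) {T : ℝ} (u : h.SpaceY T) :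
    Y0NormI p δ (h.incl u) < ∞ := u.2

theorem Exponents.exists_incl_eq (h : Exponents p δ) {T : ℝ} {u : OnI T}
    (hu : Y0NormI p δ u < ∞) : ∃ u' : h.SpaceY T, h.incl u' = u := ⟨⟨u, hu⟩, rfl⟩

instance (h : Exponents p δ) (T : ℝ) : NormedAddCommGroup (h.SpaceY T) :=
  AddGroupNorm.toNormedAddCommGroup
    { toFun := fun u => (Y0NormI p δ (h.incl u)).toReal
      map_zero' := by rw [map_zero, h.Y0NormI_zero, ENNReal.toReal_zero]
      add_le' := fun u v => by
        rw [← ENNReal.toReal_add (h.incl_lt_top u).ne (h.incl_lt_top v).ne, map_add]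
        exact ENNReal.toReal_mono (ENNReal.add_ne_top.mpr ⟨(h.incl_lt_top u).ne,
          (h.incl_lt_top v).ne⟩) (h.Y0NormI_add_le _ _)
      neg' := fun u => by
        rw [map_neg]
        refine congrArg ENNReal.toReal (le_antisymm (h.Y0NormI_neg_le _) ?_)
        simpa using h.Y0NormI_neg_le (-h.incl u)
      eq_zero_of_map_eq_zero' := fun u hu => by
        rw [ENNReal.toReal_eq_zero_iff] at hu
        refine h.incl_injective ?_
        rw [map_zero]
        exact h.eq_zero_of_Y0NormI (hu.resolve_right (h.incl_lt_top u).ne) }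

theorem Exponents.norm_eq_toReal (h : Exponents p δ) {T : ℝ} (u : h.SpaceY T) :
    ‖u‖ = (Y0NormI p δ (h.incl u)).toReal := rfl

theorem Exponents.ofReal_norm_spaceY (h : Exponents p δ) {T : ℝ} (u : h.SpaceY T) :
    ENNReal.ofReal ‖u‖ = Y0NormI p δ (h.incl u) := by
  rw [h.norm_eq_toReal, ENNReal.ofReal_toReal (h.incl_lt_top u).ne]

theorem Exponents.exists_represents_norm_lt (h : Exponents p δ)
    [Fact (1 ≤ ENNReal.ofReal (rY δ))] [Fact (1 ≤ ENNReal.ofReal p)] {T : ℝ} (u : h.SpaceY T)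
    {ε : ℝ} (hε : 0 < ε) : ∃ e : YSeq p δ, Represents e (h.incl u) ∧ ‖e‖ < ‖u‖ + ε := by
  have h1 : 0 < ‖u‖ + ε := add_pos_of_nonneg_of_pos (norm_nonneg u) hε
  obtain ⟨e, he, hlt⟩ := h.exists_represents (u := h.incl u) (c := ENNReal.ofReal (‖u‖ + ε)) (by
    rw [← h.ofReal_norm_spaceY, ENNReal.ofReal_lt_ofReal_iff h1]
    linarith)
  rw [← ofReal_norm, ENNReal.ofReal_lt_ofReal_iff h1] at hlt
  exact ⟨e, he, hlt⟩

theorem Exponents.exists_of_seq (h : Exponents p δ)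
    [Fact (1 ≤ ENNReal.ofReal (rY δ))] [Fact (1 ≤ ENNReal.ofReal p)] (T : ℝ) (e : YSeq p δ) :
    ∃ u : h.SpaceY T, Represents e (h.incl u) := by
  obtain ⟨V, hV⟩ := h.exists_fun e
  have h1 : Represents e (fun t : Set.Icc (-T) T => V t) := fun t k => hV t k
  obtain ⟨u, hu⟩ := h.exists_incl_eq ((h.Y0NormI_le h1).trans_lt enorm_lt_top)
  exact ⟨u, hu ▸ h1⟩

theorem Exponents.norm_le_of_represents (h : Exponents p δ)
    [Fact (1 ≤ ENNReal.ofReal (rY δ))] [Fact (1 ≤ ENNReal.ofReal p)] {T : ℝ} {u : h.SpaceY T}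
    {e : YSeq p δ} (he : Represents e (h.incl u)) : ‖u‖ ≤ ‖e‖ := by
  rw [h.norm_eq_toReal, ← toReal_enorm]
  exact ENNReal.toReal_mono enorm_ne_top (h.Y0NormI_le he)

/-- Completeness of a quotient: an absolutely convergent series is lifted to the sequence space with
geometric losses $2^{-n}$, summed there, and mapped back. Only the additive structure is involved.
-/
instance (h : Exponents p δ) (T : ℝ) : CompleteSpace (h.SpaceY T) := by
  have := h.fact_rY
  have := h.fact_p
  refine NormedAddCommGroup.completeSpace_of_summable_imp_tendsto fun u hu => ?_
  have hrep := fun n : ℕ => h.exists_represents_norm_lt (u n) (ε := (1 / 2) ^ n) (by positivity)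
  choose e he hle using hrep
  have hs : Summable e := by
    refine Summable.of_norm_bounded (g := fun n => ‖u n‖ + (1 / 2) ^ n)
      (hu.add summable_geometric_two) fun n => (hle n).le
  obtain ⟨v, hv⟩ := h.exists_of_seq T (∑' n, e n)
  refine ⟨v, ?_⟩
  rw [tendsto_iff_norm_sub_tendsto_zero]
  have h1 := (tendsto_iff_norm_sub_tendsto_zero.mp hs.hasSum.tendsto_sum_nat)
  refine squeeze_zero (fun _ => norm_nonneg _) (fun n => ?_) h1
  have hsum : Represents (∑ i ∈ Finset.range n, e i) (h.incl (∑ i ∈ Finset.range n, u i)) := by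
    induction n with
    | zero => simpa using h.represents_zero T
    | succ n ih =>
      rw [Finset.sum_range_succ, Finset.sum_range_succ, map_add]
      exact h.represents_add ih (he n)
  refine h.norm_le_of_represents ?_
  have := h.represents_add hsum (h.represents_neg hv)
  rw [sub_eq_add_neg, sub_eq_add_neg, map_add, map_neg]
  exact this

/-- The embedding `Z₀ ⊆ Y₀`. -/
theorem Exponents.exists_Y0NormI_le_Z0NormI (h : Exponents p δ) : ∃ C : ℝ≥0,
    ∀ (T : ℝ) (u : OnI T), Y0NormI p δ u ≤ C * Z0NormI p δ u := by
  have hp : 0 < p := by linarith [h.two_le]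
  have hδ := h.pos
  have hδ' := h.lt_one
  -- Hölder in $\xi$: $1/m=1/r_0-1/q_0$, and the spare weight $\langle\cdot\rangle^{-(1/2-2\delta)}$
  -- is in $L^m$ because $1/2-2\delta>1/2-3\delta$.
  set m : ℝ := 1 / (1 / 2 - 3 * δ) with hm
  have hm0 : 0 < m := by 
    rw [hm]
    have : 0 < 1 / 2 - 3 * δ := by linarith
    positivity
  have ht : ENNReal.HolderTriple (ENNReal.ofReal m) (ENNReal.ofReal (1 / (4 * δ)))
      (ENNReal.ofReal (1 / (1 / 2 + δ))) := by
    constructor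
    rw [← ENNReal.ofReal_inv_of_pos hm0, ← ENNReal.ofReal_inv_of_pos (by positivity),
      ← ENNReal.ofReal_inv_of_pos (by positivity), ← ENNReal.ofReal_add (by positivity)
      (by positivity), hm, inv_div, inv_div, inv_div]
    congr 1
    ring
  set I : ℝ≥0∞ := (∫⁻ ξ, jbe ξ (-(1 / 2 - 2 * δ) * m)) ^ (1 / m) with hI
  have hItop : I ≠ ∞ := by
    refine (ENNReal.rpow_lt_top_of_nonneg (by positivity) ?_).ne
    have h1 : 1 < (1 / 2 - 2 * δ) * m := by
      rw [hm, mul_one_div, _root_.one_lt_div (by linarith)]; linarith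
    have := lintegral_jbe_lt_top h1
    rw [← neg_mul] at this
    exact this.ne
  -- The summand $1$ makes the constant visibly nonzero, so that it can be moved inside the infima,
  -- which may be $\infty$.
  refine ⟨I.toNNReal + 1, fun T u => ?_⟩
  have hC0 : ((I.toNNReal + 1 : ℝ≥0) : ℝ≥0∞) ≠ 0 := by simp
  have hloc : ∀ (U : ℤ → ℝ → ℂ) (k : ℤ), AEStronglyMeasurable (U k) →
      eLpNorm (fun ξ : ℝ => ((jb (k : ℝ) ^ (1 / 2 : ℝ) * jb (ξ + (k : ℝ) ^ 2) ^ (1 / 2 : ℝ) : ℝ) : ℂ)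
        * U k ξ) (ENNReal.ofReal (1 / (1 / 2 + δ))) volume ≤
      (I.toNNReal + 1 : ℝ≥0) * eLpNorm (fun ξ : ℝ =>
        ((jb (k : ℝ) ^ (1 / 2 : ℝ) * jb (ξ + (k : ℝ) ^ 2) ^ (1 - 2 * δ) : ℝ) : ℂ)
        * U k ξ) (ENNReal.ofReal (1 / (4 * δ))) volume := by
    intro U k hU
    have hmeas : ∀ a : ℝ, Measurable fun ξ : ℝ => ((jb (ξ + (k : ℝ) ^ 2) ^ a : ℝ) : ℂ) := fun a =>
      Complex.measurable_ofReal.comp ((measurable_jb_rpow a).comp (measurable_id.add_const _))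
    have h1 := eLpNorm_smul_le_mul_eLpNorm (hpqr := ht) (μ := volume)
      (f := fun ξ : ℝ => ((jb (k : ℝ) ^ (1 / 2 : ℝ) * jb (ξ + (k : ℝ) ^ 2) ^ (1 - 2 * δ) : ℝ) : ℂ)
        * U k ξ) (φ := fun ξ : ℝ => ((jb (ξ + (k : ℝ) ^ 2) ^ (-(1 / 2 - 2 * δ)) : ℝ) : ℂ))
      (by
        simp_rw [Complex.ofReal_mul]
        exact ((hmeas _).const_mul _).aestronglyMeasurable.mul hU)
      (hmeas _).aestronglyMeasurable
    have h2 : eLpNorm (fun ξ : ℝ => ((jb (ξ + (k : ℝ) ^ 2) ^ (-(1 / 2 - 2 * δ)) : ℝ) : ℂ))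
        (ENNReal.ofReal m) volume = I := by
      rw [eLpNorm_eq_lintegral_rpow_enorm_toReal (by simpa using hm0) ENNReal.ofReal_ne_top,
        ENNReal.toReal_ofReal hm0.le, hI,
        ← lintegral_add_right_eq_self (fun ξ => jbe ξ (-(1 / 2 - 2 * δ) * m)) ((k : ℝ) ^ 2)]
      congr 1
      refine lintegral_congr fun ξ => ?_
      rw [← jbe_rpow, ← ofReal_norm, Complex.norm_real,
        Real.norm_of_nonneg (Real.rpow_nonneg (jb_pos _).le _)]
      rfl
    rw [h2] at h1
    refine le_trans (le_of_eq ?_) (h1.trans ?_)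
    · congr 1
      ext ξ
      have h3 : jb (ξ + (k : ℝ) ^ 2) ^ (1 / 2 : ℝ) = jb (ξ + (k : ℝ) ^ 2) ^ (-(1 / 2 - 2 * δ)) *
          jb (ξ + (k : ℝ) ^ 2) ^ (1 - 2 * δ) := by
        rw [← Real.rpow_add (jb_pos _)]; congr 1; ring
      rw [h3]
      simp only [Pi.smul_apply', smul_eq_mul]
      push_cast
      ring
    · gcongr
      rw [ENNReal.coe_add, ENNReal.coe_toNNReal hItop]
      exact le_self_add
  have hside : ∀ (V : ℝ → L2T) (U : ℤ → ℝ → ℂ), HasSpacetimeFourier V U →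
      fourierSideNorm (1 / 2) (1 / 2) p (1 / (1 / 2 + δ)) U ≤
      (I.toNNReal + 1 : ℝ≥0) * fourierSideNorm (1 / 2) (1 - 2 * δ) p (1 / (4 * δ)) U := by
    intro V U hU
    rw [fourierSideNorm, fourierSideNorm]
    have hroot : ((I.toNNReal + 1 : ℝ≥0) : ℝ≥0∞) =
        (((I.toNNReal + 1 : ℝ≥0) : ℝ≥0∞) ^ p) ^ (1 / p) := by
      rw [← ENNReal.rpow_mul, mul_one_div_cancel hp.ne', ENNReal.rpow_one]
    rw [hroot, ← ENNReal.mul_rpow_of_nonneg _ _ (by positivity), ← ENNReal.tsum_mul_left]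
    refine ENNReal.rpow_le_rpow (ENNReal.tsum_le_tsum fun k => ?_) (by positivity)
    rw [← ENNReal.mul_rpow_of_nonneg _ _ hp.le]
    exact ENNReal.rpow_le_rpow (hloc U k (hU k).1.1) hp.le
  rw [Z0NormI, restrictedNorm, ENNReal.mul_iInf_of_ne hC0 ENNReal.coe_ne_top]
  refine le_iInf fun V => ?_
  rw [ENNReal.mul_iInf_of_ne hC0 ENNReal.coe_ne_top]
  refine le_iInf fun hV => ?_
  rw [Z0Norm, XNorm, ENNReal.mul_iInf_of_ne hC0 ENNReal.coe_ne_top]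
  refine le_iInf fun U => ?_
  rw [ENNReal.mul_iInf_of_ne hC0 ENNReal.coe_ne_top]
  refine le_iInf fun hU => ?_
  exact (iInf₂_le V hV).trans ((iInf₂_le U hU).trans (hside V U hU))

end

/-! ### The trilinear operators on $Y_0(I)$ -/

section

theorem zeroExt_apply {T : ℝ} (v : OnI T) {s : ℝ} (hs : s ∈ Set.Icc (-T) T) :
    zeroExt v s = v ⟨s, hs⟩ := dif_pos hs

/-- The frequency sums and time integrals which define `EY` on `[-T, T]` converge. -/
def Converges (X : ℤ → Set (ℤ × ℤ × ℤ)) (M : ℤ → ℤ → ℤ → ℤ → ℂ) (η : SchwartzMap ℝ ℂ) (T : ℝ)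
    (v₁ v₂ v₃ : ℝ → L2T) : Prop :=
  ∀ t ∈ Set.Icc (-T) T, ∀ k,
    (∀ κ : X k, IntervalIntegrable (EYIntegrand η v₁ v₂ v₃ k t κ) volume 0 t) ∧
    Summable (fun κ : X k => EYTerm M η v₁ v₂ v₃ k t κ)

variable {p δ : ℝ}

theorem Exponents.exists_trilinear_of_represents (h : Exponents p δ)
    [Fact (1 ≤ ENNReal.ofReal (rY δ))] [Fact (1 ≤ ENNReal.ofReal p)] (η : SchwartzMap ℝ ℂ) :
    ∃ C : ℝ, 0 ≤ C ∧ ∀ (X : ℤ → Set (ℤ × ℤ × ℤ)), (∀ k, ∀ κ ∈ X k, Nonresonant k κ) →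
    ∀ (M : ℤ → ℤ → ℤ → ℤ → ℂ) (B : ℝ), (∀ k k₁ k₂ k₃, ‖M k k₁ k₂ k₃‖ ≤ B) →
    ∀ T : ℝ, 0 < T → T ≤ 1 → ∀ (e₁ e₂ e₃ : YSeq p δ) (v₁ v₂ v₃ : OnI T),
      Represents e₁ v₁ → Represents e₂ v₂ → Represents e₃ v₃ →
      Converges X M η T (zeroExt v₁) (zeroExt v₂) (zeroExt v₃) ∧ ∃ u : h.SpaceY T,
        (∀ (t : Set.Icc (-T) T) k, xhat (h.incl u t) k =
          EY X M η (zeroExt v₁) (zeroExt v₂) (zeroExt v₃) k t) ∧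
        ‖u‖ ≤ C * (B * T ^ gain p) * (‖e₁‖ * ‖e₂‖ * ‖e₃‖) := by
  obtain ⟨C, hC, hmain⟩ := h.exists_duhamelSum η
  have hp : 0 < p := by linarith [h.two_le]
  -- `yPow` is a $p$-th power of the norm, so its constant appears with a $p$-th root.
  refine ⟨(C ^ (1 / p)).toReal, ENNReal.toReal_nonneg, ?_⟩
  intro X hX M B hM T hT hT1 e₁ e₂ e₃ v₁ v₂ v₃ h₁ h₂ h₃
  have hB : 0 ≤ B := (norm_nonneg _).trans (hM 0 0 0 0)
  have htop : ∀ e : YSeq p δ, yPow p δ (ofSeq e) ≠ ∞ := fun e => by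
    rw [h.yPow_ofSeq]; exact ENNReal.rpow_ne_top_of_nonneg hp.le enorm_ne_top
  set e : Fin 3 → YSeq p δ := ![e₁, e₂, e₃]
  obtain ⟨hm, hle, hEY⟩ := hmain X hX M B hM T hT hT1 (fun j => ofSeq (e j))
    (fun j k => measurable_ofSeq _ k) (fun j => htop _)
  have hmem : ∀ {s : ℝ}, |s| ≤ T → s ∈ Set.Icc (-T) T := fun hs => abs_le.mp hs
  have hext : ∀ (e : YSeq p δ) (v : OnI T), Represents e v → ∀ s, |s| ≤ T → ∀ k,
      xhat (zeroExt v s) k = timeCoef (ofSeq e) k s := fun e v he s hs k => by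
    rw [zeroExt_apply v (hmem hs), he]; rfl
  have hconc := hEY _ _ _ (hext e₁ v₁ h₁) (hext e₂ v₂ h₂) (hext e₃ v₃ h₃)
  refine ⟨fun t ht k => ⟨(hconc k t (abs_le.mpr ht)).1, (hconc k t (abs_le.mpr ht)).2.1⟩, ?_⟩
  have hprod : ∏ j, yPow p δ (ofSeq (e j)) = (‖e₁‖ₑ * ‖e₂‖ₑ * ‖e₃‖ₑ) ^ p := by
    rw [Fin.prod_univ_three, ENNReal.mul_rpow_of_nonneg _ _ hp.le,
      ENNReal.mul_rpow_of_nonneg _ _ hp.le, h.yPow_ofSeq, h.yPow_ofSeq, h.yPow_ofSeq]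
    rfl
  rw [hprod] at hle
  have hfin : C * ENNReal.ofReal (B * T ^ gain p) ^ p * (‖e₁‖ₑ * ‖e₂‖ₑ * ‖e₃‖ₑ) ^ p ≠ ∞ := by
    refine ENNReal.mul_ne_top (ENNReal.mul_ne_top hC ?_) ?_
    · exact ENNReal.rpow_ne_top_of_nonneg hp.le ENNReal.ofReal_ne_top
    · exact ENNReal.rpow_ne_top_of_nonneg hp.le
        (ENNReal.mul_ne_top (ENNReal.mul_ne_top enorm_ne_top enorm_ne_top) enorm_ne_top)
  obtain ⟨e₄, he₄⟩ := h.exists_seq hm (ne_top_of_le_ne_top hfin hle)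
  obtain ⟨u, hu⟩ := h.exists_of_seq T e₄
  refine ⟨u, fun t k => ?_, (h.norm_le_of_represents hu).trans ?_⟩
  · rw [hu, seqCoef, timeCoef_congr (he₄ k), (hconc k t (abs_le.mpr t.2)).2.2]
  · rw [← yPow_congr he₄, h.yPow_ofSeq] at hle
    have h1 := ENNReal.rpow_le_rpow hle (z := 1 / p) (by positivity)
    have h2 : ∀ x : ℝ≥0∞, (x ^ p) ^ (1 / p) = x := fun x => by
      rw [← ENNReal.rpow_mul, mul_one_div_cancel hp.ne', ENNReal.rpow_one]
    rw [h2, ENNReal.mul_rpow_of_nonneg _ _ (by positivity),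
      ENNReal.mul_rpow_of_nonneg _ _ (by positivity), h2, h2] at h1
    have h3 := ENNReal.toReal_mono ?_ h1
    · simpa [ENNReal.toReal_mul, ENNReal.toReal_ofReal (mul_nonneg hB (Real.rpow_nonneg hT.le _))]
        using h3
    · refine ENNReal.mul_ne_top (ENNReal.mul_ne_top ?_ ENNReal.ofReal_ne_top)
        (ENNReal.mul_ne_top (ENNReal.mul_ne_top enorm_ne_top enorm_ne_top) enorm_ne_top)
      exact ENNReal.rpow_ne_top_of_nonneg (by positivity) hC

/-- The output depends only on the values of the inputs on $I$, not on the sequences that represent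
them. The bound can thus be taken along representatives with norms at most $\|v_j\|+\varepsilon$,
and $\varepsilon\to0$. -/
theorem Exponents.exists_trilinear_spaceY (h : Exponents p δ) (η : SchwartzMap ℝ ℂ) :
    ∃ C : ℝ, 0 ≤ C ∧ ∀ (X : ℤ → Set (ℤ × ℤ × ℤ)), (∀ k, ∀ κ ∈ X k, Nonresonant k κ) →
    ∀ (M : ℤ → ℤ → ℤ → ℤ → ℂ) (B : ℝ), (∀ k k₁ k₂ k₃, ‖M k k₁ k₂ k₃‖ ≤ B) →
    ∀ T : ℝ, 0 < T → T ≤ 1 → ∀ v₁ v₂ v₃ : h.SpaceY T,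
      Converges X M η T (zeroExt (h.incl v₁)) (zeroExt (h.incl v₂)) (zeroExt (h.incl v₃)) ∧
      ∃ u : h.SpaceY T,
        (∀ (t : Set.Icc (-T) T) k, xhat (h.incl u t) k =
          EY X M η (zeroExt (h.incl v₁)) (zeroExt (h.incl v₂)) (zeroExt (h.incl v₃)) k t) ∧
        ‖u‖ ≤ C * (B * T ^ gain p) * (‖v₁‖ * ‖v₂‖ * ‖v₃‖) := by
  have := h.fact_rY
  have := h.fact_p
  obtain ⟨C, hC, hmain⟩ := h.exists_trilinear_of_represents η
  refine ⟨C, hC, fun X hX M B hM T hT hT1 v₁ v₂ v₃ => ?_⟩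
  have hB : 0 ≤ B := (norm_nonneg _).trans (hM 0 0 0 0)
  obtain ⟨e₁, h₁, -⟩ := h.exists_represents_norm_lt v₁ one_pos
  obtain ⟨e₂, h₂, -⟩ := h.exists_represents_norm_lt v₂ one_pos
  obtain ⟨e₃, h₃, -⟩ := h.exists_represents_norm_lt v₃ one_pos
  obtain ⟨hconv, u, hu, -⟩ := hmain X hX M B hM T hT hT1 _ _ _ _ _ _ h₁ h₂ h₃
  refine ⟨hconv, u, hu, ?_⟩
  have hlim : Filter.Tendsto (fun ε : ℝ => C * (B * T ^ gain p) *
      ((‖v₁‖ + ε) * (‖v₂‖ + ε) * (‖v₃‖ + ε))) (nhdsWithin 0 (Set.Ioi 0))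
      (nhds (C * (B * T ^ gain p) * (‖v₁‖ * ‖v₂‖ * ‖v₃‖))) := by
    have hc : Continuous fun ε : ℝ => C * (B * T ^ gain p) *
      ((‖v₁‖ + ε) * (‖v₂‖ + ε) * (‖v₃‖ + ε)) := by fun_prop
    have := hc.tendsto 0
    simp only [add_zero] at this
    exact this.mono_left nhdsWithin_le_nhds
  refine ge_of_tendsto hlim (eventually_nhdsWithin_of_forall fun ε hε => ?_)
  obtain ⟨f₁, g₁, l₁⟩ := h.exists_represents_norm_lt v₁ hε
  obtain ⟨f₂, g₂, l₂⟩ := h.exists_represents_norm_lt v₂ hε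
  obtain ⟨f₃, g₃, l₃⟩ := h.exists_represents_norm_lt v₃ hε
  obtain ⟨-, u', hu', hle⟩ := hmain X hX M B hM T hT hT1 _ _ _ _ _ _ g₁ g₂ g₃
  have huu : u = u' := h.incl_injective (funext fun t => xhat_injective fun k => by rw [hu, hu'])
  rw [huu]
  refine hle.trans ?_
  have hT' : 0 ≤ T ^ gain p := Real.rpow_nonneg hT.le _
  have hε0 : 0 < ε := hε
  gcongr

/-- Convergence of the two parts has to be known beforehand, since divergent sums and integrals take
the default value $0$ and are not additive. -/
theorem EY_add {X : ℤ → Set (ℤ × ℤ × ℤ)} {M : ℤ → ℤ → ℤ → ℤ → ℂ} {η : SchwartzMap ℝ ℂ} {T : ℝ}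
    {a₁ a₂ a₃ b₁ b₂ b₃ c₁ c₂ c₃ : ℝ → L2T} (hb : Converges X M η T b₁ b₂ b₃)
    (hc : Converges X M η T c₁ c₂ c₃)
    (habc : ∀ s ∈ Set.Icc (-T) T, ∀ k t κ, EYIntegrand η a₁ a₂ a₃ k t κ s =
      EYIntegrand η b₁ b₂ b₃ k t κ s + EYIntegrand η c₁ c₂ c₃ k t κ s)
    {t : ℝ} (ht : t ∈ Set.Icc (-T) T) (k : ℤ) :
    EY X M η a₁ a₂ a₃ k t = EY X M η b₁ b₂ b₃ k t + EY X M η c₁ c₂ c₃ k t := by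
  obtain ⟨ib, sb⟩ := hb t ht k
  obtain ⟨ic, sc⟩ := hc t ht k
  rw [EY, EY, EY, ← sb.tsum_add sc]
  congr 1
  ext κ
  have hsub : Set.uIcc 0 t ⊆ Set.Icc (-T) T :=
    Set.uIcc_subset_Icc ⟨by linarith [ht.1, ht.2], by linarith [ht.1, ht.2]⟩ ht
  rw [EYTerm, EYTerm, EYTerm, intervalIntegral.integral_congr fun s hs => habc s (hsub hs) k t κ,
    intervalIntegral.integral_add (ib κ) (ic κ)]
  ring

theorem xhat_zeroExt_add {T : ℝ} (u v : OnI T) {s : ℝ} (hs : s ∈ Set.Icc (-T) T) (k : ℤ) :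
    xhat (zeroExt (u + v) s) k = xhat (zeroExt u s) k + xhat (zeroExt v s) k := by
  rw [zeroExt_apply _ hs, zeroExt_apply _ hs, zeroExt_apply _ hs, Pi.add_apply, xhat_add]

/-- A bounded map which is additive in each of its three arguments. -/
structure IsTrilinear {V : Type*} [NormedAddCommGroup V] (F : V → V → V → V) (c : ℝ) : Prop where
  add_fst : ∀ a a' u v, F (a + a') u v = F a u v + F a' u v
  add_snd : ∀ a u u' v, F a (u + u') v = F a u v + F a u' v
  add_trd : ∀ a u v v', F a u (v + v') = F a u v + F a u v'
  norm_le : ∀ a u v, ‖F a u v‖ ≤ c * (‖a‖ * ‖u‖ * ‖v‖)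

theorem Exponents.exists_isTrilinear (h : Exponents p δ) (η : SchwartzMap ℝ ℂ) :
    ∃ C : ℝ, 0 ≤ C ∧ ∀ (X : ℤ → Set (ℤ × ℤ × ℤ)), (∀ k, ∀ κ ∈ X k, Nonresonant k κ) →
    ∀ (M : ℤ → ℤ → ℤ → ℤ → ℂ) (B : ℝ), (∀ k k₁ k₂ k₃, ‖M k k₁ k₂ k₃‖ ≤ B) →
    ∀ T : ℝ, 0 < T → T ≤ 1 →
      (∀ v₁ v₂ v₃ : h.SpaceY T,
        Converges X M η T (zeroExt (h.incl v₁)) (zeroExt (h.incl v₂)) (zeroExt (h.incl v₃))) ∧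
      ∃ F : h.SpaceY T → h.SpaceY T → h.SpaceY T → h.SpaceY T,
        IsTrilinear F (C * (B * T ^ gain p)) ∧ ∀ v₁ v₂ v₃ (t : Set.Icc (-T) T) k,
          xhat (h.incl (F v₁ v₂ v₃) t) k =
            EY X M η (zeroExt (h.incl v₁)) (zeroExt (h.incl v₂)) (zeroExt (h.incl v₃)) k t := by
  obtain ⟨C, hC, hmain⟩ := h.exists_trilinear_spaceY η
  refine ⟨C, hC, fun X hX M B hM T hT hT1 => ?_⟩
  have hconv := fun v₁ v₂ v₃ => (hmain X hX M B hM T hT hT1 v₁ v₂ v₃).1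
  have hex := fun v₁ v₂ v₃ => (hmain X hX M B hM T hT hT1 v₁ v₂ v₃).2
  choose F hF hle using hex
  have hext : ∀ u v : h.SpaceY T, (∀ (t : Set.Icc (-T) T) k, xhat (h.incl u t) k =
      xhat (h.incl v t) k) → u = v := fun u v huv =>
    h.incl_injective (funext fun t => xhat_injective fun k => huv t k)
  refine ⟨hconv, F, ⟨fun a a' u v => ?_, fun a u u' v => ?_, fun a u v v' => ?_, hle⟩, hF⟩ <;>
  · refine hext _ _ fun t k => ?_
    rw [map_add, Pi.add_apply, xhat_add, hF, hF, hF]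
    refine EY_add (hconv _ _ _) (hconv _ _ _) (fun s hs k t κ => ?_) t.2 k
    simp only [EYIntegrand, map_add, xhat_zeroExt_add _ _ hs]
    ring

end

/-! ### Fixed points of trilinear equations -/

section

section

variable {V : Type*} [NormedAddCommGroup V] {F G : V → V → V → V} {c A : ℝ}

theorem IsTrilinear.norm_le_of_le (hF : IsTrilinear F c) (hc : 0 ≤ c) {a u v : V} {x y z : ℝ}
    (ha : ‖a‖ ≤ x) (hu : ‖u‖ ≤ y) (hv : ‖v‖ ≤ z) : ‖F a u v‖ ≤ c * (x * y * z) := by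
  have hx := (norm_nonneg a).trans ha
  have hy := (norm_nonneg u).trans hu
  refine (hF.norm_le a u v).trans ?_
  gcongr

theorem IsTrilinear.sub_eq (hF : IsTrilinear F c) (a a' u u' v v' : V) :
    F a u v - F a' u' v' = F (a - a') u v + F a' (u - u') v + F a' u' (v - v') := by
  have h1 : F a u v = F (a - a') u v + F a' u v := by rw [← hF.add_fst, sub_add_cancel]
  have h2 : F a' u v = F a' (u - u') v + F a' u' v := by rw [← hF.add_snd, sub_add_cancel]
  have h3 : F a' u' v = F a' u' (v - v') + F a' u' v' := by rw [← hF.add_trd, sub_add_cancel]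
  rw [h1, h2, h3]
  abel

theorem IsTrilinear.norm_sub_le (hF : IsTrilinear F c) (hc : 0 ≤ c) {a a' u u' v v' : V}
    (ha' : ‖a'‖ ≤ A) (hu : ‖u‖ ≤ A) (hu' : ‖u'‖ ≤ A) (hv : ‖v‖ ≤ A) :
    ‖F a u v - F a' u' v'‖ ≤ c * A ^ 2 * (‖a - a'‖ + ‖u - u'‖ + ‖v - v'‖) := by
  rw [hF.sub_eq]
  have h1 := hF.norm_le_of_le hc (le_refl ‖a - a'‖) hu hv
  have h2 := hF.norm_le_of_le hc ha' (le_refl ‖u - u'‖) hv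
  have h3 := hF.norm_le_of_le hc ha' hu' (le_refl ‖v - v'‖)
  refine (norm_add₃_le ..).trans ((add_le_add (add_le_add h1 h2) h3).trans (le_of_eq ?_))
  ring

/-- Solutions of `v = w + F(w, w, v) + G(w, v, v)` in a ball depend in a Lipschitz way on `w`. -/
theorem norm_sub_le_of_solves (hF : IsTrilinear F c) (hG : IsTrilinear G c) (hc : 0 ≤ c)
    (hcA : c * A ^ 2 ≤ 1 / 8) {w w' v v' : V} (hw : ‖w‖ ≤ A) (hw' : ‖w'‖ ≤ A) (hv : ‖v‖ ≤ A)
    (hv' : ‖v'‖ ≤ A) (h : v = w + F w w v + G w v v) (h' : v' = w' + F w' w' v' + G w' v' v') :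
    ‖v - v'‖ ≤ 3 * ‖w - w'‖ := by
  have h1 := hF.norm_sub_le hc (a := w) (a' := w') (u := w) (u' := w') (v := v) (v' := v')
    hw' hw hw' hv
  have h2 := hG.norm_sub_le hc (a := w) (a' := w') (u := v) (u' := v') (v := v) (v' := v')
    hw' hv hv' hv
  have h3 : v - v' = (w - w') + (F w w v - F w' w' v') + (G w v v - G w' v' v') := by
    nth_rewrite 1 [h, h']
    abel
  have h4 : ‖v - v'‖ ≤ ‖w - w'‖ + ‖F w w v - F w' w' v'‖ + ‖G w v v - G w' v' v'‖ := by
    nth_rewrite 1 [h3]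
    exact norm_add₃_le ..
  have h5 : ∀ x : ℝ, 0 ≤ x → c * A ^ 2 * x ≤ 1 / 8 * x := fun x hx => by gcongr
  -- With `h4`, the two differences give $\frac58\|v-v'\|\le\frac{11}8\|w-w'\|$, and $11/5\le3$.
  have h6 := h5 (‖w - w'‖ + ‖w - w'‖ + ‖v - v'‖) (by positivity)
  have h7 := h5 (‖w - w'‖ + ‖v - v'‖ + ‖v - v'‖) (by positivity)
  have := norm_nonneg (w - w')
  linarith

/-- The equation `v = w + F(w, w, v) + G(w, v, v)` is solvable in a ball. -/
theorem exists_solution [CompleteSpace V] (hF : IsTrilinear F c) (hG : IsTrilinear G c)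
    (hc : 0 ≤ c) (hA : 0 ≤ A) (hcA : c * A ^ 2 ≤ 1 / 8) {w : V} (hw : ‖w‖ ≤ A / 2) :
    ∃ v, ‖v‖ ≤ A ∧ v = w + F w w v + G w v v := by
  have hwA : ‖w‖ ≤ A := hw.trans (by linarith)
  set Ψ : V → V := fun v => w + F w w v + G w v v with hΨ
  have hmaps : Set.MapsTo Ψ (Metric.closedBall 0 A) (Metric.closedBall 0 A) := by
    intro v hv
    rw [mem_closedBall_zero_iff] at hv ⊢
    have h1 := hF.norm_le_of_le hc hwA hwA hv
    have h2 := hG.norm_le_of_le hc hwA hv hv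
    have h3 : c * (A * A * A) ≤ 1 / 8 * A := by
      calc c * (A * A * A) = c * A ^ 2 * A := by ring
        _ ≤ _ := by gcongr
    calc ‖Ψ v‖ ≤ ‖w‖ + ‖F w w v‖ + ‖G w v v‖ := norm_add₃_le ..
      _ ≤ A / 2 + 1 / 8 * A + 1 / 8 * A := by gcongr <;> linarith
      _ ≤ A := by linarith
  -- $F$ contributes $1/8$ to the Lipschitz constant and $G$, with two varying arguments, $2/8$.
  have hcontr : ContractingWith (1 / 2) (hmaps.restrict Ψ _ _) := by
    refine ⟨by rw [← NNReal.coe_lt_coe]; norm_num, LipschitzWith.of_dist_le_mul fun v v' => ?_⟩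
    obtain ⟨v, hv⟩ := v
    obtain ⟨v', hv'⟩ := v'
    rw [mem_closedBall_zero_iff] at hv hv'
    have h1 := hF.norm_sub_le hc (a := w) (a' := w) (u := w) (u' := w) (v := v) (v' := v')
      hwA hwA hwA hv
    have h2 := hG.norm_sub_le hc (a := w) (a' := w) (u := v) (u' := v') (v := v) (v' := v')
      hwA hv hv' hv
    rw [sub_self, norm_zero, zero_add, zero_add] at h1
    rw [sub_self, norm_zero, zero_add] at h2
    have h3 : Ψ v - Ψ v' = (F w w v - F w w v') + (G w v v - G w v' v') := by
      simp only [hΨ]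
      abel
    have h4 : c * A ^ 2 * ‖v - v'‖ ≤ 1 / 8 * ‖v - v'‖ := by gcongr
    have h5 : dist (Ψ v) (Ψ v') ≤ 1 / 2 * dist v v' := by
      rw [dist_eq_norm, dist_eq_norm, h3]
      refine (norm_add_le _ _).trans ?_
      have := norm_nonneg (v - v')
      linarith
    simpa [Subtype.dist_eq] using h5
  obtain ⟨v, hv, hfix, -⟩ := ContractingWith.exists_fixedPoint'
    Metric.isClosed_closedBall.isComplete hmaps hcontr
    (Metric.mem_closedBall_self hA) (edist_ne_top _ _)
  exact ⟨v, mem_closedBall_zero_iff.mp hv, hfix.symm⟩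

end

variable {p δ : ℝ}

theorem Exponents.mem_ballY (h : Exponents p δ) {T A : ℝ} (hA : 0 ≤ A) {v : h.SpaceY T} :
    h.incl v ∈ ballY p δ T A ↔ ‖v‖ ≤ A := by
  change Y0NormI p δ (h.incl v) ≤ _ ↔ _
  rw [← h.ofReal_norm_spaceY, ENNReal.ofReal_le_ofReal_iff hA]

theorem Exponents.exists_incl_of_mem_ballY (h : Exponents p δ) {T A : ℝ} {v : OnI T}
    (hv : v ∈ ballY p δ T A) : ∃ v' : h.SpaceY T, h.incl v' = v :=
  h.exists_incl_eq (lt_of_le_of_lt hv ENNReal.ofReal_lt_top)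

theorem exists_small_time {θ : ℝ} (hθ : 0 < θ) (K : ℝ) :
    ∃ T₀ : ℝ, 0 < T₀ ∧ T₀ ≤ 1 ∧ ∀ T, 0 < T → T ≤ T₀ → K * T ^ θ ≤ 1 / 8 := by
  have h1 : Filter.Tendsto (fun T : ℝ => K * T ^ θ) (nhds 0) (nhds 0) := by
    have := ((Real.continuous_rpow_const hθ.le).tendsto 0).const_mul K
    rwa [Real.zero_rpow hθ.ne', mul_zero] at this
  have h2 := h1.eventually (ge_mem_nhds (show (0 : ℝ) < 1 / 8 by norm_num))
  obtain ⟨ε, hε, hball⟩ := Metric.eventually_nhds_iff.mp h2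
  refine ⟨min (ε / 2) 1, by positivity, min_le_right _ _, fun T hT hTε => hball ?_⟩
  rw [Real.dist_eq, sub_zero, abs_of_pos hT]
  linarith [hTε.trans (min_le_left _ _)]

end

end DNLS

end

/-! ### The solution map -/

theorem proposition4p4 (p₀ : ℝ) (hp₀ : 2 ≤ p₀) :
    ∃ δ₀ : ℝ, 0 < δ₀ ∧ ∀ δ : ℝ, 0 < δ → δ < δ₀ →
    ∀ A₂ : ℝ, 0 < A₂ → ∃ A₃min : ℝ, 0 < A₃min ∧ ∀ A₃ : ℝ, A₃min ≤ A₃ →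
    ∀ (η : SchwartzMap ℝ ℂ) (B : ℝ),
    ∃ (L : ℝ≥0) (T₀ : ℝ), 0 < T₀ ∧ ∀ T : ℝ, 0 < T → T ≤ T₀ →
    ∀ M : ℤ → ℤ → ℤ → ℤ → ℂ, (∀ k k₁ k₂ k₃, ‖M k k₁ k₂ k₃‖ ≤ B) →
      (∀ w ∈ DNLS.ballZ p₀ δ T A₂, ∀ v ∈ DNLS.ballY p₀ δ T A₃, DNLS.EYConverges M η w v) ∧
      (∀ w ∈ DNLS.ballZ p₀ δ T A₂,
        ∃! v : DNLS.OnI T, v ∈ DNLS.ballY p₀ δ T A₃ ∧ DNLS.SolvesEq M η w v) ∧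
      ∃ Φ : DNLS.OnI T → DNLS.OnI T,
        (∀ w ∈ DNLS.ballZ p₀ δ T A₂,
          Φ w ∈ DNLS.ballY p₀ δ T A₃ ∧ DNLS.SolvesEq M η w (Φ w)) ∧
        (∀ w ∈ DNLS.ballZ p₀ δ T A₂, ∀ w' ∈ DNLS.ballZ p₀ δ T A₂,
          DNLS.Y0NormI p₀ δ (Φ w - Φ w') ≤ (L : ℝ≥0∞) * DNLS.Z0NormI p₀ δ (w - w')) ∧
        DNLS.solutionManifold p₀ δ M η T A₂ A₃ = Φ '' DNLS.ballZ p₀ δ T A₂ := by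
  refine ⟨1 / (100 * p₀), by positivity, fun δ hδ hδ₀ A₂ hA₂ => ?_⟩
  have h : DNLS.Exponents p₀ δ := ⟨hp₀, hδ, by rwa [lt_div_iff₀ (by positivity)] at hδ₀⟩
  obtain ⟨CZ, hCZ⟩ := h.exists_Y0NormI_le_Z0NormI
  -- The factor $2$ puts the data into the ball of radius $A_3/2$, leaving room for the two
  -- trilinear terms. The summand $1$ keeps the threshold positive even if the embedding constant is
  -- $0$.
  refine ⟨2 * (CZ * A₂) + 1, by positivity, fun A₃ hA₃ η B => ?_⟩
  have hA₃0 : 0 ≤ A₃ := le_trans (by positivity) hA₃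
  obtain ⟨C, hC, htri⟩ := h.exists_isTrilinear η
  obtain ⟨T₀, hT₀, hT₀1, hsmall⟩ := DNLS.exists_small_time h.gain_pos (C * B * A₃ ^ 2)
  -- The Lipschitz constant is $3$ in terms of the $Y_0(I)$ norm of the data; the embedding turns
  -- this into the $Z_0(I)$ norm.
  refine ⟨3 * CZ, T₀, hT₀, fun T hT hTT₀ M hM => ?_⟩
  have hB : 0 ≤ B := (norm_nonneg _).trans (hM 0 0 0 0)
  obtain ⟨hcN, F, hF, hFE⟩ := htri DNLS.XN (fun k κ hκ => DNLS.nonresonant_of_mem_XN hκ) M B hM T hT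
    (hTT₀.trans hT₀1)
  obtain ⟨hcL, G, hG, hGE⟩ := htri DNLS.XL (fun k κ hκ => DNLS.nonresonant_of_mem_XL hκ) M B hM T hT
    (hTT₀.trans hT₀1)
  set c := C * (B * T ^ DNLS.gain p₀) with hc
  have hc0 : 0 ≤ c := by have := Real.rpow_nonneg hT.le (DNLS.gain p₀); positivity
  have hcA : c * A₃ ^ 2 ≤ 1 / 8 := by
    refine le_trans (le_of_eq ?_) (hsmall T hT hTT₀)
    rw [hc]; ring
  have hZ : ∀ w ∈ DNLS.ballZ p₀ δ T A₂, ∃ w' : h.SpaceY T, h.incl w' = w ∧ ‖w'‖ ≤ A₃ / 2 := by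
    intro w hw
    have h1 : DNLS.Y0NormI p₀ δ w ≤ ENNReal.ofReal (CZ * A₂) := by
      rw [ENNReal.ofReal_mul CZ.coe_nonneg, ENNReal.ofReal_coe_nnreal]
      exact (hCZ T w).trans (by gcongr; exact hw)
    obtain ⟨w', rfl⟩ := h.exists_incl_of_mem_ballY h1
    refine ⟨w', rfl, ((h.mem_ballY (by positivity)).mp h1).trans (by linarith)⟩
  -- The equation is posed coefficient by coefficient, and the coefficients determine the value in
  -- $L^2(\mathbb T)$ at each time, so it becomes an identity in $Y_0(I)$.
  have hsol : ∀ w v : h.SpaceY T, DNLS.SolvesEq M η (h.incl w) (h.incl v) ↔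
      v = w + F w w v + G w v v := by
    intro w v
    constructor
    · intro hs
      refine h.incl_injective (funext fun t => DNLS.xhat_injective fun k => ?_)
      rw [hs t k, map_add, map_add, Pi.add_apply, Pi.add_apply, DNLS.xhat_add, DNLS.xhat_add, hFE, hGE]
    · intro hs t k
      have h1 := congrArg (fun u => DNLS.xhat (h.incl u t) k) hs
      simp only [map_add, Pi.add_apply, DNLS.xhat_add, hFE, hGE] at h1
      exact h1
  -- Stated for arbitrary pairs of solutions, this gives uniqueness when $w=w'$ and the Lipschitz
  -- property of the solution map otherwise.
  have hlip : ∀ w ∈ DNLS.ballZ p₀ δ T A₂, ∀ w' ∈ DNLS.ballZ p₀ δ T A₂,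
      ∀ v ∈ DNLS.ballY p₀ δ T A₃, ∀ v' ∈ DNLS.ballY p₀ δ T A₃, DNLS.SolvesEq M η w v →
      DNLS.SolvesEq M η w' v' →
      DNLS.Y0NormI p₀ δ (v - v') ≤ ((3 : ℝ≥0) : ℝ≥0∞) * DNLS.Y0NormI p₀ δ (w - w') := by
    intro w hw w' hw' v hv v' hv' hs hs'
    obtain ⟨w, rfl, hwn⟩ := hZ w hw
    obtain ⟨w', rfl, hwn'⟩ := hZ w' hw'
    obtain ⟨v, rfl⟩ := h.exists_incl_of_mem_ballY hv
    obtain ⟨v', rfl⟩ := h.exists_incl_of_mem_ballY hv'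
    have h1 := DNLS.norm_sub_le_of_solves hF hG hc0 hcA (hwn.trans (by linarith))
      (hwn'.trans (by linarith)) ((h.mem_ballY hA₃0).mp hv) ((h.mem_ballY hA₃0).mp hv')
      ((hsol w v).mp hs) ((hsol w' v').mp hs')
    rw [← map_sub, ← map_sub, ← h.ofReal_norm_spaceY, ← h.ofReal_norm_spaceY,
      ← ENNReal.ofReal_coe_nnreal, ← ENNReal.ofReal_mul (by positivity)]
    exact ENNReal.ofReal_le_ofReal h1
  have hex : ∀ w ∈ DNLS.ballZ p₀ δ T A₂,
      ∃ v, v ∈ DNLS.ballY p₀ δ T A₃ ∧ DNLS.SolvesEq M η w v := by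
    intro w hw
    obtain ⟨w, rfl, hwn⟩ := hZ w hw
    obtain ⟨v, hv, hs⟩ := DNLS.exists_solution hF hG hc0 hA₃0 hcA hwn
    exact ⟨h.incl v, (h.mem_ballY hA₃0).mpr hv, (hsol w v).mpr hs⟩
  have huniq : ∀ w ∈ DNLS.ballZ p₀ δ T A₂, ∀ v ∈ DNLS.ballY p₀ δ T A₃,
      ∀ v' ∈ DNLS.ballY p₀ δ T A₃, DNLS.SolvesEq M η w v → DNLS.SolvesEq M η w v' → v = v' := by
    intro w hw v hv v' hv' hs hs'
    have h1 := hlip w hw w hw v hv v' hv' hs hs'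
    rw [sub_self, h.Y0NormI_zero, mul_zero] at h1
    exact sub_eq_zero.mp (h.eq_zero_of_Y0NormI (le_antisymm h1 zero_le))
  refine ⟨fun w hw v hv t k => ?_, fun w hw => ?_, ?_⟩
  · obtain ⟨w, rfl, -⟩ := hZ w hw
    obtain ⟨v, rfl⟩ := h.exists_incl_of_mem_ballY hv
    have h1 := hcN w w v t t.2 k
    have h2 := hcL w v v t t.2 k
    exact ⟨h1.1, h2.1, h1.2, h2.2⟩
  · obtain ⟨v, hv, hs⟩ := hex w hw
    exact ⟨v, ⟨hv, hs⟩, fun v' hv' => huniq w hw v' hv'.1 v hv hv'.2 hs⟩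
  · choose! Φ hΦ using hex
    refine ⟨Φ, hΦ, fun w hw w' hw' => ?_, ?_⟩
    · refine (hlip w hw w' hw' _ (hΦ w hw).1 _ (hΦ w' hw').1 (hΦ w hw).2 (hΦ w' hw').2).trans ?_
      rw [ENNReal.coe_mul, mul_assoc]
      gcongr
      exact hCZ T _
    · ext v
      constructor
      -- A point of the manifold is the chosen solution for its own $w$ by uniqueness.
      · rintro ⟨hv, w, hw, hs⟩
        exact ⟨w, hw, huniq w hw _ (hΦ w hw).1 v hv (hΦ w hw).2 hs⟩
      · rintro ⟨w, hw, rfl⟩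
        exact ⟨(hΦ w hw).1, w, hw, (hΦ w hw).2⟩
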